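/- For real $x\ge 1$ put $\mathscr S(x)=\{[x/n] : n\in\mathbb Z,\ 1\le n\le x\}$ (a set, so each value is counted once). For $y,s>0$ let $\phi_{y,s}(u)=\frac{y\,u^{1-s}}{1-s}$ if $s\ne 1$ and $\phi_{y,1}(u)=y\log u$ $(u>0)$. For $N,y,s,\varepsilon>0$ and an integer $P\ge1$, let $\mathscr F(N,P,y,s,\varepsilon)$ be the set of real functions $f$ on an interval $[a,b]\subset[N,2N]$, $a<b$, that are $P$ times continuously differentiable on $[a,b]$ and satisfy $|f^{(p)}(u)-\phi_{y,s}^{(p)}(u)|\le\varepsilon\,|\phi_{y,s}^{(p)}(u)|$ for all $u\in[a,b]$ and $1\le p\le P$. A pair of real numbers $(k,\ell)$ with $0\le k\le\frac12\le\ell\le1$ is an *exponent pair* if for every $s>0$ there are an integer $P\ge1$ and an $\varepsilon>0$, depending only on $k,\ell,s$, such that for all $N,y>0$ and all $f\in\mathscr F(N,P,y,s,\varepsilon)$, with $[a,b]$ the domain of $f$, $$\sum_{a<n\le b}e^{2\pi i f(n)}\ll L^{k}N^{\ell}+L^{-1},\qquad L=yN^{-s},$$ where the implicit constant depends only on $k,\ell,s$.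 **Theorem 1.2.** Let $(k,\ell)$ be an exponent pair. Then for all real $x\ge2$, $$\#\{(m,n)\in\mathscr S(x)^2 : \gcd(m,n)=1\}=\frac{4}{\zeta(2)}\,x+O\Bigl(x^{\frac12+\frac{k+\ell}{2k+2}}\Bigr),$$ where the implicit constant depends only on $(k,\ell)$. -/

import Mathlib

/-- The set `𝒮(x) = {[x/n] : n ∈ [1,x] ∩ ℤ}`, each value being counted once. -/
noncomputable def floorQuotients (x : ℝ) : Finset ℕ :=
  (Finset.Icc 1 ⌊x⌋₊).image fun n : ℕ => ⌊x / (n : ℝ)⌋₊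

/-- The number of ordered pairs `(m, n)` of coprime elements of `𝒮(x)`. -/
noncomputable def coprimePairCount (x : ℝ) : ℕ :=
  ((floorQuotients x ×ˢ floorQuotients x).filter fun p : ℕ × ℕ => Nat.gcd p.1 p.2 = 1).card

/-- The model phase function of amplitude `y` and index `s` (used at positive arguments only). -/
noncomputable def modelPhase (y s u : ℝ) : ℝ :=
  if s = 1 then y * Real.log u else y * u ^ (1 - s) / (1 - s)

/-- `f`, restricted to `[a, b]`, is an admissible phase function of scale `N`, order `P`,
amplitude `y`, index `s` and precision `ε`. Derivatives of `f` are taken within `[a, b]`, hence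
are one-sided at the endpoints. -/
structure IsAdmissiblePhase (N : ℝ) (P : ℕ) (y s ε a b : ℝ) (f : ℝ → ℝ) : Prop where
  lt : a < b
  subset : Set.Icc a b ⊆ Set.Icc N (2 * N)
  contDiffOn : ContDiffOn ℝ (P : WithTop ℕ∞) f (Set.Icc a b)
  deriv_close : ∀ p : ℕ, 1 ≤ p → p ≤ P → ∀ u ∈ Set.Icc a b,
    |iteratedDerivWithin p f (Set.Icc a b) u - iteratedDeriv p (modelPhase y s) u|
      ≤ ε * |iteratedDeriv p (modelPhase y s) u|

/-- The exponential sum `∑_{a < n ≤ b} e(f(n))` over integers `n`, where `e(t) = exp(2πit)`. -/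
noncomputable def phaseSum (a b : ℝ) (f : ℝ → ℝ) : ℂ :=
  ∑ n ∈ Finset.Ioc ⌊a⌋ ⌊b⌋, Complex.exp (2 * Real.pi * Complex.I * (f (n : ℝ) : ℂ))

/-- Exponent pairs. The order `P`, the precision `ε` and the implied constant `C`
depend only on `k`, `l`, `s`. -/
def IsExponentPair (k l : ℝ) : Prop :=
  0 ≤ k ∧ k ≤ 1 / 2 ∧ 1 / 2 ≤ l ∧ l ≤ 1 ∧
  ∀ s : ℝ, 0 < s → ∃ P : ℕ, 1 ≤ P ∧ ∃ ε : ℝ, 0 < ε ∧ ∃ C : ℝ,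
    ∀ N y : ℝ, 0 < N → 0 < y → ∀ (a b : ℝ) (f : ℝ → ℝ),
      IsAdmissiblePhase N P y s ε a b f →
        ‖phaseSum a b f‖ ≤ C * ((y * N ^ (-s)) ^ k * N ^ l + (y * N ^ (-s))⁻¹)

/-! Let S_d be the number of multiples of d in 𝒮(x), and put θ = (k+l)/(2k+2). Möbius inversion
turns the count into ∑_{d ≤ x} μ(d) S_d² (`coprimePairCount_eq_sum`), so it suffices to know S_d
well for small d and to bound it for large d.

The set 𝒮(x) is, up to O(1) elements, the integers below √x together with the distinct values ⌊x/n⌋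
for n ≤ √x. Hence S_d is √x/d plus the number of n ≤ √x with d ∣ ⌊x/n⌋, up to O(1). The indicator of
d ∣ ⌊t⌋ is 1/d plus a difference of two sawtooths of t/d, so S_d = 2√x/d up to sawtooth sums with
argument X/n + c, where X = x/d (`abs_multipleCount_sub_le`).

The exponent pair, used only for the phase y/n, bounds these sums by x^θ d^(-κ) + d with κ = k/(k+1)
when k < l. For d ≤ x^(1/2-θ) the error in S_d² is then about x^θ d^(-κ) · √x/d; the factor d^(-κ)
makes the sum over d converge without a logarithm, giving x^(1/2+θ). For larger d one has S_d ≪ √x/d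
+ x^(θ-η). The first part contributes x/x^(1/2-θ) to ∑ S_d²; in the rest the saving x^(-η) pays for
logarithms and for the divisor bound in ∑ S_d ≪ x^(1/2+η).

Three boundary cases need care. If l = 1 the error term is trivial. If k = 0 then l ≥ 1
(`BoundsReciprocalPhase.one_le`). If k = l = 1/2, every dyadic block of the sawtooth sum contributes
equally, and the resulting logarithm cannot be afforded when d is small. There a power saving over
x^(1/3) is needed, and it is proved from scratch in the first half of the file: ∑ e(y/n) is
converted into a dual sum of length about y/N² with phase 2√(yν), to which a fifth derivative test
applies. The conversion is exact: e(y/u) is an explicit smooth factor times the Fourier transform at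
u of sin(4π√(ys)) exp(-2πas). Integrating against a 1-periodic trigonometric polynomial folds the
half-line onto one period, so the dual sum factors out in the supremum norm and a Dirichlet-type
kernel in the L¹ norm (`exists_norm_sum_block_div_le`). -/

section

open Finset

/-! ### The additive character and the Kusmin–Landau inequality -/

/-- The additive character `t ↦ exp (2πit)` of `ℝ`. -/
noncomputable def expTwoPi (t : ℝ) : ℂ := Complex.exp (2 * Real.pi * Complex.I * (t : ℂ))

lemma expTwoPi_add (s t : ℝ) : expTwoPi (s + t) = expTwoPi s * expTwoPi t := by
  simp only [expTwoPi, ← Complex.exp_add]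
  push_cast
  ring_nf

lemma expTwoPi_eq (t : ℝ) : expTwoPi t = Complex.exp (((2 * Real.pi * t : ℝ) : ℂ) * Complex.I) := by
  rw [expTwoPi]
  congr 1
  push_cast
  ring

lemma norm_expTwoPi (t : ℝ) : ‖expTwoPi t‖ = 1 := by
  rw [expTwoPi_eq, Complex.norm_exp_ofReal_mul_I]

lemma expTwoPi_int (n : ℤ) : expTwoPi n = 1 := by
  rw [expTwoPi, Complex.exp_eq_one_iff]
  exact ⟨n, by push_cast; ring⟩

lemma expTwoPi_add_int (t : ℝ) (n : ℤ) : expTwoPi (t + n) = expTwoPi t := by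
  rw [expTwoPi_add, expTwoPi_int, mul_one]

lemma expTwoPi_neg (t : ℝ) : expTwoPi (-t) = (starRingEnd ℂ) (expTwoPi t) := by
  rw [expTwoPi_eq, expTwoPi_eq, ← Complex.exp_conj]
  simp [map_ofNat]

lemma expTwoPi_eq_cos_add_sin (t : ℝ) :
    expTwoPi t = (Real.cos (2 * Real.pi * t) : ℂ) + (Real.sin (2 * Real.pi * t) : ℂ) * Complex.I := by
  rw [expTwoPi_eq, Complex.exp_mul_I]
  push_cast
  ring

lemma expTwoPi_re (t : ℝ) : (expTwoPi t).re = Real.cos (2 * Real.pi * t) := by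
  rw [expTwoPi_eq, Complex.exp_ofReal_mul_I_re]

lemma expTwoPi_im (t : ℝ) : (expTwoPi t).im = Real.sin (2 * Real.pi * t) := by
  rw [expTwoPi_eq, Complex.exp_ofReal_mul_I_im]

lemma norm_sum_expTwoPi_le {ι : Type*} (s : Finset ι) (a : ι → ℝ) :
    ‖∑ i ∈ s, expTwoPi (a i)‖ ≤ s.card := by
  refine (norm_sum_le _ _).trans ?_
  simp [norm_expTwoPi]

lemma norm_one_sub_expTwoPi (t : ℝ) : ‖1 - expTwoPi t‖ = 2 * |Real.sin (Real.pi * t)| := by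
  have h : ‖1 - expTwoPi t‖ ^ 2 = (2 * |Real.sin (Real.pi * t)|) ^ 2 := by
    rw [← Complex.normSq_eq_norm_sq, Complex.normSq_apply, mul_pow, sq_abs]
    simp only [Complex.sub_re, Complex.sub_im, Complex.one_re, Complex.one_im, expTwoPi_re,
      expTwoPi_im]
    have e : 2 * Real.pi * t = 2 * (Real.pi * t) := by ring
    rw [e, Real.cos_two_mul, Real.sin_two_mul]
    have := Real.sin_sq_add_cos_sq (Real.pi * t)
    nlinarith [this]
  exact (pow_left_inj₀ (norm_nonneg _) (by positivity) two_ne_zero).1 h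

lemma norm_expTwoPi_sub_one_le (t : ℝ) : ‖expTwoPi t - 1‖ ≤ 2 * Real.pi * |t| := by
  rw [norm_sub_rev, norm_one_sub_expTwoPi]
  have h := Real.abs_sin_le_one (Real.pi * t)
  have h2 : |Real.sin (Real.pi * t)| ≤ |Real.pi * t| := Real.abs_sin_le_abs
  rw [abs_mul, abs_of_pos Real.pi_pos] at h2
  nlinarith

/-- Jordan's inequality on the whole period. -/
lemma two_mul_le_sin_pi_mul {θ g : ℝ} (hθ : 0 ≤ θ) (h1 : θ ≤ g) (h2 : g ≤ 1 - θ) :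
    2 * θ ≤ Real.sin (Real.pi * g) := by
  have hpi := Real.pi_pos
  have key : ∀ u : ℝ, 0 ≤ u → u ≤ 1 / 2 → 2 * u ≤ Real.sin (Real.pi * u) := by
    intro u hu hu2
    have := Real.mul_le_sin (x := Real.pi * u) (by positivity) (by nlinarith)
    have e : 2 / Real.pi * (Real.pi * u) = 2 * u := by field_simp
    linarith
  rcases le_total g (1 / 2) with h | h
  · linarith [key g (by linarith) h]
  · have := key (1 - g) (by linarith) (by linarith)
    rw [show Real.pi * (1 - g) = Real.pi - Real.pi * g by ring, Real.sin_pi_sub] at this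
    linarith

/-- Summation by parts against a bounded antitone sequence. -/
lemma norm_sum_sub_succ_mul_le (u : ℕ → ℂ) (hu : ∀ i, ‖u i‖ ≤ 1) (r : ℕ → ℝ) (n : ℕ) (B : ℝ)
    (hr : ∀ i < n, |r i| ≤ B) (hanti : ∀ i, i + 1 < n → r (i + 1) ≤ r i) (hB : 0 ≤ B) :
    ‖∑ i ∈ range n, (u i - u (i + 1)) * (r i : ℂ)‖ ≤ 4 * B := by
  rcases n with _ | n
  · simpa using by positivity
  have key : ∀ m ≤ n, ‖∑ i ∈ range (m + 1), (u i - u (i + 1)) * (r i : ℂ)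
      + u (m + 1) * (r m : ℂ)‖ ≤ |r 0| + (r 0 - r m) := by
    intro m
    induction m with
    | zero =>
      intro _
      have : ∑ i ∈ range (0 + 1), (u i - u (i + 1)) * (r i : ℂ) + u (0 + 1) * (r 0 : ℂ)
          = u 0 * (r 0 : ℂ) := by simp; ring
      rw [this, norm_mul, Complex.norm_real, Real.norm_eq_abs]
      nlinarith [hu 0, abs_nonneg (r 0)]
    | succ m ih =>
      intro hm
      have ih := ih (by omega)
      have e : ∑ i ∈ range (m + 1 + 1), (u i - u (i + 1)) * (r i : ℂ)
          + u (m + 1 + 1) * (r (m + 1) : ℂ)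
          = (∑ i ∈ range (m + 1), (u i - u (i + 1)) * (r i : ℂ) + u (m + 1) * (r m : ℂ))
            + u (m + 1) * ((r (m + 1) - r m : ℝ) : ℂ) := by
        rw [sum_range_succ _ (m + 1)]
        push_cast
        ring
      rw [e]
      refine (norm_add_le _ _).trans ?_
      have h1 := hanti m (by omega)
      rw [norm_mul, Complex.norm_real, Real.norm_eq_abs, abs_of_nonpos (by linarith)]
      nlinarith [hu (m + 1)]
  have h := key n le_rfl
  have h0 := hr 0 (by omega)
  have hn := hr n (by omega)
  have h2 : ‖u (n + 1) * (r n : ℂ)‖ ≤ |r n| := by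
    rw [norm_mul, Complex.norm_real, Real.norm_eq_abs]
    nlinarith [hu (n + 1), abs_nonneg (r n)]
  have h3 := norm_sub_le (∑ i ∈ range (n + 1), (u i - u (i + 1)) * (r i : ℂ)
      + u (n + 1) * (r n : ℂ)) (u (n + 1) * (r n : ℂ))
  rw [add_sub_cancel_right] at h3
  have := abs_le.1 h0
  have := abs_le.1 hn
  linarith

/-- The inverse of 1 - e(g) has constant real part 1/2, and its imaginary part is half of cot(πg).
Only this real, monotone cotangent has to be handled by summation by parts in Kusmin–Landau. -/
lemma inv_one_sub_expTwoPi {g : ℝ} (hg : Real.sin (Real.pi * g) ≠ 0) :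
    (1 - expTwoPi g) * (1 / 2 + Complex.I / 2 *
      ((Real.cos (Real.pi * g) / Real.sin (Real.pi * g) : ℝ) : ℂ)) = 1 := by
  have e : 2 * Real.pi * g = 2 * (Real.pi * g) := by ring
  rw [expTwoPi_eq_cos_add_sin, e, Real.cos_two_mul, Real.sin_two_mul]
  have h1 := Real.sin_sq_add_cos_sq (Real.pi * g)
  set s := Real.sin (Real.pi * g)
  set c := Real.cos (Real.pi * g)
  have hs : (s : ℂ) ≠ 0 := by exact_mod_cast hg
  have h2 : (s : ℂ) ^ 2 + (c : ℂ) ^ 2 = 1 := by exact_mod_cast h1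
  push_cast
  field_simp
  have hI : Complex.I ^ 2 = -1 := Complex.I_sq
  linear_combination (-2 * c * Complex.I) * h2 - 2 * (s : ℂ) * c ^ 2 * hI

/-- The Kusmin–Landau inequality, for sequences. -/
lemma norm_sum_expTwoPi_le_of_monotone_diff (a : ℕ → ℝ) (n : ℕ) {θ : ℝ} (hθ : 0 < θ)
    (hθ2 : θ ≤ 1 / 2) (j : ℤ)
    (hg : ∀ i < n, j + θ ≤ a (i + 1) - a i ∧ a (i + 1) - a i ≤ j + 1 - θ)
    (hmono : ∀ i, i + 1 < n → a (i + 1) - a i ≤ a (i + 2) - a (i + 1)) :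
    ‖∑ i ∈ range n, expTwoPi (a i)‖ ≤ 2 / θ := by
  set g : ℕ → ℝ := fun i => a (i + 1) - a i - j with hgdef
  have hg' : ∀ i < n, θ ≤ g i ∧ g i ≤ 1 - θ := fun i hi => by
    have := hg i hi
    simp only [hgdef]
    constructor <;> linarith
  have hsin : ∀ i < n, 2 * θ ≤ Real.sin (Real.pi * g i) := fun i hi =>
    two_mul_le_sin_pi_mul hθ.le (hg' i hi).1 (hg' i hi).2
  set r : ℕ → ℝ := fun i => Real.cos (Real.pi * g i) / Real.sin (Real.pi * g i) with hr
  -- As e(a_{i+1}) = e(a_i) e(g_i), the integer j being invisible to e, each term is (e(a_i) -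
  -- e(a_{i+1})) / (1 - e(g_i)): a telescoping difference times 1/2 + (i/2) cot(πg_i).
  have hterm : ∀ i ∈ range n, expTwoPi (a i) = 1 / 2 * (expTwoPi (a i) - expTwoPi (a (i + 1)))
      + Complex.I / 2 * ((expTwoPi (a i) - expTwoPi (a (i + 1))) * (r i : ℂ)) := by
    intro i hi
    have hi := mem_range.1 hi
    have hs : Real.sin (Real.pi * g i) ≠ 0 := by linarith [hsin i hi]
    have h1 := inv_one_sub_expTwoPi hs
    have h2 : expTwoPi (a (i + 1)) = expTwoPi (a i) * expTwoPi (g i) := by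
      rw [← expTwoPi_add, ← expTwoPi_add_int (a i + g i) j]
      congr 1
      simp only [hgdef]
      ring
    rw [h2]
    linear_combination (- expTwoPi (a i)) * h1
  rw [sum_congr rfl hterm, sum_add_distrib, ← mul_sum, ← mul_sum, sum_range_sub']
  have hB : ∀ i < n, |r i| ≤ 1 / (2 * θ) := by
    intro i hi
    have h1 := hsin i hi
    have h2 : 0 < Real.sin (Real.pi * g i) := by linarith
    rw [hr, abs_div, abs_of_pos h2]
    exact div_le_div₀ zero_le_one (Real.abs_cos_le_one _) (by positivity) h1
  have hanti : ∀ i, i + 1 < n → r (i + 1) ≤ r i := by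
    intro i hi
    have h1 := hsin i (by omega)
    have h2 := hsin (i + 1) hi
    have h3 : g i ≤ g (i + 1) := by
      have := hmono i hi
      simp only [hgdef]
      linarith
    have h4 := hg' i (by omega)
    have h5 := hg' (i + 1) hi
    simp only [hr]
    rw [div_le_div_iff₀ (by linarith) (by linarith)]
    -- For angles in (0, π), cot β ≤ cot α amounts to sin(β - α) ≥ 0 after clearing the positive
    -- sines.
    have h6 : 0 ≤ Real.sin (Real.pi * g (i + 1) - Real.pi * g i) := by
      apply Real.sin_nonneg_of_nonneg_of_le_pi
      · nlinarith [Real.pi_pos]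
      · nlinarith [Real.pi_pos]
    rw [Real.sin_sub] at h6
    linarith
  have h1 := norm_sum_sub_succ_mul_le (fun i => expTwoPi (a i))
    (fun i => (norm_expTwoPi _).le) r n (1 / (2 * θ)) hB hanti (by positivity)
  have h2 : ‖expTwoPi (a 0) - expTwoPi (a n)‖ ≤ 2 := by
    refine (norm_sub_le _ _).trans ?_
    rw [norm_expTwoPi, norm_expTwoPi]
    norm_num
  refine (norm_add_le _ _).trans ?_
  rw [norm_mul, norm_mul]
  simp only [norm_div, Complex.norm_I, norm_one, Complex.norm_ofNat]
  have h3 : 1 ≤ 1 / (2 * θ) := by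
    rw [le_div_iff₀ (by positivity)]
    linarith
  have h4 : 2 / θ = 4 * (1 / (2 * θ)) := by field_simp; norm_num
  rw [h4]
  linarith

/-- A sequence with increments at least `lam` visits an interval of length `w` at most `w / lam + 1`
times. -/
lemma card_filter_mem_Icc_le (g : ℕ → ℝ) (n : ℕ) {lam : ℝ} (hlam : 0 < lam)
    (hg : ∀ i, i + 1 < n → lam ≤ g (i + 1) - g i) (p w : ℝ) (hw : 0 ≤ w) :
    (((range n).filter fun i => p ≤ g i ∧ g i ≤ p + w).card : ℝ) ≤ w / lam + 1 := by
  have hgrow : ∀ i k, i + k < n → lam * k ≤ g (i + k) - g i := by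
    intro i k
    induction k with
    | zero => intro _; simp
    | succ k ih =>
      intro h
      have h1 := ih (by omega)
      have h2 := hg (i + k) (by omega)
      push_cast
      rw [← add_assoc]
      linarith
  set s := (range n).filter fun i => p ≤ g i ∧ g i ≤ p + w with hs
  rcases s.eq_empty_or_nonempty with h | h
  · rw [h]
    simp only [card_empty, Nat.cast_zero]
    positivity
  · have h0 := s.min'_mem h
    have h1 := s.max'_mem h
    have hle := s.min'_le_max' h
    set i0 := s.min' h
    set i1 := s.max' h
    have hsub : s ⊆ Icc i0 i1 := fun i hi => mem_Icc.2 ⟨s.min'_le i hi, s.le_max' i hi⟩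
    have hc := card_le_card hsub
    rw [Nat.card_Icc] at hc
    rw [hs, mem_filter, mem_range] at h0 h1
    obtain ⟨k, hk⟩ := Nat.exists_eq_add_of_le hle
    have h2 := hgrow i0 k (by omega)
    rw [← hk] at h2
    have h3 : (k : ℝ) ≤ w / lam := by
      rw [le_div_iff₀ hlam]
      linarith [h0.2.1, h1.2.2]
    have h4 : s.card ≤ k + 1 := by omega
    have h5 : (s.card : ℝ) ≤ k + 1 := by exact_mod_cast h4
    linarith

/-- The part of an exponential sum where the increments stay away from the integers. -/
lemma norm_sum_filter_expTwoPi_le (a : ℕ → ℝ) (n : ℕ) {θ : ℝ} (hθ : 0 < θ)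
    (hθ2 : θ ≤ 1 / 2) (j : ℤ)
    (hmono : ∀ i, i + 1 < n → a (i + 1) - a i ≤ a (i + 2) - a (i + 1)) :
    ‖∑ i ∈ (range n).filter fun i => j + θ ≤ a (i + 1) - a i ∧ a (i + 1) - a i ≤ j + 1 - θ,
      expTwoPi (a i)‖ ≤ 2 / θ := by
  have hm : ∀ i k, i + k < n → a (i + 1) - a i ≤ a (i + k + 1) - a (i + k) := by
    intro i k
    induction k with
    | zero => intro _; exact le_rfl
    | succ k ih => intro h; exact (ih (by omega)).trans (hmono (i + k) h)
  set s := (range n).filter fun i => j + θ ≤ a (i + 1) - a i ∧ a (i + 1) - a i ≤ j + 1 - θ with hs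
  rcases s.eq_empty_or_nonempty with h | h
  · rw [h]
    simp only [sum_empty, norm_zero]
    positivity
  · have h0 := s.min'_mem h
    have h1 := s.max'_mem h
    have hle := s.min'_le_max' h
    set i0 := s.min' h with hi0
    set i1 := s.max' h with hi1
    have h0' := h0
    have h1' := h1
    rw [hs, mem_filter, mem_range] at h0' h1'
    obtain ⟨k, hk⟩ := Nat.exists_eq_add_of_le hle
    have hmem : ∀ i < k + 1, j + θ ≤ a (i0 + i + 1) - a (i0 + i) ∧
        a (i0 + i + 1) - a (i0 + i) ≤ j + 1 - θ := by
      intro i hi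
      constructor
      · exact h0'.2.1.trans (hm i0 i (by omega))
      · have := hm (i0 + i) (k - i) (by omega)
        rw [show i0 + i + (k - i) = i1 by omega] at this
        exact this.trans h1'.2.2
    have heq : s = (range (k + 1)).image (fun i => i0 + i) := by
      ext i
      rw [mem_image]
      constructor
      · intro hi
        have h2 := s.min'_le i hi
        have h3 := s.le_max' i hi
        exact ⟨i - i0, mem_range.2 (by omega), by omega⟩
      · rintro ⟨i', hi', rfl⟩
        have hi' := mem_range.1 hi'
        rw [hs, mem_filter, mem_range]
        exact ⟨by omega, hmem i' hi'⟩
    rw [heq, sum_image (fun x _ y _ hxy => by simpa using hxy)]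
    exact norm_sum_expTwoPi_le_of_monotone_diff (fun i => a (i0 + i)) (k + 1) hθ hθ2 j hmem
      (fun i hi => hmono (i0 + i) (by omega))

/-! ### Derivative tests for sequences, by Weyl differencing -/

/-- A `k`-th derivative test with exponents `α`, `β`, for sequences: if the `k`-th differences
have order of magnitude `lam`, then the exponential sum is `≪ n lam ^ α + n ^ β lam ^ (-α)`. -/
def HasDiffTest (k : ℕ) (α β : ℝ) : Prop :=
  ∀ A : ℝ, 1 ≤ A → ∃ C : ℝ, 0 ≤ C ∧ ∀ (lam : ℝ) (a : ℕ → ℝ) (n : ℕ), 0 < lam → 1 ≤ n →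
    (∀ i < n, lam ≤ (fwdDiff 1)^[k] a i ∧ (fwdDiff 1)^[k] a i ≤ A * lam) →
    ‖∑ i ∈ range n, expTwoPi (a i)‖ ≤ C * (n * lam ^ α + (n : ℝ) ^ β * lam ^ (-α))

/-- The van der Corput second derivative test, for sequences. -/
lemma hasDiffTest_two : HasDiffTest 2 (1 / 2) 0 := by
  intro A hA
  refine ⟨10 * A, by positivity, fun lam a n hlam hn hdiff => ?_⟩
  set g : ℕ → ℝ := fun i => a (i + 1) - a i with hg
  have hd : ∀ i < n, lam ≤ g (i + 1) - g i ∧ g (i + 1) - g i ≤ A * lam := fun i hi => hdiff i hi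
  -- The threshold √λ balances two costs for each integer j: the trivial count t/λ of the indices
  -- whose increment lies within t of an endpoint of [j, j+1], and the Kusmin–Landau bound 2/t for
  -- the others. There are O(Aλn + 1) integers j to consider.
  set t := lam ^ (1 / 2 : ℝ) with ht
  have ht0 : 0 < t := Real.rpow_pos_of_pos hlam _
  have ht2 : t * t = lam := by
    rw [ht, ← Real.rpow_add hlam]
    norm_num
  rw [Real.rpow_neg hlam.le, ← ht, Real.rpow_zero, one_mul]
  have hn' : (1 : ℝ) ≤ n := by exact_mod_cast hn
  rcases le_or_gt t (1 / 2) with hθ | hθ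
  swap
  · refine (norm_sum_expTwoPi_le _ _).trans ?_
    rw [card_range]
    have h1 : 0 < t⁻¹ := by positivity
    have h2 : (n : ℝ) * (1 / 2) ≤ n * t := by gcongr
    have h3 : 1 * (n * t + t⁻¹) ≤ A * (n * t + t⁻¹) := by gcongr
    linarith
  have hmono : ∀ i, i + 1 < n → a (i + 1) - a i ≤ a (i + 2) - a (i + 1) := fun i hi => by
    have := (hd i (by omega)).1
    simp only [hg] at this
    linarith
  have hle : ∀ i < n, g 0 ≤ g i ∧ g i ≤ g 0 + A * lam * i := by
    intro i
    induction i with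
    | zero => intro _; simp
    | succ i ih =>
      intro hi
      have h1 := ih (by omega)
      have h2 := hd i (by omega)
      push_cast
      constructor <;> linarith
  have hmaps : ∀ i ∈ range n, ⌊g i⌋ ∈ Icc ⌊g 0⌋ ⌊g 0 + A * lam * n⌋ := by
    intro i hi
    have hi := mem_range.1 hi
    have h1 := hle i hi
    have h2 : (i : ℝ) ≤ n := by exact_mod_cast hi.le
    refine mem_Icc.2 ⟨Int.floor_le_floor h1.1, Int.floor_le_floor (h1.2.trans ?_)⟩
    have : 0 ≤ A * lam := by positivity
    nlinarith
  rw [← sum_fiberwise_of_maps_to hmaps]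
  have hfib : ∀ j ∈ Icc ⌊g 0⌋ ⌊g 0 + A * lam * n⌋,
      ‖∑ i ∈ range n with ⌊g i⌋ = j, expTwoPi (a i)‖ ≤ 5 * t⁻¹ := by
    intro j _
    set s1 := (range n).filter fun i => (j : ℝ) ≤ g i ∧ g i ≤ j + t with hs1
    set s2 := (range n).filter fun i => (j + 1 - t : ℝ) ≤ g i ∧ g i ≤ j + 1 - t + t with hs2
    set s3 := (range n).filter fun i => j + t ≤ a (i + 1) - a i ∧ a (i + 1) - a i ≤ j + 1 - t
      with hs3
    set s := (range n).filter fun i => ⌊g i⌋ = j with hs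
    have h1 := card_filter_mem_Icc_le g n hlam (fun i hi => (hd i (by omega)).1) j t ht0.le
    have h2 := card_filter_mem_Icc_le g n hlam (fun i hi => (hd i (by omega)).1) (j + 1 - t) t
      ht0.le
    have h3 := norm_sum_filter_expTwoPi_le a n ht0 hθ j hmono
    rw [← hs1] at h1
    rw [← hs2] at h2
    rw [← hs3] at h3
    rw [← sum_filter_add_sum_filter_not s (fun i => i ∈ s3)]
    have e1 : s.filter (fun i => i ∈ s3) = s3.filter (fun i => g i < j + 1) := by
      ext i
      simp only [hs, hs3, mem_filter, mem_range, Int.floor_eq_iff, hg]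
      constructor
      · rintro ⟨⟨h1, h2, h3⟩, h4⟩
        exact ⟨h4, h3⟩
      · rintro ⟨h4, h3⟩
        exact ⟨⟨h4.1, by linarith [h4.2.1], h3⟩, h4⟩
    have e2 : s3.filter (fun i => g i < j + 1) = s3 := by
      rw [filter_eq_self]
      intro i hi
      have := (mem_filter.1 hi).2.2
      simp only [hg]
      linarith
    have h4 : ((s.filter fun i => i ∉ s3).card : ℝ) ≤ s1.card + s2.card := by
      have hsub : (s.filter fun i => i ∉ s3) ⊆ s1 ∪ s2 := by
        intro i hi
        simp only [hs, hs3, mem_filter, mem_range, Int.floor_eq_iff, not_and, not_le] at hi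
        obtain ⟨⟨hi1, hi2, hi3⟩, hi4⟩ := hi
        rw [mem_union, hs1, hs2, mem_filter, mem_filter, mem_range]
        by_cases hc : g i ≤ j + t
        · exact Or.inl ⟨hi1, hi2, hc⟩
        · push Not at hc
          have := hi4 hi1 hc.le
          exact Or.inr ⟨hi1, by simp only [hg]; linarith, by linarith⟩
      exact_mod_cast (card_le_card hsub).trans (card_union_le _ _)
    rw [e1, e2]
    have h5 := norm_sum_expTwoPi_le (s.filter fun i => i ∉ s3) a
    refine (norm_add_le _ _).trans ?_
    have h6 : t / lam = t⁻¹ := by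
      rw [← ht2]
      field_simp
    have h7 : 2 ≤ t⁻¹ := by
      rw [le_inv_comm₀ (by norm_num) ht0]
      linarith
    rw [h6] at h1 h2
    have h8 : 2 / t = 2 * t⁻¹ := by ring
    linarith
  refine (norm_sum_le_of_le _ hfib).trans ?_
  rw [sum_const, nsmul_eq_mul, Int.card_Icc]
  have hcard : ((⌊g 0 + A * lam * n⌋ + 1 - ⌊g 0⌋).toNat : ℝ) ≤ A * lam * n + 2 := by
    have h0 : ⌊g 0⌋ ≤ ⌊g 0 + A * lam * n⌋ := Int.floor_le_floor (by
      have : 0 ≤ A * lam * n := by positivity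
      linarith)
    have h1 : (((⌊g 0 + A * lam * n⌋ + 1 - ⌊g 0⌋).toNat : ℤ) : ℝ)
        = (⌊g 0 + A * lam * n⌋ + 1 - ⌊g 0⌋ : ℤ) := by
      rw [Int.toNat_of_nonneg (by omega)]
    rw [Int.cast_natCast] at h1
    rw [h1]
    push_cast
    have := Int.floor_le (g 0 + A * lam * n)
    have := Int.lt_floor_add_one (g 0)
    linarith
  have ht1 : lam * t⁻¹ = t := by
    rw [← ht2]
    field_simp
  have h9 : 0 < t⁻¹ := by positivity
  calc _ ≤ (A * lam * n + 2) * (5 * t⁻¹) := by gcongr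
    _ = 5 * A * n * (lam * t⁻¹) + 10 * t⁻¹ := by ring
    _ ≤ 10 * A * (n * t + t⁻¹) := by
      rw [ht1]
      have : 0 ≤ A * n * t := by positivity
      nlinarith

/-- The correlation sums `∑ f (i + r) * conj (f i)` of `f` on `range n`. -/
noncomputable def correlation (f : ℕ → ℂ) (n r : ℕ) : ℂ :=
  ∑ i ∈ range (n - r), f (i + r) * (starRingEnd ℂ) (f i)

/-- The window `q ↦ m - q` of `f` restricted to `range n`. -/
noncomputable def windowed (f : ℕ → ℂ) (n m q : ℕ) : ℂ :=
  if q ≤ m ∧ m - q < n then f (m - q) else 0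

lemma sum_windowed (f : ℕ → ℂ) (n Q q : ℕ) (hq : q < Q) :
    ∑ m ∈ range (n + Q), windowed f n m q = ∑ i ∈ range n, f i := by
  simp only [windowed]
  rw [← sum_filter]
  symm
  refine sum_bij (fun i _ => i + q) ?_ ?_ ?_ ?_
  · intro i hi
    have := mem_range.1 hi
    rw [mem_filter, mem_range]
    omega
  · intro i _ j _ h
    simpa using h
  · intro m hm
    rw [mem_filter, mem_range] at hm
    exact ⟨m - q, mem_range.2 hm.2.2, by omega⟩
  · intro i _
    simp

lemma sum_windowed_mul_conj (f : ℕ → ℂ) (n Q q r : ℕ) (hq : q + r < Q) :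
    ∑ m ∈ range (n + Q), windowed f n m q * (starRingEnd ℂ) (windowed f n m (q + r))
      = correlation f n r := by
  rw [correlation]
  have : ∀ m ∈ range (n + Q), windowed f n m q * (starRingEnd ℂ) (windowed f n m (q + r)) =
      if q + r ≤ m ∧ m - q < n then f (m - q) * (starRingEnd ℂ) (f (m - (q + r))) else 0 := by
    intro m _
    simp only [windowed]
    by_cases h : q + r ≤ m ∧ m - q < n
    · rw [if_pos h, if_pos (by omega), if_pos (by omega)]
    · rw [if_neg h]
      by_cases h1 : q ≤ m ∧ m - q < n
      · rw [if_neg (c := q + r ≤ m ∧ m - (q + r) < n) (by omega)]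
        simp
      · rw [if_neg h1, zero_mul]
  rw [sum_congr rfl this, ← sum_filter]
  symm
  refine sum_bij (fun i _ => i + (q + r)) ?_ ?_ ?_ ?_
  · intro i hi
    have := mem_range.1 hi
    rw [mem_filter, mem_range]
    omega
  · intro i _ j _ h
    simpa using h
  · intro m hm
    rw [mem_filter, mem_range] at hm
    exact ⟨m - (q + r), mem_range.2 (by omega), by omega⟩
  · intro i _
    rw [show i + (q + r) - q = i + r by omega, show i + (q + r) - (q + r) = i by omega]

/-- With truncated subtraction, (q - q') + (q' - q) is |q - q'|. Exchanging q and q' conjugates the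
sum, so only the distance between the two windows matters for the norm. -/
lemma norm_sum_windowed_mul_conj_le (f : ℕ → ℂ) (n Q q q' : ℕ) (hq : q < Q) (hq' : q' < Q) :
    ‖∑ m ∈ range (n + Q), windowed f n m q * (starRingEnd ℂ) (windowed f n m q')‖
      = ‖correlation f n ((q - q') + (q' - q))‖ := by
  rcases le_total q q' with h | h
  · obtain ⟨r, rfl⟩ := Nat.exists_eq_add_of_le h
    rw [sum_windowed_mul_conj f n Q q r hq', show q - (q + r) + (q + r - q) = r by omega]
  · obtain ⟨r, rfl⟩ := Nat.exists_eq_add_of_le h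
    rw [show q' + r - q' + (q' - (q' + r)) = r by omega, ← sum_windowed_mul_conj f n Q q' r hq,
      ← Complex.norm_conj, map_sum]
    congr 1
    refine sum_congr rfl fun m _ => ?_
    rw [map_mul, Complex.conj_conj, mul_comm]

lemma sum_abs_sub_le (T : ℕ → ℝ) (hT : ∀ r, 0 ≤ T r) (Q q : ℕ) (hq : q < Q) :
    ∑ q' ∈ range Q, T ((q - q') + (q' - q)) ≤ T 0 + 2 * ∑ r ∈ Ico 1 Q, T r := by
  have h1 : ∑ q' ∈ range Q, T ((q - q') + (q' - q))
      = ∑ q' ∈ range q, T (q - q') + (T 0 + ∑ q' ∈ Ico (q + 1) Q, T (q' - q)) := by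
    rw [range_eq_Ico, ← sum_Ico_consecutive _ (Nat.zero_le q) hq.le, sum_eq_sum_Ico_succ_bot hq,
      ← range_eq_Ico]
    simp only [Nat.sub_self, add_zero]
    congr 1
    · refine sum_congr rfl fun i hi => ?_
      have := mem_range.1 hi
      congr 1
      omega
    · congr 1
      refine sum_congr rfl fun i hi => ?_
      have := mem_Ico.1 hi
      congr 1
      omega
  have h2 : ∑ q' ∈ range q, T (q - q') ≤ ∑ r ∈ Ico 1 Q, T r := by
    rw [← sum_image (f := T) (g := fun q' => q - q') (s := range q)]
    · refine sum_le_sum_of_subset_of_nonneg ?_ fun _ _ _ => hT _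
      intro i hi
      obtain ⟨j, hj, rfl⟩ := mem_image.1 hi
      have := mem_range.1 hj
      rw [mem_Ico]
      omega
    · intro i hi j hj h
      have h1 : i < q := mem_range.1 hi
      have h2 : j < q := mem_range.1 hj
      have h3 : q - i = q - j := h
      omega
  have h3 : ∑ q' ∈ Ico (q + 1) Q, T (q' - q) ≤ ∑ r ∈ Ico 1 Q, T r := by
    rw [← sum_image (f := T) (g := fun q' => q' - q) (s := Ico (q + 1) Q)]
    · refine sum_le_sum_of_subset_of_nonneg ?_ fun _ _ _ => hT _
      intro i hi
      obtain ⟨j, hj, rfl⟩ := mem_image.1 hi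
      have := mem_Ico.1 hj
      rw [mem_Ico]
      omega
    · intro i hi j hj h
      have h1 := mem_Ico.1 hi
      have h2 := mem_Ico.1 hj
      have h3 : i - q = j - q := h
      omega
  linarith

/-- The van der Corput inequality (Weyl differencing). -/
lemma sq_norm_sum_le_correlation (f : ℕ → ℂ) (hf : ∀ i, ‖f i‖ ≤ 1) (n Q : ℕ) (hQ : 1 ≤ Q)
    (hQn : Q ≤ n) :
    ‖∑ i ∈ range n, f i‖ ^ 2 ≤
      2 * n / Q * (n + 2 * ∑ r ∈ Ico 1 Q, ‖correlation f n r‖) := by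
  have hQ0 : (0 : ℝ) < Q := by exact_mod_cast hQ
  set W := windowed f n with hW
  -- Averaging over Q shifts of the sum prepares Cauchy–Schwarz in m, which runs over n + Q ≤ 2n
  -- values; expanding the square leaves correlations at distance below Q.
  have e1 : (Q : ℂ) * ∑ i ∈ range n, f i = ∑ m ∈ range (n + Q), ∑ q ∈ range Q, W m q := by
    rw [sum_comm, sum_congr rfl fun q hq => sum_windowed f n Q q (mem_range.1 hq), sum_const,
      card_range, nsmul_eq_mul]
  have e2 : (Q * ‖∑ i ∈ range n, f i‖) ^ 2
      ≤ (n + Q) * ∑ m ∈ range (n + Q), ‖∑ q ∈ range Q, W m q‖ ^ 2 := by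
    have h1 : Q * ‖∑ i ∈ range n, f i‖ ≤ ∑ m ∈ range (n + Q), ‖∑ q ∈ range Q, W m q‖ := by
      have : (Q : ℝ) * ‖∑ i ∈ range n, f i‖ = ‖(Q : ℂ) * ∑ i ∈ range n, f i‖ := by simp
      rw [this, e1]
      exact norm_sum_le _ _
    refine (pow_le_pow_left₀ (by positivity) h1 2).trans ?_
    have := sq_sum_le_card_mul_sum_sq (s := range (n + Q)) (f := fun m => ‖∑ q ∈ range Q, W m q‖)
    simpa using this
  have e3 : ∑ m ∈ range (n + Q), ‖∑ q ∈ range Q, W m q‖ ^ 2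
      ≤ ∑ q ∈ range Q, ∑ q' ∈ range Q, ‖correlation f n ((q - q') + (q' - q))‖ := by
    have h1 : ((∑ m ∈ range (n + Q), ‖∑ q ∈ range Q, W m q‖ ^ 2 : ℝ) : ℂ)
        = ∑ q ∈ range Q, ∑ q' ∈ range Q, ∑ m ∈ range (n + Q),
          W m q * (starRingEnd ℂ) (W m q') := by
      push_cast
      have : ∀ m ∈ range (n + Q), ((‖∑ q ∈ range Q, W m q‖ : ℂ)) ^ 2
          = ∑ q ∈ range Q, ∑ q' ∈ range Q, W m q * (starRingEnd ℂ) (W m q') := by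
        intro m _
        rw [← Complex.mul_conj', map_sum, sum_mul_sum]
      rw [sum_congr rfl this, sum_comm]
      refine sum_congr rfl fun q _ => ?_
      rw [sum_comm]
    have h2 : ∑ m ∈ range (n + Q), ‖∑ q ∈ range Q, W m q‖ ^ 2
        = ‖((∑ m ∈ range (n + Q), ‖∑ q ∈ range Q, W m q‖ ^ 2 : ℝ) : ℂ)‖ := by
      rw [Complex.norm_real, Real.norm_of_nonneg]
      positivity
    rw [h2, h1]
    refine norm_sum_le_of_le _ fun q hq => norm_sum_le_of_le _ fun q' hq' => ?_
    rw [norm_sum_windowed_mul_conj_le f n Q q q' (mem_range.1 hq) (mem_range.1 hq')]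
  have e4 : ∑ q ∈ range Q, ∑ q' ∈ range Q, ‖correlation f n ((q - q') + (q' - q))‖
      ≤ Q * (n + 2 * ∑ r ∈ Ico 1 Q, ‖correlation f n r‖) := by
    have h0 : ‖correlation f n 0‖ ≤ n := by
      rw [correlation]
      refine (norm_sum_le_of_le (n := fun _ => (1 : ℝ)) _ fun i _ => ?_).trans (by simp)
      rw [norm_mul, Complex.norm_conj]
      exact mul_le_one₀ (hf _) (norm_nonneg _) (hf _)
    have : ∀ q ∈ range Q, ∑ q' ∈ range Q, ‖correlation f n ((q - q') + (q' - q))‖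
        ≤ n + 2 * ∑ r ∈ Ico 1 Q, ‖correlation f n r‖ := fun q hq =>
      (sum_abs_sub_le (fun r => ‖correlation f n r‖) (fun _ => norm_nonneg _) Q q
        (mem_range.1 hq)).trans (by linarith)
    refine (sum_le_sum this).trans ?_
    rw [sum_const, card_range, nsmul_eq_mul]
  set X := (n : ℝ) + 2 * ∑ r ∈ Ico 1 Q, ‖correlation f n r‖ with hX
  have hX0 : 0 ≤ X := by positivity
  have hQn' : (Q : ℝ) ≤ n := by exact_mod_cast hQn
  have e5 : (Q * ‖∑ i ∈ range n, f i‖) ^ 2 ≤ (n + n) * (Q * X) :=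
    e2.trans (mul_le_mul (by linarith) (e3.trans e4) (by positivity) (by positivity))
  have e6 : ‖∑ i ∈ range n, f i‖ ^ 2 = (Q * ‖∑ i ∈ range n, f i‖) ^ 2 / (Q : ℝ) ^ 2 := by
    field_simp
  rw [e6, div_le_iff₀ (by positivity)]
  calc _ ≤ _ := e5
    _ = _ := by field_simp; ring

/-- Since α ≤ 1/2, the factor r^(1/2-α) is at most Q^(1/2-α). Only the exponent -1/2 remains to be
summed, and it telescopes against 2√m; this makes the constant independent of α. -/
lemma sum_Ico_rpow_neg_le {α : ℝ} (hα2 : α ≤ 1 / 2) (Q : ℕ) (hQ : 1 ≤ Q) :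
    ∑ r ∈ Ico 1 Q, (r : ℝ) ^ (-α) ≤ 2 * (Q : ℝ) ^ (1 - α) := by
  have h1 : ∀ m : ℕ, ∑ r ∈ Ico 1 (m + 1), (r : ℝ) ^ (-(1 / 2) : ℝ) ≤ 2 * √(m : ℝ) := by
    intro m
    induction m with
    | zero => simp
    | succ m ih =>
      rw [sum_Ico_succ_top (by omega)]
      have hm : (0 : ℝ) < ((m + 1 : ℕ) : ℝ) := by positivity
      have e : ((m + 1 : ℕ) : ℝ) ^ (-(1 / 2) : ℝ) = 1 / √((m + 1 : ℕ) : ℝ) := by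
        rw [Real.rpow_neg hm.le, ← Real.sqrt_eq_rpow, one_div]
      rw [e]
      have hs : 0 < √((m + 1 : ℕ) : ℝ) := Real.sqrt_pos.2 hm
      have hs2 := Real.sq_sqrt hm.le
      have ht2 := Real.sq_sqrt (Nat.cast_nonneg (α := ℝ) m)
      have ht := Real.sqrt_nonneg (m : ℝ)
      have : 1 / √((m + 1 : ℕ) : ℝ) ≤ 2 * (√((m + 1 : ℕ) : ℝ) - √(m : ℝ)) := by
        rw [div_le_iff₀ hs]
        push_cast at hs2 ⊢
        nlinarith [sq_nonneg (√((m : ℝ) + 1) - √(m : ℝ))]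
      linarith
  obtain ⟨m, rfl⟩ : ∃ m, Q = m + 1 := ⟨Q - 1, by omega⟩
  have hQ0 : (0 : ℝ) < ((m + 1 : ℕ) : ℝ) := by positivity
  calc ∑ r ∈ Ico 1 (m + 1), (r : ℝ) ^ (-α)
      ≤ ∑ r ∈ Ico 1 (m + 1), ((m + 1 : ℕ) : ℝ) ^ (1 / 2 - α) * (r : ℝ) ^ (-(1 / 2) : ℝ) := by
        refine sum_le_sum fun r hr => ?_
        have hr := mem_Ico.1 hr
        have hr0 : (0 : ℝ) < r := by exact_mod_cast hr.1
        rw [show (-α : ℝ) = (1 / 2 - α) + (-(1 / 2)) by ring, Real.rpow_add hr0]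
        gcongr
        linarith
    _ = ((m + 1 : ℕ) : ℝ) ^ (1 / 2 - α) * ∑ r ∈ Ico 1 (m + 1), (r : ℝ) ^ (-(1 / 2) : ℝ) := by
        rw [mul_sum]
    _ ≤ ((m + 1 : ℕ) : ℝ) ^ (1 / 2 - α) * (2 * ((m + 1 : ℕ) : ℝ) ^ (1 / 2 : ℝ)) := by
        gcongr
        refine (h1 m).trans ?_
        rw [← Real.sqrt_eq_rpow]
        gcongr
        simp
    _ = _ := by
        rw [mul_left_comm, ← Real.rpow_add hQ0]
        congr 2
        ring

/-- A difference at distance r is a sum of r unit differences. Thus if the (k+1)-st differences of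
`a` have size λ, the k-th differences of the shifted phase have size rλ, and the test of order k
applies to it. -/
lemma fwdDiff_iterate_shift_sub (k : ℕ) (a : ℕ → ℝ) (r i : ℕ) :
    (fwdDiff 1)^[k] (fun j => a (j + r) - a j) i
      = ∑ s ∈ range r, (fwdDiff 1)^[k + 1] a (i + s) := by
  induction k generalizing a i with
  | zero =>
    simp only [Function.iterate_zero, id_eq, zero_add, Function.iterate_one, fwdDiff]
    simpa [add_assoc] using (sum_range_sub (fun s => a (i + s)) r).symm
  | succ k ih =>
    rw [Function.iterate_succ_apply]
    have : fwdDiff 1 (fun j => a (j + r) - a j)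
        = fun j => (fwdDiff 1 a) (j + r) - (fwdDiff 1 a) j := by
      funext j
      simp only [fwdDiff]
      rw [show j + 1 + r = j + r + 1 by ring]
      ring
    rw [this, ih]
    rfl

/-- The Weyl–van der Corput differencing step. -/
lemma HasDiffTest.succ {k : ℕ} {α β : ℝ} (h : HasDiffTest k α β) (hα : 0 < α) (hα2 : α ≤ 1 / 2)
    (hβ : 0 ≤ β) : HasDiffTest (k + 1) (α / (2 * (1 + α))) ((1 + β) / 2) := by
  intro A hA
  obtain ⟨C, hC, hS⟩ := h A hA
  refine ⟨2 + 8 * C, by positivity, fun lam a n hlam hn hdiff => ?_⟩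
  have hn0 : (0 : ℝ) < n := by exact_mod_cast hn
  have hn1 : (1 : ℝ) ≤ n := by exact_mod_cast hn
  set α' := α / (2 * (1 + α)) with hα'
  set γ := α / (1 + α) with hγ
  have hγ0 : 0 < γ := by positivity
  have hγα : γ = 2 * α' := by rw [hγ, hα']; field_simp
  have hα'0 : 0 < α' := by positivity
  have hγ2 : (1 - γ) * α = γ := by rw [hγ]; field_simp; ring
  set β' := (1 + β) / 2 with hβ'
  have htriv : ‖∑ i ∈ range n, expTwoPi (a i)‖ ≤ n := by
    simpa using norm_sum_expTwoPi_le (range n) a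
  have hU : 0 ≤ (n : ℝ) * lam ^ α' := by positivity
  have hV : 0 ≤ (n : ℝ) ^ β' * lam ^ (-α') := by positivity
  rcases le_or_gt 1 lam with hl | hl
  · have h1 : 1 ≤ lam ^ α' := Real.one_le_rpow hl hα'0.le
    have h2 : (n : ℝ) ≤ n * lam ^ α' := by nlinarith
    nlinarith
  -- The number of shifts is about λ^(-γ), where γ = α/(1+α) solves (1-γ)α = γ: then the diagonal
  -- saving 1/Q and the bound (Qλ)^α for the correlations are both of order λ^γ.
  set P := lam ^ (-γ) with hP
  have hP1 : 1 ≤ P := by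
    rw [hP]
    exact Real.one_le_rpow_of_pos_of_le_one_of_nonpos hlam hl.le (by linarith)
  set Q := ⌈P⌉₊ with hQ
  have hQP : P ≤ Q := Nat.le_ceil P
  have hQP2 : (Q : ℝ) ≤ 2 * P := by
    have := Nat.ceil_lt_add_one (show 0 ≤ P by linarith)
    linarith
  have hQ1 : 1 ≤ Q := Nat.one_le_ceil_iff.2 (by linarith)
  have hQ0 : (0 : ℝ) < Q := by exact_mod_cast hQ1
  -- If there are fewer terms than shifts, then n ≤ λ^(-2α'), and the trivial bound n is covered by
  -- the second term because β' ≥ 1/2.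
  rcases lt_or_ge n Q with hQn | hQn
  · have h1 : (n : ℝ) ≤ P := (Nat.lt_ceil.1 hQn).le
    have h2 : (n : ℝ) ^ (1 / 2 : ℝ) ≤ lam ^ (-α') := by
      have : lam ^ (-α') = P ^ (1 / 2 : ℝ) := by
        rw [hP, ← Real.rpow_mul hlam.le]
        congr 1
        rw [hγα]
        ring
      rw [this]
      gcongr
    have h3 : (n : ℝ) ≤ (n : ℝ) ^ β' * lam ^ (-α') := by
      calc (n : ℝ) = (n : ℝ) ^ (1 : ℝ) := (Real.rpow_one _).symm
        _ ≤ (n : ℝ) ^ (β' + 1 / 2) := by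
          apply Real.rpow_le_rpow_of_exponent_le hn1
          rw [hβ']
          linarith
        _ = (n : ℝ) ^ β' * (n : ℝ) ^ (1 / 2 : ℝ) := Real.rpow_add hn0 _ _
        _ ≤ _ := by gcongr
    nlinarith
  have hcorr : ∀ r ∈ Ico 1 Q, ‖correlation (fun i => expTwoPi (a i)) n r‖
      ≤ C * (n * (Q * lam) ^ α) + C * ((n : ℝ) ^ β * lam ^ (-α)) * (r : ℝ) ^ (-α) := by
    intro r hr
    have hr := mem_Ico.1 hr
    have hr0 : (0 : ℝ) < r := by exact_mod_cast hr.1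
    have e1 : correlation (fun i => expTwoPi (a i)) n r
        = ∑ i ∈ range (n - r), expTwoPi (a (i + r) - a i) := by
      rw [correlation]
      refine sum_congr rfl fun i _ => ?_
      rw [sub_eq_add_neg, expTwoPi_add, expTwoPi_neg]
    rw [e1]
    have hm : ((n - r : ℕ) : ℝ) ≤ n := by exact_mod_cast Nat.sub_le n r
    refine (hS (r * lam) (fun i => a (i + r) - a i) (n - r) (by positivity) (by omega)
      fun i hi => ?_).trans ?_
    · rw [fwdDiff_iterate_shift_sub]
      constructor
      · calc (r : ℝ) * lam = ∑ s ∈ range r, lam := by simp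
          _ ≤ _ := sum_le_sum fun s hs => (hdiff _ (by have := mem_range.1 hs; omega)).1
      · calc _ ≤ ∑ s ∈ range r, A * lam :=
            sum_le_sum fun s hs => (hdiff _ (by have := mem_range.1 hs; omega)).2
          _ = A * (r * lam) := by simp; ring
    · rw [mul_add]
      have hrQ : (r : ℝ) ≤ Q := by exact_mod_cast hr.2.le
      have h1 : ((n - r : ℕ) : ℝ) * (r * lam) ^ α ≤ n * (Q * lam) ^ α := by gcongr
      have h2 : ((n - r : ℕ) : ℝ) ^ β * (r * lam) ^ (-α)
          ≤ (n : ℝ) ^ β * lam ^ (-α) * (r : ℝ) ^ (-α) := by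
        rw [Real.mul_rpow hr0.le hlam.le, mul_assoc, mul_comm (lam ^ (-α))]
        gcongr
      have h3 := mul_le_mul_of_nonneg_left h1 hC
      have h4 := mul_le_mul_of_nonneg_left h2 hC
      linarith
  have hsum : ∑ r ∈ Ico 1 Q, ‖correlation (fun i => expTwoPi (a i)) n r‖
      ≤ Q * (C * (n * (Q * lam) ^ α)) + C * ((n : ℝ) ^ β * lam ^ (-α)) * (2 * (Q : ℝ) ^ (1 - α)) := by
    refine (sum_le_sum hcorr).trans ?_
    rw [sum_add_distrib, sum_const, Nat.card_Ico, nsmul_eq_mul, ← mul_sum]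
    have h1 := sum_Ico_rpow_neg_le hα2 Q hQ1
    have h2 : ((Q - 1 : ℕ) : ℝ) ≤ Q := by exact_mod_cast Nat.sub_le _ _
    gcongr
  have hvdc := sq_norm_sum_le_correlation (fun i => expTwoPi (a i)) (fun i => (norm_expTwoPi _).le)
    n Q hQ1 hQn
  have hlamP : lam ^ γ * P = 1 := by
    rw [hP, ← Real.rpow_add hlam]
    simp
  have hPl : P * lam = lam ^ (1 - γ) := by
    rw [hP, sub_eq_add_neg, add_comm, Real.rpow_add hlam, Real.rpow_one]
  have hX : (Q * lam) ^ α ≤ 2 * lam ^ γ := by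
    calc (Q * lam) ^ α ≤ (2 * lam ^ (1 - γ)) ^ α := by
          rw [← hPl]
          exact Real.rpow_le_rpow (by positivity) (by nlinarith) hα.le
      _ = 2 ^ α * lam ^ γ := by
          rw [Real.mul_rpow (by norm_num) (by positivity), ← Real.rpow_mul hlam.le, hγ2]
      _ ≤ 2 * lam ^ γ := by
          gcongr
          calc (2 : ℝ) ^ α ≤ 2 ^ (1 : ℝ) :=
                Real.rpow_le_rpow_of_exponent_le (by norm_num) (by linarith)
            _ = 2 := Real.rpow_one 2
  have hY : (Q * lam) ^ (-α) ≤ lam ^ (-γ) := by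
    calc (Q * lam) ^ (-α) ≤ (lam ^ (1 - γ)) ^ (-α) := by
          rw [← hPl]
          apply Real.rpow_le_rpow_of_nonpos (by positivity) (by gcongr) (by linarith)
      _ = lam ^ (-γ) := by
          rw [← Real.rpow_mul hlam.le]
          congr 1
          linarith
  have hQinv : (n : ℝ) / Q ≤ n * lam ^ γ := by
    rw [div_le_iff₀ hQ0]
    have : 1 ≤ lam ^ γ * Q := by
      rw [← hlamP]
      gcongr
    nlinarith
  have hfin : ‖∑ i ∈ range n, expTwoPi (a i)‖ ^ 2 ≤
      (2 + 8 * C) * ((n : ℝ) ^ 2 * lam ^ γ) + 8 * C * ((n : ℝ) ^ (1 + β) * lam ^ (-γ)) := by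
    refine hvdc.trans ?_
    calc _ ≤ 2 * (n : ℝ) / Q * (n + 2 * (Q * (C * (n * (Q * lam) ^ α))
            + C * ((n : ℝ) ^ β * lam ^ (-α)) * (2 * (Q : ℝ) ^ (1 - α)))) := by gcongr
      _ = 2 * n * (n / Q) + 4 * C * (n : ℝ) ^ 2 * (Q * lam) ^ α
            + 8 * C * (n * (n : ℝ) ^ β) * (Q * lam) ^ (-α) := by
          rw [Real.mul_rpow hQ0.le hlam.le (z := -α), sub_eq_add_neg, Real.rpow_add hQ0,
            Real.rpow_one]
          field_simp
          ring
      _ ≤ 2 * n * (n * lam ^ γ) + 4 * C * (n : ℝ) ^ 2 * (2 * lam ^ γ)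
            + 8 * C * (n * (n : ℝ) ^ β) * lam ^ (-γ) := by gcongr
      _ = _ := by
          rw [Real.rpow_add hn0, Real.rpow_one]
          ring
  have e1 : (n : ℝ) ^ 2 * lam ^ γ = (n * lam ^ α') ^ 2 := by
    rw [mul_pow, ← Real.rpow_natCast (lam ^ α'), ← Real.rpow_mul hlam.le, hγα]
    congr 2
    push_cast
    ring
  have e2 : (n : ℝ) ^ (1 + β) * lam ^ (-γ) = ((n : ℝ) ^ β' * lam ^ (-α')) ^ 2 := by
    rw [mul_pow, ← Real.rpow_natCast (lam ^ (-α')), ← Real.rpow_mul hlam.le, hγα,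
      ← Real.rpow_natCast ((n : ℝ) ^ β'), ← Real.rpow_mul hn0.le, hβ']
    congr 2 <;> push_cast <;> ring
  rw [e1, e2] at hfin
  set U := (n : ℝ) * lam ^ α'
  set V := (n : ℝ) ^ β' * lam ^ (-α')
  refine abs_le_of_sq_le_sq' ?_ (by positivity) |>.2
  refine hfin.trans ?_
  have h1 : 0 ≤ (2 + 8 * C) * (2 * (U * V)) + 2 * V ^ 2 := by positivity
  calc (2 + 8 * C) * U ^ 2 + 8 * C * V ^ 2 ≤ (2 + 8 * C) * (U + V) ^ 2 := by linarith
    _ ≤ (2 + 8 * C) ^ 2 * (U + V) ^ 2 := by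
      gcongr
      exact le_self_pow₀ (by linarith) two_ne_zero
    _ = _ := (mul_pow _ _ _).symm

/-- Three differencing steps: (1/2, 0) → (1/6, 1/2) → (1/14, 3/4) → (1/30, 7/8). -/
lemma hasDiffTest_five : HasDiffTest 5 (1 / 30) (7 / 8) := by
  have h3 := hasDiffTest_two.succ (by norm_num) (by norm_num) (by norm_num)
  have h4 := h3.succ (by norm_num) (by norm_num) (by norm_num)
  have h5 := h4.succ (by norm_num) (by norm_num) (by norm_num)
  norm_num at h5 ⊢
  exact h5

/-! ### Sums with phase 2√(y(ν+t)) -/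

/-- Iterated differences of a smooth function are bounded by its derivative of the same order. -/
lemma fwdDiff_iterate_mem_of_hasDerivAt (k : ℕ) (F : ℕ → ℝ → ℝ) {p : ℝ}
    (hF : ∀ i < k, ∀ u, p ≤ u → HasDerivAt (F i) (F (i + 1) u) u) (t lo hi : ℝ) (i : ℕ)
    (hp : p ≤ i + t) (h : ∀ u, i + t ≤ u → u ≤ i + t + k → lo ≤ F k u ∧ F k u ≤ hi) :
    lo ≤ (fwdDiff 1)^[k] (fun n : ℕ => F 0 (n + t)) i ∧
      (fwdDiff 1)^[k] (fun n : ℕ => F 0 (n + t)) i ≤ hi := by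
  induction k generalizing F with
  | zero => exact h _ le_rfl (by simp)
  | succ k ih =>
    rw [Function.iterate_succ_apply]
    have e : fwdDiff 1 (fun n : ℕ => F 0 (n + t))
        = fun n : ℕ => (fun j u => F j (u + 1) - F j u) 0 (n + t) := by
      funext n
      simp only [fwdDiff]
      push_cast
      rw [show (n : ℝ) + 1 + t = n + t + 1 by ring]
    rw [e]
    refine ih (fun j u => F j (u + 1) - F j u) ?_ ?_
    · intro j hj u hu
      exact ((hF j (by omega) (u + 1) (by linarith)).comp_add_const u 1).sub
        (hF j (by omega) u hu)
    · intro u h1 h2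
      obtain ⟨ξ, hξ, hs⟩ := exists_hasDerivAt_eq_slope (F k) (F (k + 1)) (lt_add_one u)
        (fun v hv => (hF k (by omega) v (by linarith [hv.1])).continuousAt.continuousWithinAt)
        (fun v hv => hF k (by omega) v (by linarith [hv.1]))
      rw [add_sub_cancel_left, div_one] at hs
      rw [← hs]
      refine h ξ (by linarith [hξ.1]) ?_
      push_cast
      linarith [hξ.2]

lemma sum_Ioc_eq_sum_range {M : Type*} [AddCommMonoid M] (f : ℕ → M) (m n : ℕ) :
    ∑ i ∈ Ioc m n, f i = ∑ i ∈ range (n - m), f (m + 1 + i) := by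
  have h : Ioc m n = Ico (m + 1) (n + 1) := by
    ext i
    simp only [mem_Ioc, mem_Ico]
    omega
  rw [h, sum_Ico_eq_sum_range, Nat.add_sub_add_right]

lemma floor_two_mul_sub_floor_le {N : ℝ} (hN : 1 / 2 ≤ N) :
    ((⌊2 * N⌋₊ - ⌊N⌋₊ : ℕ) : ℝ) ≤ 3 * N := by
  rw [Nat.cast_sub (Nat.floor_le_floor (by linarith))]
  have := Nat.floor_le (show 0 ≤ 2 * N by linarith)
  have := Nat.lt_floor_add_one N
  linarith

/-- The fifth derivative test for the phase `2 √(y u)` on a dyadic block. -/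
lemma exists_norm_sum_block_sqrt_le : ∃ C : ℝ, 0 ≤ C ∧ ∀ (y t N : ℝ), 0 < y → -(1 / 2) ≤ t →
    t ≤ 1 / 2 → 1 / 2 ≤ N →
    ‖∑ ν ∈ Ioc ⌊N⌋₊ ⌊2 * N⌋₊, expTwoPi (2 * √(y * (ν + t)))‖
      ≤ C * (y ^ (1 / 60 : ℝ) * N ^ (17 / 20 : ℝ) + y ^ (-(1 / 60) : ℝ) * N ^ (41 / 40 : ℝ)) := by
  -- The fifth differences involve only points u between N/2 and 13N: the first is at least m - 1/2
  -- with m > N and m ≥ 1, the last at most 2N + 1/2 + 5 with N ≥ 1/2. The fifth derivative is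
  -- proportional to u^(-9/2), so it varies by a factor of at most 26^(9/2).
  obtain ⟨C, hC, hS⟩ := hasDiffTest_five ((26 : ℝ) ^ (9 / 2 : ℝ))
    (Real.one_le_rpow (by norm_num) (by norm_num))
  set c0 : ℝ := 105 / 16 * 13 ^ (-(9 / 2) : ℝ) with hc0
  have hc0p : 0 < c0 := by positivity
  refine ⟨C * (3 * c0 ^ (1 / 30 : ℝ) + 3 ^ (7 / 8 : ℝ) * c0 ^ (-(1 / 30) : ℝ)), by positivity,
    fun y t N hy ht1 ht2 hN => ?_⟩
  have hN0 : 0 < N := by linarith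
  set m := ⌊N⌋₊ + 1 with hm
  set n := ⌊2 * N⌋₊ - ⌊N⌋₊ with hn
  have hmN : N / 2 ≤ m - 1 / 2 := by
    have h1 : N < m := by
      rw [hm]
      exact_mod_cast Nat.lt_floor_add_one N
    have h2 : (1 : ℝ) ≤ m := by rw [hm]; exact_mod_cast Nat.le_add_left 1 _
    linarith
  rw [sum_Ioc_eq_sum_range, ← hn, ← hm]
  rcases Nat.eq_zero_or_pos n with h0 | hn1
  · rw [h0, range_zero, sum_empty, norm_zero]
    positivity
  set F : ℕ → ℝ → ℝ := fun i u =>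
    2 * √y * ((∏ j ∈ range i, ((1 / 2 : ℝ) - j)) * u ^ ((1 / 2 : ℝ) - i)) with hF
  have hFd : ∀ i < 5, ∀ u, N / 2 ≤ u → HasDerivAt (F i) (F (i + 1) u) u := by
    intro i _ u hu
    have h1 := ((Real.hasDerivAt_rpow_const (x := u) (p := (1 / 2 : ℝ) - i)
      (Or.inl (by linarith))).const_mul (∏ j ∈ range i, ((1 / 2 : ℝ) - j))).const_mul (2 * √y)
    refine h1.congr_deriv ?_
    simp only [hF]
    rw [prod_range_succ, show (1 / 2 : ℝ) - (i + 1 : ℕ) = 1 / 2 - i - 1 by push_cast; ring]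
    ring
  have hF5 : ∀ u, F 5 u = 2 * √y * (105 / 32 * u ^ (-(9 / 2) : ℝ)) := by
    intro u
    simp only [hF, prod_range_succ, prod_range_zero]
    norm_num
  have hF0 : ∀ u, 0 < u → F 0 u = 2 * √(y * u) := by
    intro u hu
    simp only [hF, prod_range_zero]
    rw [Real.sqrt_mul hy.le, Real.sqrt_eq_rpow u]
    norm_num
    ring
  set lam := c0 * √y * N ^ (-(9 / 2) : ℝ) with hlam
  have hlam0 : 0 < lam := by positivity
  have hterm : ∀ i ∈ range n, expTwoPi (2 * √(y * ((m + i : ℕ) + t)))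
      = expTwoPi ((fun i : ℕ => F 0 (i + (m + t))) i) := by
    intro i _
    simp only
    have hi0 : (0 : ℝ) ≤ i := Nat.cast_nonneg i
    rw [hF0 _ (by linarith)]
    congr 4
    push_cast
    ring
  rw [sum_congr rfl hterm]
  refine (hS lam _ n hlam0 hn1 fun i hi => ?_).trans ?_
  · refine fwdDiff_iterate_mem_of_hasDerivAt 5 F hFd (m + t) lam _ i ?_ ?_
    · have hi0 : (0 : ℝ) ≤ i := Nat.cast_nonneg i
      linarith
    · intro u h1 h2
      have hi0 : (0 : ℝ) ≤ i := Nat.cast_nonneg i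
      have hu1 : N / 2 ≤ u := by linarith
      have hu2 : u ≤ 13 * N := by
        have h3 : m + i ≤ ⌊2 * N⌋₊ := by omega
        have h4 : ((m + i : ℕ) : ℝ) ≤ 2 * N :=
          (Nat.cast_le.2 h3).trans (Nat.floor_le (by linarith))
        push_cast at h4 h2
        linarith
      have hu0 : 0 < u := by linarith
      rw [hF5]
      constructor
      · have h5 : (13 * N) ^ (-(9 / 2) : ℝ) ≤ u ^ (-(9 / 2) : ℝ) :=
          Real.rpow_le_rpow_of_nonpos hu0 hu2 (by norm_num)
        calc lam = 2 * √y * (105 / 32 * (13 * N) ^ (-(9 / 2) : ℝ)) := by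
              rw [hlam, hc0, Real.mul_rpow (by norm_num) hN0.le]
              ring
          _ ≤ _ := by gcongr
      · have h5 : u ^ (-(9 / 2) : ℝ) ≤ (N / 2) ^ (-(9 / 2) : ℝ) :=
          Real.rpow_le_rpow_of_nonpos (by linarith) hu1 (by norm_num)
        calc _ ≤ 2 * √y * (105 / 32 * (N / 2) ^ (-(9 / 2) : ℝ)) := by gcongr
          _ = _ := by
              have e1 : (N / 2) ^ (-(9 / 2) : ℝ)
                  = 26 ^ (9 / 2 : ℝ) * (13 ^ (-(9 / 2) : ℝ) * N ^ (-(9 / 2) : ℝ)) := by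
                rw [show N / 2 = (26 : ℝ)⁻¹ * (13 * N) by ring,
                  Real.mul_rpow (by norm_num) (by positivity),
                  Real.mul_rpow (by norm_num) hN0.le, Real.inv_rpow (by norm_num),
                  Real.rpow_neg (by norm_num) (9 / 2), inv_inv]
              rw [e1, hlam, hc0]
              ring
  · have hn3 : (n : ℝ) ≤ 3 * N := floor_two_mul_sub_floor_le hN
    have hsq : √y = y ^ (1 / 2 : ℝ) := Real.sqrt_eq_rpow y
    have e1 : lam ^ (1 / 30 : ℝ)
        = c0 ^ (1 / 30 : ℝ) * y ^ (1 / 60 : ℝ) * N ^ (-(3 / 20) : ℝ) := by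
      rw [hlam, Real.mul_rpow (by positivity) (by positivity),
        Real.mul_rpow hc0p.le (by positivity), hsq, ← Real.rpow_mul hy.le,
        ← Real.rpow_mul hN0.le]
      norm_num
    have e2 : lam ^ (-(1 / 30) : ℝ)
        = c0 ^ (-(1 / 30) : ℝ) * y ^ (-(1 / 60) : ℝ) * N ^ (3 / 20 : ℝ) := by
      rw [hlam, Real.mul_rpow (by positivity) (by positivity),
        Real.mul_rpow hc0p.le (by positivity), hsq, ← Real.rpow_mul hy.le,
        ← Real.rpow_mul hN0.le]
      norm_num
    have e3 : N ^ (17 / 20 : ℝ) = N * N ^ (-(3 / 20) : ℝ) := by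
      rw [← Real.rpow_one_add' hN0.le (by norm_num)]
      norm_num
    have e4 : N ^ (41 / 40 : ℝ) = N ^ (7 / 8 : ℝ) * N ^ (3 / 20 : ℝ) := by
      rw [← Real.rpow_add hN0]
      norm_num
    have h1 : (n : ℝ) * lam ^ (1 / 30 : ℝ)
        ≤ 3 * c0 ^ (1 / 30 : ℝ) * (y ^ (1 / 60 : ℝ) * N ^ (17 / 20 : ℝ)) := by
      calc _ ≤ 3 * N * lam ^ (1 / 30 : ℝ) := by gcongr
        _ = _ := by rw [e1, e3]; ring
    have h2 : (n : ℝ) ^ (7 / 8 : ℝ) * lam ^ (-(1 / 30) : ℝ)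
        ≤ 3 ^ (7 / 8 : ℝ) * c0 ^ (-(1 / 30) : ℝ) * (y ^ (-(1 / 60) : ℝ) * N ^ (41 / 40 : ℝ)) := by
      calc _ ≤ (3 * N) ^ (7 / 8 : ℝ) * lam ^ (-(1 / 30) : ℝ) := by gcongr
        _ = _ := by rw [e2, e4, Real.mul_rpow (by norm_num) hN0.le]; ring
    rw [mul_assoc]
    gcongr
    set X := y ^ (1 / 60 : ℝ) * N ^ (17 / 20 : ℝ)
    set Y := y ^ (-(1 / 60) : ℝ) * N ^ (41 / 40 : ℝ)
    have hX : 0 ≤ X := by positivity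
    have hY : 0 ≤ Y := by positivity
    have h3 : 0 ≤ 3 * c0 ^ (1 / 30 : ℝ) * Y := by positivity
    have h4 : 0 ≤ 3 ^ (7 / 8 : ℝ) * c0 ^ (-(1 / 30) : ℝ) * X := by positivity
    linarith

/-- Dyadic decomposition of a sum over `n ≤ N₀`. -/
lemma exists_norm_sum_Ioc_le_dyadic {E : Type*} [SeminormedAddCommGroup E] (f : ℕ → E) (N₀ : ℝ)
    (hN₀ : 1 ≤ N₀) (b : ℝ → ℝ)
    (h : ∀ N, 1 / 2 ≤ N → 2 * N ≤ N₀ → ‖∑ n ∈ Ioc ⌊N⌋₊ ⌊2 * N⌋₊, f n‖ ≤ b N) :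
    ∃ J : ℕ, (J : ℝ) ≤ 1 + Real.log N₀ / Real.log 2 ∧ (∀ j < J, 1 / 2 ≤ N₀ / 2 ^ (j + 1)) ∧
      ‖∑ n ∈ Ioc 0 ⌊N₀⌋₊, f n‖ ≤ ∑ j ∈ range J, b (N₀ / 2 ^ (j + 1)) := by
  have hsplit : ∀ J : ℕ, ∑ n ∈ Ioc 0 ⌊N₀⌋₊, f n = ∑ n ∈ Ioc 0 ⌊N₀ / 2 ^ J⌋₊, f n
      + ∑ j ∈ range J, ∑ n ∈ Ioc ⌊N₀ / 2 ^ (j + 1)⌋₊ ⌊N₀ / 2 ^ j⌋₊, f n := by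
    intro J
    induction J with
    | zero => simp
    | succ J ih =>
      rw [ih, sum_range_succ, ← add_assoc, add_right_comm]
      congr 1
      rw [sum_Ioc_consecutive _ (Nat.zero_le _) (Nat.floor_le_floor _)]
      gcongr
      · norm_num
      · omega
  have h2 : 0 < Real.log 2 := Real.log_pos (by norm_num)
  set r := Real.log N₀ / Real.log 2 with hr
  have hr0 : 0 ≤ r := div_nonneg (Real.log_nonneg hN₀) h2.le
  have hpow : ∀ j : ℕ, (j : ℝ) ≤ r ↔ (2 : ℝ) ^ j ≤ N₀ := by
    intro j
    rw [hr, le_div_iff₀ h2, ← Real.log_pow, Real.log_le_log_iff (by positivity) (by linarith)]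
  have hJ : ∀ j < ⌊r⌋₊ + 1, 1 / 2 ≤ N₀ / 2 ^ (j + 1) := by
    intro j hj
    have h3 := (hpow j).1 ((Nat.cast_le.2 (Nat.lt_succ_iff.1 hj)).trans (Nat.floor_le hr0))
    rw [le_div_iff₀ (by positivity), pow_succ]
    linarith
  refine ⟨⌊r⌋₊ + 1, ?_, hJ, ?_⟩
  · push_cast
    linarith [Nat.floor_le hr0]
  · rw [hsplit (⌊r⌋₊ + 1)]
    -- After more than log₂ N₀ halvings the remaining range lies below 1 and contains no positive
    -- integer.
    have h3 : ⌊N₀ / 2 ^ (⌊r⌋₊ + 1)⌋₊ = 0 := by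
      rw [Nat.floor_eq_zero, div_lt_one (by positivity)]
      by_contra hcon
      push Not at hcon
      have := (hpow _).2 hcon
      have := Nat.lt_floor_add_one r
      push_cast at *
      linarith
    rw [h3, Ioc_self, sum_empty, zero_add]
    refine norm_sum_le_of_le _ fun j hj => ?_
    have h4 := h (N₀ / 2 ^ (j + 1)) (hJ j (mem_range.1 hj)) ?_
    · rwa [show 2 * (N₀ / 2 ^ (j + 1)) = N₀ / 2 ^ j by rw [pow_succ]; field_simp] at h4
    · rw [pow_succ, show 2 * (N₀ / (2 ^ j * 2)) = N₀ / 2 ^ j by field_simp]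
      exact div_le_self (by linarith) (one_le_pow₀ (by norm_num))

lemma sum_range_dyadic_rpow_le {w N₀ : ℝ} (hw : 0 < w) (hN₀ : 0 ≤ N₀) (J : ℕ) :
    ∑ j ∈ range J, (N₀ / 2 ^ (j + 1)) ^ w ≤ N₀ ^ w / (2 ^ w - 1) := by
  have h2 : (1 : ℝ) < 2 ^ w := Real.one_lt_rpow (by norm_num) hw
  have h3 : ((2 : ℝ) ^ w)⁻¹ < 1 := inv_lt_one_of_one_lt₀ h2
  have e : ∀ j ∈ range J, (N₀ / 2 ^ (j + 1)) ^ w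
      = N₀ ^ w * ((2 : ℝ) ^ w)⁻¹ * (((2 : ℝ) ^ w)⁻¹) ^ j := by
    intro j _
    rw [Real.div_rpow hN₀ (by positivity), ← Real.rpow_natCast, ← Real.rpow_mul (by norm_num),
      mul_comm, Real.rpow_mul (by norm_num), Real.rpow_natCast, pow_succ, div_eq_mul_inv]
    rw [mul_inv, inv_pow]
    ring
  rw [sum_congr rfl e, ← mul_sum]
  have h4 : ∑ j ∈ range J, (((2 : ℝ) ^ w)⁻¹) ^ j ≤ (1 - ((2 : ℝ) ^ w)⁻¹)⁻¹ := by
    rw [← tsum_geometric_of_lt_one (by positivity) h3]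
    exact (summable_geometric_of_lt_one (by positivity) h3).sum_le_tsum _
      (fun _ _ => by positivity)
  calc _ ≤ N₀ ^ w * ((2 : ℝ) ^ w)⁻¹ * (1 - ((2 : ℝ) ^ w)⁻¹)⁻¹ := by gcongr
    _ = _ := by
      have : (2 : ℝ) ^ w - 1 ≠ 0 := by linarith
      have : (1 : ℝ) - ((2 : ℝ) ^ w)⁻¹ ≠ 0 := by linarith
      field_simp

lemma exists_norm_sum_sqrt_le : ∃ C : ℝ, 0 ≤ C ∧ ∀ (y t : ℝ) (n : ℕ), 0 < y → -(1 / 2) ≤ t →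
    t ≤ 1 / 2 →
    ‖∑ ν ∈ Ioc 0 n, expTwoPi (2 * √(y * (ν + t)))‖
      ≤ C * (y ^ (1 / 60 : ℝ) * (n : ℝ) ^ (17 / 20 : ℝ)
        + y ^ (-(1 / 60) : ℝ) * (n : ℝ) ^ (41 / 40 : ℝ)) := by
  obtain ⟨C, hC, hS⟩ := exists_norm_sum_block_sqrt_le
  have hq1 : (0 : ℝ) < 2 ^ (17 / 20 : ℝ) - 1 := by
    linarith [Real.one_lt_rpow (x := 2) (z := 17 / 20) (by norm_num) (by norm_num)]
  have hq2 : (0 : ℝ) < 2 ^ (41 / 40 : ℝ) - 1 := by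
    linarith [Real.one_lt_rpow (x := 2) (z := 41 / 40) (by norm_num) (by norm_num)]
  set q1 := (2 : ℝ) ^ (17 / 20 : ℝ) - 1
  set q2 := (2 : ℝ) ^ (41 / 40 : ℝ) - 1
  refine ⟨C * (q1⁻¹ + q2⁻¹), by positivity, fun y t n hy ht1 ht2 => ?_⟩
  rcases Nat.eq_zero_or_pos n with rfl | hn
  · simp only [Ioc_self, sum_empty, norm_zero]
    positivity
  have hn1 : (1 : ℝ) ≤ n := by exact_mod_cast hn
  obtain ⟨J, -, -, hJ⟩ := exists_norm_sum_Ioc_le_dyadic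
    (fun ν : ℕ => expTwoPi (2 * √(y * (ν + t)))) n hn1 _
    (fun N hN _ => hS y t N hy ht1 ht2 hN)
  rw [Nat.floor_natCast] at hJ
  refine hJ.trans ?_
  rw [← mul_sum, sum_add_distrib, ← mul_sum, ← mul_sum, mul_assoc]
  gcongr
  have h1 := sum_range_dyadic_rpow_le (w := 17 / 20) (by norm_num) (Nat.cast_nonneg (α := ℝ) n) J
  have h2 := sum_range_dyadic_rpow_le (w := 41 / 40) (by norm_num) (Nat.cast_nonneg (α := ℝ) n) J
  set X := (n : ℝ) ^ (17 / 20 : ℝ)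
  set Y := (n : ℝ) ^ (41 / 40 : ℝ)
  calc _ ≤ y ^ (1 / 60 : ℝ) * (X / q1) + y ^ (-(1 / 60) : ℝ) * (Y / q2) := by gcongr
    _ = q1⁻¹ * (y ^ (1 / 60 : ℝ) * X) + q2⁻¹ * (y ^ (-(1 / 60) : ℝ) * Y) := by
      rw [div_eq_mul_inv, div_eq_mul_inv]
      ring
    _ ≤ _ := by
      have h3 : 0 ≤ q1⁻¹ * (y ^ (-(1 / 60) : ℝ) * Y) := by positivity
      have h4 : 0 ≤ q2⁻¹ * (y ^ (1 / 60 : ℝ) * X) := by positivity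
      linarith

/-! ### The damped dual sum -/

/-- The function `s ↦ sin (4π √(ys)) exp (-2πas)`, which vanishes for `s ≤ 0`. -/
noncomputable def dampedSine (y a s : ℝ) : ℝ :=
  Real.sin (4 * Real.pi * √(y * s)) * Real.exp (-(2 * Real.pi * a * s))

lemma sum_mul_eq_by_parts (f g : ℕ → ℂ) (n : ℕ) :
    ∑ ν ∈ Ioc 0 n, f ν * g ν = (∑ ν ∈ Ioc 0 n, f ν) * g (n + 1)
      + ∑ ν ∈ Ioc 0 n, (∑ μ ∈ Ioc 0 ν, f μ) * (g ν - g (ν + 1)) := by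
  induction n with
  | zero => simp
  | succ n ih =>
    rw [sum_Ioc_succ_top (Nat.zero_le n), ih, sum_Ioc_succ_top (Nat.zero_le n),
      sum_Ioc_succ_top (Nat.zero_le n) (fun ν => (∑ μ ∈ Ioc 0 ν, f μ) * (g ν - g (ν + 1))),
      sum_Ioc_succ_top (Nat.zero_le n)]
    ring

lemma rpow_le_exp_pi_mul {u w : ℝ} (hu : 0 ≤ u) (hw : 0 ≤ w) (hw2 : w ≤ 2) :
    u ^ w ≤ Real.exp (Real.pi * u) := by
  have h1 : u ^ w ≤ 1 + u ^ 2 := by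
    rcases le_total u 1 with h | h
    · have := Real.rpow_le_one hu h hw
      nlinarith [sq_nonneg u]
    · have := Real.rpow_le_rpow_of_exponent_le h hw2
      rw [Real.rpow_ofNat] at this
      linarith
  have h2 := Real.quadratic_le_exp_of_nonneg (x := Real.pi * u) (by positivity)
  have h3 := Real.pi_gt_three
  have h4 : 0 ≤ (Real.pi ^ 2 - 9) * u ^ 2 := mul_nonneg (by nlinarith) (sq_nonneg u)
  have h5 := mul_nonneg Real.pi_pos.le hu
  nlinarith [sq_nonneg u]

lemma geom_sum_Ioc_le {q : ℝ} (hq : 0 ≤ q) (n : ℕ) :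
    (1 - q) * ∑ ν ∈ Ioc 0 n, q ^ ν ≤ q := by
  have : (1 - q) * ∑ ν ∈ Ioc 0 n, q ^ ν = q - q ^ (n + 1) := by
    induction n with
    | zero => simp
    | succ n ih =>
      rw [sum_Ioc_succ_top (Nat.zero_le n), mul_add, ih]
      ring
  rw [this]
  have : 0 ≤ q ^ (n + 1) := by positivity
  linarith

/-- The damping makes 1/a the effective length of the sum, so partial summation replaces n by 1/a in
the undamped bound. Uniformity in K and in t over one period is what the folding argument requires.
-/
lemma exists_abs_sum_dampedSine_le : ∃ C : ℝ, 0 ≤ C ∧ ∀ (y a t : ℝ) (K : ℕ), 0 < y → 0 < a →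
    -(1 / 2) ≤ t → t ≤ 1 / 2 →
    |∑ ν ∈ range K, dampedSine y a (t + ν)|
      ≤ C * (1 + y ^ (1 / 60 : ℝ) * a ^ (-(17 / 20) : ℝ)
        + y ^ (-(1 / 60) : ℝ) * a ^ (-(41 / 40) : ℝ)) := by
  obtain ⟨C, hC, hS⟩ := exists_norm_sum_sqrt_le
  refine ⟨1 + 3 * C, by positivity, fun y a t K hy ha ht1 ht2 => ?_⟩
  set B := y ^ (1 / 60 : ℝ) * a ^ (-(17 / 20) : ℝ) + y ^ (-(1 / 60) : ℝ) * a ^ (-(41 / 40) : ℝ)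
    with hB
  have hB0 : 0 ≤ B := by positivity
  have hpi := Real.pi_pos
  suffices h : |∑ ν ∈ range K, dampedSine y a (t + ν)| ≤ 1 + 3 * C * B by
    rw [add_assoc, ← hB]
    nlinarith [mul_nonneg hC hB0]
  rcases K with _ | n
  · simp only [range_zero, sum_empty, abs_zero]
    positivity
  -- The term ν = 0 is set apart: t may be negative, and the undamped bound concerns ν ≥ 1.
  rw [sum_range_succ']
  have h0 : |dampedSine y a (t + (0 : ℕ))| ≤ 1 := by
    rw [dampedSine, Nat.cast_zero, add_zero]
    rcases le_total t 0 with h | h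
    · rw [Real.sqrt_eq_zero_of_nonpos (by nlinarith)]
      simp
    · rw [abs_mul]
      refine mul_le_one₀ (Real.abs_sin_le_one _) (abs_nonneg _) ?_
      rw [Real.abs_exp, Real.exp_le_one_iff]
      have : 0 ≤ 2 * Real.pi * a * t := by positivity
      linarith
  set f : ℕ → ℂ := fun ν => expTwoPi (2 * √(y * (ν + t))) with hf
  set g : ℕ → ℝ := fun ν => Real.exp (-(2 * Real.pi * a * (t + ν))) with hg
  have h1 : ∑ ν ∈ range n, dampedSine y a (t + (ν + 1 : ℕ))
      = (∑ ν ∈ Ioc 0 n, f ν * (g ν : ℂ)).im := by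
    rw [sum_Ioc_eq_sum_range, Complex.im_sum, Nat.sub_zero]
    refine sum_congr rfl fun ν _ => ?_
    rw [Complex.im_mul_ofReal, hf, hg, expTwoPi_im, dampedSine]
    congr 2
    · rw [Nat.zero_add, Nat.add_comm 1 ν, add_comm t]
      ring
    · rw [Nat.zero_add, Nat.add_comm 1 ν]
  -- The full damping ratio per step is q²; one factor q^ν is spent on the growth of the partial
  -- sums and the other makes the series of differences converge.
  set q := Real.exp (-(Real.pi * a)) with hq
  have hq0 : 0 < q := Real.exp_pos _
  have hq1 : q ≤ 1 := Real.exp_le_one_iff.2 (by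
    have := mul_pos hpi ha
    linarith)
  have hP : ∀ ν : ℕ, ‖∑ μ ∈ Ioc 0 ν, f μ‖ ≤ C * B * (q⁻¹) ^ ν := by
    intro ν
    refine (hS y t ν hy ht1 ht2).trans ?_
    have hw : ∀ w : ℝ, 0 ≤ w → w ≤ 2 → (ν : ℝ) ^ w ≤ a ^ (-w) * (q⁻¹) ^ ν := by
      intro w hw1 hw2
      have h2 := rpow_le_exp_pi_mul (u := a * ν) (by positivity) hw1 hw2
      have h3 : (q⁻¹) ^ ν = Real.exp (Real.pi * (a * ν)) := by
        rw [hq, ← Real.exp_neg, ← Real.exp_nat_mul]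
        congr 1
        ring
      rw [Real.mul_rpow ha.le (Nat.cast_nonneg _)] at h2
      rw [h3, Real.rpow_neg ha.le, ← div_eq_inv_mul, le_div_iff₀ (by positivity)]
      linarith
    rw [mul_assoc, hB, add_mul]
    refine mul_le_mul_of_nonneg_left (add_le_add ?_ ?_) hC
    · rw [mul_assoc]
      exact mul_le_mul_of_nonneg_left (hw _ (by norm_num) (by norm_num)) (by positivity)
    · rw [mul_assoc]
      exact mul_le_mul_of_nonneg_left (hw _ (by norm_num) (by norm_num)) (by positivity)
  have hgq : ∀ ν : ℕ, g ν = Real.exp (-(2 * Real.pi * a * t)) * (q * q) ^ ν := by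
    intro ν
    rw [hq, ← Real.exp_add, ← Real.exp_nat_mul, ← Real.exp_add]
    simp only [hg]
    congr 1
    ring
  set E := Real.exp (-(2 * Real.pi * a * t)) with hE
  have hE0 : 0 < E := Real.exp_pos _
  have hEq : E * q ≤ 1 := by
    rw [hE, hq, ← Real.exp_add, Real.exp_le_one_iff]
    have : 0 ≤ Real.pi * a * (2 * t + 1) := mul_nonneg (mul_pos hpi ha).le (by linarith)
    linarith
  have hCB : 0 ≤ C * B := by positivity
  have hmain : ‖∑ ν ∈ Ioc 0 n, f ν * (g ν : ℂ)‖ ≤ 3 * C * B := by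
    rw [sum_mul_eq_by_parts]
    refine (norm_add_le _ _).trans ?_
    have hqq : ∀ ν : ℕ, (q⁻¹) ^ ν * (q * q) ^ ν = q ^ ν := by
      intro ν
      rw [← mul_pow]
      congr 1
      field_simp
    have e1 : ‖(∑ ν ∈ Ioc 0 n, f ν) * (g (n + 1) : ℂ)‖ ≤ C * B := by
      rw [norm_mul, Complex.norm_real, Real.norm_of_nonneg (show 0 ≤ g (n + 1) from (Real.exp_pos _).le), hgq]
      calc _ ≤ C * B * (q⁻¹) ^ n * (E * (q * q) ^ (n + 1)) := by
            gcongr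
            exact hP n
        _ = C * B * ((q⁻¹) ^ n * (q * q) ^ n * (E * q) * q) := by ring
        _ ≤ C * B * (1 * 1 * 1) := by
            rw [hqq]
            gcongr
            exact pow_le_one₀ hq0.le hq1
        _ = C * B := by ring
    have e2 : ‖∑ ν ∈ Ioc 0 n, (∑ μ ∈ Ioc 0 ν, f μ) * ((g ν : ℂ) - (g (ν + 1) : ℂ))‖
        ≤ 2 * (C * B) := by
      have : ∀ ν ∈ Ioc 0 n, ‖(∑ μ ∈ Ioc 0 ν, f μ) * ((g ν : ℂ) - (g (ν + 1) : ℂ))‖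
          ≤ C * B * (E * (1 - q * q)) * q ^ ν := by
        intro ν _
        have h3 : g ν - g (ν + 1) = E * (1 - q * q) * (q * q) ^ ν := by
          rw [hgq, hgq]
          ring
        have h4 : 0 ≤ 1 - q * q := by nlinarith
        rw [norm_mul, ← Complex.ofReal_sub, Complex.norm_real, h3,
          Real.norm_of_nonneg (by positivity)]
        calc _ ≤ C * B * (q⁻¹) ^ ν * (E * (1 - q * q) * (q * q) ^ ν) := by
              gcongr
              exact hP ν
          _ = C * B * (E * (1 - q * q)) * ((q⁻¹) ^ ν * (q * q) ^ ν) := by ring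
          _ = _ := by rw [hqq]
      refine (norm_sum_le_of_le _ this).trans ?_
      rw [← mul_sum]
      calc _ = C * B * (E * (1 + q) * ((1 - q) * ∑ ν ∈ Ioc 0 n, q ^ ν)) := by ring
        _ ≤ C * B * (E * (1 + q) * q) := by
            gcongr
            exact geom_sum_Ioc_le hq0.le n
        _ = C * B * ((E * q) * (1 + q)) := by ring
        _ ≤ C * B * (1 * (1 + 1)) := by gcongr
        _ = _ := by ring
    linarith
  rw [h1]
  refine (abs_add_le _ _).trans ?_
  have := (Complex.abs_im_le_norm (∑ ν ∈ Ioc 0 n, f ν * (g ν : ℂ))).trans hmain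
  linarith

end

section

open MeasureTheory Set

/-! ### The Fourier transform of the damped sine -/

lemma integrable_sin_mul_gaussian {c : ℂ} (hc : 0 < c.re) (b : ℝ) :
    Integrable fun x : ℝ => (Real.sin (b * x) : ℂ) * ((x : ℂ) * Complex.exp (-c * x ^ 2)) := by
  refine (integrable_mul_cexp_neg_mul_sq hc).bdd_mul (c := 1) ?_ ?_
  · exact (by fun_prop : Continuous fun x : ℝ => (Real.sin (b * x) : ℂ)).aestronglyMeasurable
  · filter_upwards with x
    rw [Complex.norm_real]
    exact Real.abs_sin_le_one _

lemma integrable_cos_mul_gaussian {c : ℂ} (hc : 0 < c.re) (b : ℝ) :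
    Integrable fun x : ℝ => (Real.cos (b * x) : ℂ) * Complex.exp (-c * x ^ 2) := by
  refine (integrable_cexp_neg_mul_sq hc).bdd_mul (c := 1) ?_ ?_
  · exact (by fun_prop : Continuous fun x : ℝ => (Real.cos (b * x) : ℂ)).aestronglyMeasurable
  · filter_upwards with x
    rw [Complex.norm_real]
    exact Real.abs_cos_le_one _

lemma integral_cos_mul_gaussian {c : ℂ} (hc : 0 < c.re) (b : ℝ) :
    ∫ x : ℝ, (Real.cos (b * x) : ℂ) * Complex.exp (-c * x ^ 2)
      = (Real.pi / c) ^ (1 / 2 : ℂ) * Complex.exp (-b ^ 2 / (4 * c)) := by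
  have h1 := fourierIntegral_gaussian hc (b : ℂ)
  have h2 := fourierIntegral_gaussian hc (-(b : ℂ))
  have hi : ∀ t : ℝ, Integrable fun x : ℝ =>
      Complex.exp (Complex.I * t * x) * Complex.exp (-c * x ^ 2) := by
    intro t
    refine (integrable_cexp_neg_mul_sq hc).bdd_mul (c := 1) ?_ ?_
    · exact (by fun_prop : Continuous fun x : ℝ =>
        Complex.exp (Complex.I * t * x)).aestronglyMeasurable
    · filter_upwards with x
      rw [show Complex.I * t * x = ((t * x : ℝ) : ℂ) * Complex.I by push_cast; ring,
        Complex.norm_exp_ofReal_mul_I]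
  have e : ∀ x : ℝ, (Real.cos (b * x) : ℂ) * Complex.exp (-c * x ^ 2)
      = 1 / 2 * (Complex.exp (Complex.I * b * x) * Complex.exp (-c * x ^ 2))
        + 1 / 2 * (Complex.exp (Complex.I * (-(b : ℂ)) * x) * Complex.exp (-c * x ^ 2)) := by
    intro x
    push_cast
    rw [Complex.cos, show (b : ℂ) * x * Complex.I = Complex.I * b * x by ring,
      show -((b : ℂ) * x) * Complex.I = Complex.I * (-(b : ℂ)) * x by ring]
    ring
  simp_rw [e]
  have hi2 := hi (-b)
  push_cast at hi2
  rw [integral_add ((hi b).const_mul _) (hi2.const_mul _), integral_const_mul,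
    integral_const_mul, h1, h2]
  ring_nf

lemma integral_Ioi_cos_mul_gaussian {c : ℂ} (hc : 0 < c.re) (b : ℝ) :
    ∫ x in Ioi (0 : ℝ), (Real.cos (b * x) : ℂ) * Complex.exp (-c * x ^ 2)
      = 1 / 2 * ((Real.pi / c) ^ (1 / 2 : ℂ) * Complex.exp (-b ^ 2 / (4 * c))) := by
  have hint := integrable_cos_mul_gaussian hc b
  rw [← integral_cos_mul_gaussian hc b,
    ← intervalIntegral.integral_Iic_add_Ioi (b := (0 : ℝ)) hint.integrableOn hint.integrableOn]
  have : ∫ x in Iic (0 : ℝ), (Real.cos (b * x) : ℂ) * Complex.exp (-c * x ^ 2)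
      = ∫ x in Ioi (0 : ℝ), (Real.cos (b * x) : ℂ) * Complex.exp (-c * x ^ 2) := by
    have h := integral_comp_neg_Ioi (0 : ℝ)
      (fun x : ℝ => (Real.cos (b * x) : ℂ) * Complex.exp (-c * x ^ 2))
    rw [neg_zero] at h
    rw [← h]
    refine integral_congr_ae (Filter.Eventually.of_forall fun x => ?_)
    simp
  rw [this]
  ring

/-- Integration by parts: -(1/c) sin(bx) exp(-cx²) vanishes at 0 and at infinity, and its derivative
is the integrand minus b/c times the cosine integrand, whose integral is known. -/
lemma integral_Ioi_sin_mul_gaussian {c : ℂ} (hc : 0 < c.re) (b : ℝ) :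
    ∫ x in Ioi (0 : ℝ), 2 * ((Real.sin (b * x) : ℂ) * ((x : ℂ) * Complex.exp (-c * x ^ 2)))
      = b / (2 * c) * ((Real.pi / c) ^ (1 / 2 : ℂ) * Complex.exp (-b ^ 2 / (4 * c))) := by
  have hc0 : c ≠ 0 := fun h => by simp [h] at hc
  set F : ℝ → ℂ := fun x => -(1 / c) * ((Real.sin (b * x) : ℂ) * Complex.exp (-c * x ^ 2)) with hF
  have hd : ∀ x : ℝ, HasDerivAt F
      (2 * ((Real.sin (b * x) : ℂ) * ((x : ℂ) * Complex.exp (-c * x ^ 2)))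
        - b / c * ((Real.cos (b * x) : ℂ) * Complex.exp (-c * x ^ 2))) x := by
    intro x
    have h1 : HasDerivAt (fun x : ℝ => (Real.sin (b * x) : ℂ)) ((Real.cos (b * x) * b : ℝ) : ℂ) x :=
      HasDerivAt.ofReal_comp (by
        simpa using ((hasDerivAt_id x).const_mul b).sin)
    have h2 : HasDerivAt (fun x : ℝ => Complex.exp (-c * x ^ 2))
        (Complex.exp (-c * x ^ 2) * (-c * (2 * x))) x := by
      have h3 : HasDerivAt (fun x : ℝ => -c * (x : ℂ) ^ 2) (-c * (2 * x)) x := by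
        have h4 := ((hasDerivAt_id x).ofReal_comp.pow 2).const_mul (-c)
        simpa using h4
      exact h3.cexp
    refine ((h1.mul h2).const_mul (-(1 / c))).congr_deriv ?_
    push_cast
    field_simp
    ring
  have hlim : Filter.Tendsto F Filter.atTop (nhds 0) := by
    have h1 : Filter.Tendsto (fun x : ℝ => ‖1 / c‖ * Real.exp (-c.re * x ^ 2)) Filter.atTop
        (nhds 0) := by
      rw [show (0 : ℝ) = ‖1 / c‖ * 0 by ring]
      refine Filter.Tendsto.const_mul _ (Real.tendsto_exp_atBot.comp ?_)
      exact (Filter.tendsto_pow_atTop two_ne_zero).const_mul_atTop_of_neg (by linarith)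
    refine squeeze_zero_norm (fun x => ?_) h1
    rw [hF, norm_mul, norm_neg, norm_mul, Complex.norm_real, norm_cexp_neg_mul_sq]
    gcongr
    exact mul_le_of_le_one_left (Real.exp_pos _).le (Real.abs_sin_le_one _)
  have i1 := ((integrable_sin_mul_gaussian hc b).const_mul 2).integrableOn (s := Ioi (0 : ℝ))
  have i2 := ((integrable_cos_mul_gaussian hc b).const_mul ((b : ℂ) / c)).integrableOn
    (s := Ioi (0 : ℝ))
  have h := integral_Ioi_of_hasDerivAt_of_tendsto (a := (0 : ℝ)) (f := F)
    (hd 0).continuousAt.continuousWithinAt (fun x _ => hd x) (i1.sub i2) hlim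
  rw [integral_sub i1 i2, integral_const_mul ((b : ℂ) / c), integral_Ioi_cos_mul_gaussian hc] at h
  have hF0 : F 0 = 0 := by simp [hF]
  rw [hF0, sub_zero, sub_eq_zero] at h
  rw [h]
  field_simp

/-- The Fourier transform of the damped sine. -/
lemma integral_Ioi_dampedSine_mul_expTwoPi {y a : ℝ} (hy : 0 < y) (ha : 0 < a) (u : ℝ) :
    ∫ s in Ioi (0 : ℝ), (dampedSine y a s : ℂ) * expTwoPi (-(u * s))
      = 2 * Real.pi * √y / (2 * Real.pi * (a + u * Complex.I))
        * ((Real.pi / (2 * Real.pi * (a + u * Complex.I))) ^ (1 / 2 : ℂ)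
          * Complex.exp (-(2 * Real.pi * y / (a + u * Complex.I)))) := by
  have hpi := Real.pi_pos
  set c : ℂ := 2 * Real.pi * (a + u * Complex.I) with hc
  have hcre : 0 < c.re := by
    have : c.re = 2 * Real.pi * a := by simp [hc]
    rw [this]
    positivity
  have hz : (a : ℂ) + u * Complex.I ≠ 0 := fun h => by
    have := congrArg Complex.re h
    simp at this
    linarith
  -- The substitution s = x² removes the square root from the sine and turns the exponentials into a
  -- Gaussian with complex parameter c = 2π(a + iu).
  rw [← integral_comp_rpow_Ioi_of_pos (p := 2) (by norm_num)]
  have h := integral_Ioi_sin_mul_gaussian hcre (4 * Real.pi * √y)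
  have e : ∀ x ∈ Ioi (0 : ℝ), ((2 : ℝ) * x ^ ((2 : ℝ) - 1)) •
      ((dampedSine y a (x ^ (2 : ℝ)) : ℂ) * expTwoPi (-(u * x ^ (2 : ℝ))))
      = 2 * ((Real.sin (4 * Real.pi * √y * x) : ℂ) * ((x : ℂ) * Complex.exp (-c * x ^ 2))) := by
    intro x hx
    have hx : 0 < x := hx
    rw [show (2 : ℝ) - 1 = 1 by norm_num, Real.rpow_one, Real.rpow_ofNat, dampedSine,
      Real.sqrt_mul hy.le, Real.sqrt_sq hx.le, expTwoPi, Complex.real_smul]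
    have e2 : Complex.exp (-c * x ^ 2) = (Real.exp (-(2 * Real.pi * a * x ^ 2)) : ℂ)
        * Complex.exp (2 * Real.pi * Complex.I * ((-(u * x ^ 2) : ℝ) : ℂ)) := by
      rw [Complex.ofReal_exp, ← Complex.exp_add, hc]
      congr 1
      push_cast
      ring
    rw [e2, show 4 * Real.pi * (√y * x) = 4 * Real.pi * √y * x by ring]
    push_cast
    ring
  rw [setIntegral_congr_fun measurableSet_Ioi e, h]
  have hsq : (√y : ℂ) ^ 2 = y := by exact_mod_cast Real.sq_sqrt hy.le
  have hpi' : (Real.pi : ℂ) ≠ 0 := by exact_mod_cast hpi.ne'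
  congr 1
  · push_cast
    field_simp
    ring
  · congr 2
    push_cast
    rw [hc, mul_pow, hsq]
    field_simp
    ring

/-! ### Folding the half-line onto one period -/

lemma continuous_expTwoPi : Continuous expTwoPi := by
  unfold expTwoPi
  fun_prop

lemma continuous_dampedSine (y a : ℝ) : Continuous (dampedSine y a) := by
  unfold dampedSine
  fun_prop

lemma dampedSine_of_nonpos {y a s : ℝ} (hy : 0 < y) (hs : s ≤ 0) : dampedSine y a s = 0 := by
  rw [dampedSine, Real.sqrt_eq_zero_of_nonpos (by nlinarith)]
  simp

lemma abs_dampedSine_le (y a s : ℝ) : |dampedSine y a s| ≤ Real.exp (-(2 * Real.pi * a) * s) := by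
  rw [dampedSine, abs_mul, Real.abs_exp, show -(2 * Real.pi * a) * s = -(2 * Real.pi * a * s) by ring]
  exact mul_le_of_le_one_left (Real.exp_pos _).le (Real.abs_sin_le_one _)

lemma integrableOn_dampedSine_mul {y a M : ℝ} (ha : 0 < a) {W : ℝ → ℂ} (hW : Continuous W)
    (hM : ∀ s, ‖W s‖ ≤ M) (p : ℝ) :
    IntegrableOn (fun s => (dampedSine y a s : ℂ) * W s) (Ioi p) := by
  have hb : 0 < 2 * Real.pi * a := by positivity
  refine Integrable.mono' ((exp_neg_integrableOn_Ioi p hb).mul_const M) ?_ ?_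
  · exact ((Complex.continuous_ofReal.comp (continuous_dampedSine y a)).mul hW).aestronglyMeasurable
  · filter_upwards with s
    rw [norm_mul, Complex.norm_real]
    exact mul_le_mul (abs_dampedSine_le y a s) (hM s) (norm_nonneg _) (Real.exp_pos _).le

/-- Unfolding the integral of the damped sine against a `1`-periodic function. -/
lemma norm_integral_dampedSine_mul_periodic_le {y a M T : ℝ} (hy : 0 < y) (ha : 0 < a)
    {W : ℝ → ℂ} (hW : Continuous W) (hM : ∀ s, ‖W s‖ ≤ M) (hper : ∀ (s : ℝ) (n : ℕ), W (s + n) = W s)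
    (hT : ∀ (t : ℝ) (K : ℕ), -(1 / 2) ≤ t → t ≤ 1 / 2 →
      |∑ ν ∈ Finset.range K, dampedSine y a (t + ν)| ≤ T) {h : ℝ → ℝ} (hh : Continuous h)
    (hWh : ∀ t, -(1 / 2) < t → t ≤ 1 / 2 → ‖W t‖ ≤ h t) :
    ‖∫ s in Ioi (0 : ℝ), (dampedSine y a s : ℂ) * W s‖ ≤ T * ∫ t in (-(1 / 2) : ℝ)..(1 / 2), h t := by
  have hcont : Continuous fun s => (dampedSine y a s : ℂ) * W s :=
    (Complex.continuous_ofReal.comp (continuous_dampedSine y a)).mul hW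
  -- The damped sine vanishes on negative arguments, so the integral may start at -1/2. Unit
  -- intervals are then centred at integers, and the kernel peaks in the middle of the period.
  have h0 : ∫ s in Ioi (0 : ℝ), (dampedSine y a s : ℂ) * W s
      = ∫ s in Ioi (-(1 / 2) : ℝ), (dampedSine y a s : ℂ) * W s := by
    symm
    refine setIntegral_eq_of_subset_of_forall_sdiff_eq_zero measurableSet_Ioi
      (Ioi_subset_Ioi (by norm_num)) fun s hs => ?_
    have : s ≤ 0 := not_lt.1 hs.2
    rw [dampedSine_of_nonpos hy this]
    simp
  have hlim := intervalIntegral_tendsto_integral_Ioi (-(1 / 2) : ℝ)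
    (integrableOn_dampedSine_mul (y := y) ha hW hM (-(1 / 2)))
    (Filter.tendsto_atTop_add_const_right Filter.atTop (-(1 / 2) : ℝ)
      tendsto_natCast_atTop_atTop)
  rw [h0]
  refine le_of_tendsto hlim.norm (Filter.Eventually.of_forall fun K => ?_)
  have e1 : ∫ s in (-(1 / 2) : ℝ)..(K + -(1 / 2)), (dampedSine y a s : ℂ) * W s
      = ∫ t in (-(1 / 2) : ℝ)..(1 / 2),
        ((∑ ν ∈ Finset.range K, dampedSine y a (t + ν) : ℝ) : ℂ) * W t := by
    have h1 := intervalIntegral.sum_integral_adjacent_intervals (μ := volume)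
      (f := fun s => (dampedSine y a s : ℂ) * W s) (a := fun k : ℕ => (k : ℝ) + -(1 / 2)) (n := K)
      (fun k _ => hcont.intervalIntegrable _ _)
    simp only [Nat.cast_zero, zero_add] at h1
    rw [← h1]
    have h2 : ∀ k ∈ Finset.range K, ∫ s in ((k : ℝ) + -(1 / 2))..((k + 1 : ℕ) + -(1 / 2)),
        (dampedSine y a s : ℂ) * W s
        = ∫ t in (-(1 / 2) : ℝ)..(1 / 2), (dampedSine y a (t + k) : ℂ) * W t := by
      intro k _
      have h3 := intervalIntegral.integral_comp_add_right (a := (-(1 / 2) : ℝ)) (b := 1 / 2)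
        (fun s => (dampedSine y a s : ℂ) * W s) (k : ℝ)
      rw [show (-(1 / 2) : ℝ) + k = k + -(1 / 2) by ring,
        show (1 / 2 : ℝ) + k = (k + 1 : ℕ) + -(1 / 2) by push_cast; ring] at h3
      rw [← h3]
      refine intervalIntegral.integral_congr fun t _ => ?_
      simp only [hper]
    rw [Finset.sum_congr rfl h2, ← intervalIntegral.integral_finsetSum]
    · refine intervalIntegral.integral_congr fun t _ => ?_
      push_cast
      rw [Finset.sum_mul]
    · intro k _
      refine Continuous.intervalIntegrable ?_ _ _
      exact ((Complex.continuous_ofReal.comp (continuous_dampedSine y a)).comp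
        (continuous_add_const (k : ℝ))).mul hW
  rw [e1, ← intervalIntegral.integral_const_mul]
  refine intervalIntegral.norm_integral_le_of_norm_le (by norm_num) ?_
    ((continuous_const.mul hh).intervalIntegrable _ _)
  filter_upwards with t ht
  rw [norm_mul, Complex.norm_real]
  have hTt := hT t K ht.1.le ht.2
  exact mul_le_mul hTt (hWh t ht.1 ht.2) (norm_nonneg _) ((abs_nonneg _).trans hTt)

lemma norm_geom_sum_expTwoPi_le (p t : ℝ) (ht : t ≠ 0) (ht2 : |t| ≤ 1 / 2) (m : ℕ) :
    ‖∑ i ∈ Finset.range m, expTwoPi (-((p + i) * t))‖ ≤ 1 / (2 * |t|) := by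
  have h0 : 0 < |t| := abs_pos.2 ht
  have e : ∀ i : ℕ, expTwoPi (-((p + i) * t)) = expTwoPi (-(p * t)) * expTwoPi (-t) ^ i := by
    intro i
    have : expTwoPi (-t) ^ i = expTwoPi (-(i * t)) := by
      rw [expTwoPi, expTwoPi, ← Complex.exp_nat_mul]
      congr 1
      push_cast
      ring
    rw [this, ← expTwoPi_add]
    congr 1
    ring
  simp_rw [e]
  rw [← Finset.mul_sum, norm_mul, norm_expTwoPi, one_mul, le_div_iff₀ (by positivity)]
  have h1 := mul_neg_geom_sum (expTwoPi (-t)) m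
  have h2 : ‖1 - expTwoPi (-t)‖ * ‖∑ i ∈ Finset.range m, expTwoPi (-t) ^ i‖ ≤ 2 := by
    rw [← norm_mul, h1]
    refine (norm_sub_le _ _).trans ?_
    rw [norm_pow, norm_expTwoPi]
    norm_num
  have h3 : 4 * |t| ≤ ‖1 - expTwoPi (-t)‖ := by
    rw [norm_one_sub_expTwoPi, mul_neg, Real.sin_neg, abs_neg]
    have h4 := two_mul_le_sin_pi_mul h0.le le_rfl (show |t| ≤ 1 - |t| by linarith)
    have h5 : |Real.sin (Real.pi * t)| = |Real.sin (Real.pi * |t|)| := by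
      rcases abs_choice t with h | h
      · rw [h]
      · rw [h, mul_neg, Real.sin_neg, abs_neg]
    rw [h5]
    have := le_abs_self (Real.sin (Real.pi * |t|))
    linarith
  nlinarith [norm_nonneg (∑ i ∈ Finset.range m, expTwoPi (-t) ^ i)]

lemma norm_sum_mul_le_of_variation (f v : ℕ → ℂ) (m : ℕ) {P V D : ℝ} (hV : 0 ≤ V) (hD : 0 ≤ D)
    (hP : ∀ k ≤ m, ‖∑ i ∈ Finset.range k, f i‖ ≤ P) (hv : ∀ i < m, ‖v i‖ ≤ V)
    (hvD : ∀ i, i + 1 < m → ‖v (i + 1) - v i‖ ≤ D) :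
    ‖∑ i ∈ Finset.range m, v i * f i‖ ≤ P * (V + m * D) := by
  have hP0 : 0 ≤ P := (norm_nonneg _).trans (hP 0 (Nat.zero_le m))
  rcases m with _ | m
  · simp only [Finset.range_zero, Finset.sum_empty, norm_zero]
    positivity
  have key : ∀ k : ℕ, ∑ i ∈ Finset.range (k + 1), v i * f i
      = v k * ∑ i ∈ Finset.range (k + 1), f i
        - ∑ i ∈ Finset.range k, (v (i + 1) - v i) * ∑ j ∈ Finset.range (i + 1), f j := by
    intro k
    induction k with
    | zero => simp
    | succ k ih =>
      rw [Finset.sum_range_succ, ih, Finset.sum_range_succ f (k + 1),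
        Finset.sum_range_succ (fun i => (v (i + 1) - v i) * ∑ j ∈ Finset.range (i + 1), f j) k]
      ring
  rw [key]
  have h1 : ‖v m * ∑ i ∈ Finset.range (m + 1), f i‖ ≤ V * P := by
    rw [norm_mul]
    exact mul_le_mul (hv m (by omega)) (hP _ le_rfl) (norm_nonneg _) hV
  have h2 : ‖∑ i ∈ Finset.range m, (v (i + 1) - v i) * ∑ j ∈ Finset.range (i + 1), f j‖
      ≤ m * (D * P) := by
    refine (norm_sum_le_of_le (n := fun _ => D * P) _ fun i hi => ?_).trans (by simp)
    have hi := Finset.mem_range.1 hi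
    rw [norm_mul]
    exact mul_le_mul (hvD i (by omega)) (hP _ (by omega)) (norm_nonneg _) hD
  refine (norm_sub_le _ _).trans ((add_le_add h1 h2).trans ?_)
  push_cast
  nlinarith [mul_nonneg hD hP0]

/-! ### Passing from the phase y/n to the dual sum -/

/-- `expTwoPi (y / u)` divided by the Fourier transform of the damped sine at `u`. -/
noncomputable def unweight (y a u : ℝ) : ℂ :=
  1 / (2 * Real.pi ^ 2 * √y) * (2 * Real.pi * (a + u * Complex.I)) ^ 2
    * (Real.pi / (2 * Real.pi * (a + u * Complex.I))) ^ (1 / 2 : ℂ)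
    * Complex.exp (2 * Real.pi * y / (a + u * Complex.I) + 2 * Real.pi * Complex.I * (y / u))

lemma add_mul_I_ne_zero {a : ℝ} (ha : 0 < a) (u : ℝ) : (a : ℂ) + u * Complex.I ≠ 0 := fun h => by
  have := congrArg Complex.re h
  simp at this
  linarith

lemma cpow_half_sq (w : ℂ) : (w ^ (1 / 2 : ℂ)) ^ 2 = w := by
  rw [one_div]
  exact Complex.cpow_ofNat_inv_pow w 2

lemma unweight_mul_integral {y a : ℝ} (hy : 0 < y) (ha : 0 < a) (u : ℝ) :
    unweight y a u * ∫ s in Ioi (0 : ℝ), (dampedSine y a s : ℂ) * expTwoPi (-(u * s))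
      = expTwoPi (y / u) := by
  have hz := add_mul_I_ne_zero ha u
  have hpi' : (Real.pi : ℂ) ≠ 0 := by exact_mod_cast Real.pi_ne_zero
  have hsq : (√y : ℂ) ≠ 0 := by exact_mod_cast (Real.sqrt_pos.2 hy).ne'
  rw [integral_Ioi_dampedSine_mul_expTwoPi hy ha, unweight, Complex.exp_add, Complex.exp_neg]
  have hD := cpow_half_sq (Real.pi / (2 * Real.pi * (a + u * Complex.I)))
  have hE := Complex.exp_ne_zero (2 * Real.pi * y / (a + u * Complex.I))
  set D := ((Real.pi : ℂ) / (2 * Real.pi * (a + u * Complex.I))) ^ (1 / 2 : ℂ)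
  set E := Complex.exp (2 * Real.pi * y / (a + u * Complex.I))
  have e : expTwoPi (y / u) = Complex.exp (2 * Real.pi * Complex.I * (y / u)) := by
    rw [expTwoPi]
    push_cast
    rfl
  rw [e]
  set G := Complex.exp (2 * Real.pi * Complex.I * (y / u))
  set z := (a : ℂ) + u * Complex.I
  calc _ = G * (2 * z * D ^ 2) := by field_simp
    _ = G := by rw [hD]; field_simp

/-- With z = a + iu, the two exponents together have derivative -2πiy(1/z² + 1/u²). Since z² + u² =
a(a + 2iu), this cancels up to a factor a, and the quotient varies slowly although each exponential
oscillates. The term 3/2 · i/z comes from the power of z. -/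
lemma hasDerivAt_unweight {y a : ℝ} (ha : 0 < a) {u : ℝ} (hu : 0 < u) :
    HasDerivAt (unweight y a) (unweight y a u * (3 / 2 * Complex.I / (a + u * Complex.I)
      - 2 * Real.pi * Complex.I * y * (a * (a + 2 * u * Complex.I))
        / (u ^ 2 * (a + u * Complex.I) ^ 2))) u := by
  have hz := add_mul_I_ne_zero ha u
  have hu' : (u : ℂ) ≠ 0 := by exact_mod_cast hu.ne'
  have hpi' : (Real.pi : ℂ) ≠ 0 := by exact_mod_cast Real.pi_ne_zero
  have hzd : HasDerivAt (fun u : ℝ => (a : ℂ) + u * Complex.I) Complex.I u := by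
    simpa using ((hasDerivAt_id u).ofReal_comp.mul_const Complex.I).const_add (a : ℂ)
  have hc : HasDerivAt (fun u : ℝ => 2 * (Real.pi : ℂ) * (a + u * Complex.I))
      (2 * Real.pi * Complex.I) u := hzd.const_mul _
  have hc0 : 2 * (Real.pi : ℂ) * (a + u * Complex.I) ≠ 0 := by
    simp [hz, hpi']
  have hw : HasDerivAt (fun u : ℝ => (Real.pi : ℂ) / (2 * Real.pi * (a + u * Complex.I)))
      (-((Real.pi : ℂ) * (2 * Real.pi * Complex.I)) / (2 * Real.pi * (a + u * Complex.I)) ^ 2) u := by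
    refine ((hasDerivAt_const u (Real.pi : ℂ)).div hc hc0).congr_deriv ?_
    ring
  have hslit : (Real.pi : ℂ) / (2 * Real.pi * (a + u * Complex.I)) ∈ Complex.slitPlane := by
    left
    have e : (Real.pi : ℂ) / (2 * Real.pi * (a + u * Complex.I))
        = ((1 / 2 : ℝ) : ℂ) * (a + u * Complex.I)⁻¹ := by
      push_cast
      field_simp
    rw [e, Complex.re_ofReal_mul, Complex.inv_re]
    have h1 : ((a : ℂ) + u * Complex.I).re = a := by simp
    have h2 := Complex.normSq_pos.2 hz
    rw [h1]
    positivity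
  have hD : HasDerivAt
      (fun u : ℝ => ((Real.pi : ℂ) / (2 * Real.pi * (a + u * Complex.I))) ^ (1 / 2 : ℂ))
      (1 / 2 * ((Real.pi : ℂ) / (2 * Real.pi * (a + u * Complex.I))) ^ (1 / 2 - 1 : ℂ)
        * (-((Real.pi : ℂ) * (2 * Real.pi * Complex.I))
          / (2 * Real.pi * (a + u * Complex.I)) ^ 2)) u := by
    have h1 := (hasDerivAt_id ((Real.pi : ℂ) / (2 * Real.pi * (a + u * Complex.I)))).cpow_const
      (c := (1 / 2 : ℂ)) hslit
    rw [mul_one] at h1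
    exact h1.comp u hw
  have hE1 : HasDerivAt (fun u : ℝ => 2 * Real.pi * (y : ℂ) / (a + u * Complex.I))
      (-(2 * Real.pi * y * Complex.I) / (a + u * Complex.I) ^ 2) u := by
    refine ((hasDerivAt_const u (2 * Real.pi * y : ℂ)).div hzd hz).congr_deriv ?_
    ring
  have hE2 : HasDerivAt (fun u : ℝ => 2 * Real.pi * Complex.I * ((y : ℂ) / u))
      (-(2 * Real.pi * Complex.I * y) / u ^ 2) u := by
    have h1 := ((hasDerivAt_const u (y : ℂ)).div (hasDerivAt_id u).ofReal_comp hu').const_mul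
      (2 * Real.pi * Complex.I)
    refine h1.congr_deriv ?_
    simp only [id_eq]
    push_cast
    field_simp
    ring
  have hE := (hE1.add hE2).cexp
  have hV := (((hc.pow 2).const_mul (1 / (2 * (Real.pi : ℂ) ^ 2 * √y))).mul hD).mul hE
  refine hV.congr_deriv ?_
  have hw0 : (Real.pi : ℂ) / (2 * Real.pi * (a + u * Complex.I)) ≠ 0 := div_ne_zero hpi' hc0
  rw [Complex.cpow_sub _ _ hw0, Complex.cpow_one, unweight]
  simp only [Pi.add_apply, Pi.mul_apply, Pi.pow_apply]
  set D := ((Real.pi : ℂ) / (2 * Real.pi * (a + u * Complex.I))) ^ (1 / 2 : ℂ)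
  set E := Complex.exp (2 * Real.pi * (y : ℂ) / (a + u * Complex.I)
    + 2 * Real.pi * Complex.I * ((y : ℂ) / u))
  have hI : Complex.I ^ 2 = -1 := Complex.I_sq
  have key : -(2 * (Real.pi : ℂ) * y * Complex.I) / (a + u * Complex.I) ^ 2
      + -(2 * Real.pi * Complex.I * y) / u ^ 2
      = -(2 * Real.pi * Complex.I * y * (a * (a + 2 * u * Complex.I))
        / (u ^ 2 * (a + u * Complex.I) ^ 2)) := by
    rw [div_add_div _ _ (pow_ne_zero 2 hz) (pow_ne_zero 2 hu'), ← neg_div]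
    congr 1
    · linear_combination (-(2 * (Real.pi : ℂ) * Complex.I * y) * u ^ 2) * hI
    · ring
  rw [key]
  set R := 2 * (Real.pi : ℂ) * Complex.I * y * (a * (a + 2 * u * Complex.I))
        / (u ^ 2 * (a + u * Complex.I) ^ 2)
  set z := (a : ℂ) + u * Complex.I
  have : D / ((Real.pi : ℂ) / (2 * Real.pi * z)) = D * (2 * z) := by field_simp
  rw [this]
  set K := 1 / (2 * (Real.pi : ℂ) ^ 2 * √y)
  have e2 : -((Real.pi : ℂ) * (2 * Real.pi * Complex.I)) / (2 * Real.pi * z) ^ 2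
      = -(Complex.I / (2 * z ^ 2)) := by field_simp
  rw [e2]
  field_simp
  push_cast
  ring

lemma le_norm_add_mul_I (a u : ℝ) : |u| ≤ ‖(a : ℂ) + u * Complex.I‖ := by
  have h := Complex.abs_im_le_norm ((a : ℂ) + u * Complex.I)
  simpa using h

lemma norm_add_mul_I_le {a N u : ℝ} (ha : 0 < a) (haN : a ≤ N) (hu : 0 ≤ u) (huN : u ≤ 2 * N) :
    ‖(a : ℂ) + u * Complex.I‖ ≤ 3 * N := by
  refine (norm_add_le _ _).trans ?_
  rw [norm_mul, Complex.norm_I, mul_one, Complex.norm_real, Complex.norm_real,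
    Real.norm_of_nonneg ha.le, Real.norm_of_nonneg hu]
  linarith

/-- The normalisation ya = N² keeps the exponential bounded: the real part of its exponent is
2πya/(a² + u²) ≤ 2π once u ≥ N. What is left has size |z|^(3/2)/√y. -/
lemma norm_unweight_le {y a N u : ℝ} (hy : 0 < y) (ha : 0 < a) (haN : a ≤ N) (hya : y * a = N ^ 2)
    (h1 : N ≤ u) (h2 : u ≤ 2 * N) :
    ‖unweight y a u‖ ≤ √(216 * Real.pi ^ 4 * N ^ 3) * Real.exp (2 * Real.pi) / √y := by
  have hpi := Real.pi_pos
  have hpi3 := Real.pi_gt_three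
  have hN : 0 < N := ha.trans_le haN
  have hz := add_mul_I_ne_zero ha u
  have hu0 : 0 < u := by linarith
  have hzN := norm_add_mul_I_le ha haN hu0.le h2
  have hz0 : 0 < ‖(a : ℂ) + u * Complex.I‖ := norm_pos_iff.2 hz
  have hcn : ‖2 * (Real.pi : ℂ) * (a + u * Complex.I)‖ = 2 * Real.pi * ‖(a : ℂ) + u * Complex.I‖ := by
    simp [abs_of_pos hpi]
  rw [unweight, norm_mul, norm_mul, norm_mul, Complex.norm_exp]
  have hre : (2 * Real.pi * y / (a + u * Complex.I) + 2 * Real.pi * Complex.I * (y / u) : ℂ).re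
      ≤ 2 * Real.pi := by
    have e1 : (2 * Real.pi * y / (a + u * Complex.I) : ℂ).re
        = 2 * Real.pi * y * a / (a ^ 2 + u ^ 2) := by
      rw [show (2 * Real.pi * y / (a + u * Complex.I) : ℂ)
        = ((2 * Real.pi * y : ℝ) : ℂ) * (a + u * Complex.I)⁻¹ by push_cast; rw [div_eq_mul_inv],
        Complex.re_ofReal_mul, Complex.inv_re, Complex.normSq_apply]
      simp
      ring
    have e2 : (2 * Real.pi * Complex.I * (y / u) : ℂ).re = 0 := by
      rw [show (2 * Real.pi * Complex.I * (y / u) : ℂ)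
        = ((2 * Real.pi * (y / u) : ℝ) : ℂ) * Complex.I by push_cast; ring, Complex.re_ofReal_mul]
      simp
    rw [Complex.add_re, e1, e2, add_zero, div_le_iff₀ (by positivity)]
    have : 2 * Real.pi * y * a = 2 * Real.pi * N ^ 2 := by rw [mul_assoc, hya]
    rw [this]
    gcongr
    nlinarith [sq_nonneg a]
  have hA : ‖(1 / (2 * Real.pi ^ 2 * √y) : ℂ)‖ = 1 / (2 * Real.pi ^ 2) * (1 / √y) := by
    simp [abs_of_pos hpi, abs_of_nonneg (Real.sqrt_nonneg y)]
    ring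
  have hB : ‖(2 * Real.pi * (a + u * Complex.I) : ℂ) ^ 2‖
      * ‖((Real.pi : ℂ) / (2 * Real.pi * (a + u * Complex.I))) ^ (1 / 2 : ℂ)‖
      ≤ √(216 * Real.pi ^ 4 * N ^ 3) := by
    apply Real.le_sqrt_of_sq_le
    have h3 := congrArg (‖·‖) (cpow_half_sq ((Real.pi : ℂ) / (2 * Real.pi * (a + u * Complex.I))))
    simp only [norm_pow, norm_div, hcn, Complex.norm_real, Real.norm_of_nonneg hpi.le] at h3
    rw [norm_pow, hcn, mul_pow, h3]
    calc _ = 8 * Real.pi ^ 4 * ‖(a : ℂ) + u * Complex.I‖ ^ 3 := by field_simp; ring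
      _ ≤ 8 * Real.pi ^ 4 * (3 * N) ^ 3 := by gcongr
      _ = _ := by ring
  rw [hA]
  calc _ = 1 / (2 * Real.pi ^ 2) * ((‖(2 * Real.pi * (a + u * Complex.I) : ℂ) ^ 2‖
      * ‖((Real.pi : ℂ) / (2 * Real.pi * (a + u * Complex.I))) ^ (1 / 2 : ℂ)‖)
      * Real.exp (2 * Real.pi * y / (a + u * Complex.I)
        + 2 * Real.pi * Complex.I * (y / u) : ℂ).re * (1 / √y)) := by ring
    _ ≤ 1 * (√(216 * Real.pi ^ 4 * N ^ 3) * Real.exp (2 * Real.pi) * (1 / √y)) := by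
      gcongr
      rw [div_le_one (by positivity)]
      nlinarith
    _ = _ := by ring

/-- Both terms of the logarithmic derivative are O(1/N), by |z| ≥ N and ya = N²: they are at most
2/N and 40/N. -/
lemma norm_unweight_add_one_sub_le {y a N u : ℝ} (hy : 0 < y) (ha : 0 < a) (haN : a ≤ N)
    (hya : y * a = N ^ 2) (h1 : N ≤ u) (h2 : u + 1 ≤ 2 * N) :
    ‖unweight y a (u + 1) - unweight y a u‖
      ≤ √(216 * Real.pi ^ 4 * N ^ 3) * Real.exp (2 * Real.pi) / √y * (45 / N) := by
  have hpi := Real.pi_pos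
  have hpi3 := Real.pi_lt_four
  have hN : 0 < N := ha.trans_le haN
  have h := norm_image_sub_le_of_norm_deriv_le_segment' (f := unweight y a) (a := u) (b := u + 1)
    (C := √(216 * Real.pi ^ 4 * N ^ 3) * Real.exp (2 * Real.pi) / √y * (45 / N))
    (fun v hv => (hasDerivAt_unweight ha (show 0 < v by linarith [hv.1])).hasDerivWithinAt) ?_
    (u + 1) ⟨by linarith, le_rfl⟩
  · simpa using h
  intro v hv
  have hv1 : N ≤ v := by linarith [hv.1]
  have hv2 : v ≤ 2 * N := by linarith [hv.2]
  have hv0 : 0 < v := by linarith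
  rw [norm_mul]
  refine mul_le_mul (norm_unweight_le hy ha haN hya hv1 hv2) ?_ (norm_nonneg _) (by positivity)
  have hz0 : v ≤ ‖(a : ℂ) + v * Complex.I‖ := by
    have := le_norm_add_mul_I a v
    rwa [abs_of_pos hv0] at this
  have hNz : N ≤ ‖(a : ℂ) + v * Complex.I‖ := hv1.trans hz0
  have e1 : ‖3 / 2 * Complex.I / (a + v * Complex.I)‖ ≤ 2 / N := by
    rw [norm_div, norm_mul, Complex.norm_I, mul_one]
    have : ‖(3 / 2 : ℂ)‖ ≤ 2 := by norm_num
    gcongr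
  have e2 : ‖2 * Real.pi * Complex.I * y * (a * (a + 2 * v * Complex.I))
      / (v ^ 2 * (a + v * Complex.I) ^ 2)‖ ≤ 40 / N := by
    rw [norm_div]
    have h3 : ‖2 * Real.pi * Complex.I * y * (a * (a + 2 * v * Complex.I))‖ ≤ 40 * N ^ 3 := by
      have h4 : ‖(a : ℂ) + 2 * v * Complex.I‖ ≤ 5 * N := by
        refine (norm_add_le _ _).trans ?_
        rw [norm_mul, norm_mul, Complex.norm_I, mul_one, Complex.norm_real, Complex.norm_real,
          Real.norm_of_nonneg ha.le, Real.norm_of_nonneg hv0.le, Complex.norm_ofNat]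
        linarith
      have h5 : ‖2 * Real.pi * Complex.I * y * (a * (a + 2 * v * Complex.I))‖
          = 2 * Real.pi * (y * a) * ‖(a : ℂ) + 2 * v * Complex.I‖ := by
        simp only [norm_mul, Complex.norm_I, Complex.norm_real, Complex.norm_ofNat,
          Real.norm_of_nonneg hpi.le, Real.norm_of_nonneg hy.le, Real.norm_of_nonneg ha.le]
        ring
      rw [h5, hya]
      calc _ ≤ 2 * 4 * N ^ 2 * (5 * N) := by gcongr
        _ = _ := by ring
    have h6 : N ^ 4 ≤ ‖(v : ℂ) ^ 2 * (a + v * Complex.I) ^ 2‖ := by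
      rw [norm_mul, norm_pow, norm_pow, Complex.norm_real, Real.norm_of_nonneg hv0.le]
      calc N ^ 4 = N ^ 2 * N ^ 2 := by ring
        _ ≤ _ := by gcongr
    calc _ ≤ 40 * N ^ 3 / N ^ 4 := by gcongr
      _ = 40 / N := by field_simp
  refine (norm_sub_le _ _).trans ((add_le_add e1 e2).trans ?_)
  rw [← add_div]
  gcongr
  norm_num

/-- The integrand majorises both bounds for a geometric sum over the block, the trivial 3N and
1/(2|t|); its mean over a period costs only a logarithm. -/
lemma integral_div_one_add_mul_abs_le {N : ℝ} (hN : 1 ≤ N) :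
    ∫ t in (-(1 / 2) : ℝ)..(1 / 2), 6 * N / (1 + N * |t|) ≤ 12 * (1 + Real.log N) := by
  have hN0 : 0 < N := by linarith
  have hcont : Continuous fun t : ℝ => 6 * N / (1 + N * |t|) := by
    refine continuous_const.div (by fun_prop) fun t => ?_
    positivity
  have hhalf : ∫ t in (0 : ℝ)..(1 / 2), 6 * N / (1 + N * |t|) = 6 * Real.log (1 + N / 2) := by
    have h1 : ∫ t in (0 : ℝ)..(1 / 2), 6 * N / (1 + N * |t|)
        = 6 * Real.log (1 + N * (1 / 2)) - 6 * Real.log (1 + N * 0) := by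
      apply intervalIntegral.integral_eq_sub_of_hasDerivAt (f := fun t => 6 * Real.log (1 + N * t))
      · intro t ht
        rw [uIcc_of_le (by norm_num)] at ht
        have h2 : (0 : ℝ) < 1 + N * t := by nlinarith [ht.1]
        have h3 : HasDerivAt (fun t => 1 + N * t) N t := by
          simpa using ((hasDerivAt_id t).const_mul N).const_add 1
        refine ((h3.log h2.ne').const_mul 6).congr_deriv ?_
        rw [abs_of_nonneg ht.1]
        ring
      · exact hcont.intervalIntegrable _ _
    rw [h1]
    simp
    ring_nf
  have hneg : ∫ t in (-(1 / 2) : ℝ)..0, 6 * N / (1 + N * |t|)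
      = ∫ t in (0 : ℝ)..(1 / 2), 6 * N / (1 + N * |t|) := by
    have := intervalIntegral.integral_comp_neg (a := (0 : ℝ)) (b := 1 / 2)
      (fun t : ℝ => 6 * N / (1 + N * |t|))
    simp only [abs_neg, neg_zero] at this
    exact this.symm
  rw [← intervalIntegral.integral_add_adjacent_intervals (hcont.intervalIntegrable _ 0)
    (hcont.intervalIntegrable 0 _), hneg, hhalf]
  have : Real.log (1 + N / 2) ≤ 1 + Real.log N := by
    rw [← Real.log_exp 1, ← Real.log_mul (Real.exp_ne_zero 1) hN0.ne', Real.log_exp]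
    apply Real.log_le_log (by positivity)
    have := Real.add_one_le_exp (1 : ℝ)
    nlinarith
  linarith

/-- A bound for the exponential sum with phase `y / n` over a dyadic block, obtained by passing to
the dual sum with phase `2 √(y ν)`. -/
lemma exists_norm_sum_block_div_le : ∃ C : ℝ, 0 ≤ C ∧ ∀ (y N : ℝ), 1 ≤ N → N ≤ y →
    ‖∑ n ∈ Finset.Ioc ⌊N⌋₊ ⌊2 * N⌋₊, expTwoPi (y / n)‖
      ≤ C * (1 + Real.log N) * (y ^ (11 / 30 : ℝ) * N ^ (-(1 / 5) : ℝ)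
        + y ^ (61 / 120 : ℝ) * N ^ (-(11 / 20) : ℝ) + y ^ (-(1 / 2) : ℝ) * N ^ (3 / 2 : ℝ)) := by
  obtain ⟨C, hC, hT⟩ := exists_abs_sum_dampedSine_le
  set c1 := √(216 * Real.pi ^ 4) * Real.exp (2 * Real.pi) with hc1
  refine ⟨12 * 136 * C * c1, by positivity, fun y N hN hNy => ?_⟩
  have hN0 : 0 < N := by linarith
  have hy : 0 < y := by linarith
  -- The size y/N² of the derivative of the phase is the natural length of the dual sum, and the
  -- damping cuts at 1/a.
  set a := N ^ 2 / y with ha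
  have ha0 : 0 < a := by positivity
  have hya : y * a = N ^ 2 := by rw [ha]; field_simp
  have haN : a ≤ N := by
    rw [ha, div_le_iff₀ hy]
    nlinarith
  set V := √(216 * Real.pi ^ 4 * N ^ 3) * Real.exp (2 * Real.pi) / √y with hV
  have hV0 : 0 ≤ V := by positivity
  set s := Finset.Ioc ⌊N⌋₊ ⌊2 * N⌋₊ with hs
  set W : ℝ → ℂ := fun t => ∑ n ∈ s, unweight y a n * expTwoPi (-(n * t)) with hW
  have hmem : ∀ n ∈ s, N ≤ n ∧ (n : ℝ) ≤ 2 * N := by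
    intro n hn
    rw [hs, Finset.mem_Ioc] at hn
    exact ⟨((Nat.floor_lt hN0.le).1 hn.1).le, (Nat.le_floor_iff (by linarith)).1 hn.2⟩
  have hWc : Continuous W := by
    refine continuous_finsetSum _ fun n _ => continuous_const.mul ?_
    exact continuous_expTwoPi.comp (by fun_prop)
  have hWM : ∀ t, ‖W t‖ ≤ ∑ n ∈ s, ‖unweight y a n‖ := by
    intro t
    refine norm_sum_le_of_le _ fun n _ => ?_
    rw [norm_mul, norm_expTwoPi, mul_one]
  have hper : ∀ (t : ℝ) (k : ℕ), W (t + k) = W t := by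
    intro t k
    refine Finset.sum_congr rfl fun n _ => ?_
    have : -((n : ℝ) * (t + k)) = -(n * t) + ((-(n * k : ℕ) : ℤ) : ℝ) := by
      push_cast
      ring
    rw [this, expTwoPi_add_int]
  have hint : ∫ t in Ioi (0 : ℝ), (dampedSine y a t : ℂ) * W t = ∑ n ∈ s, expTwoPi (y / n) := by
    have e1 : ∀ t : ℝ, (dampedSine y a t : ℂ) * W t
        = ∑ n ∈ s, unweight y a n * ((dampedSine y a t : ℂ) * expTwoPi (-(n * t))) := by
      intro t
      rw [hW, Finset.mul_sum]
      refine Finset.sum_congr rfl fun n _ => ?_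
      ring
    simp_rw [e1]
    rw [integral_finsetSum]
    · refine Finset.sum_congr rfl fun n _ => ?_
      rw [integral_const_mul, unweight_mul_integral hy ha0]
    · intro n _
      refine Integrable.const_mul ?_ _
      exact integrableOn_dampedSine_mul (M := 1) ha0 (continuous_expTwoPi.comp (by fun_prop))
        (fun t => (norm_expTwoPi _).le) 0
  -- The constant is 136 = 1 + 3·45: the weights have size V, and there are at most 3N steps, each
  -- changing them by at most 45V/N.
  have hWh : ∀ t, -(1 / 2) < t → t ≤ 1 / 2 → ‖W t‖ ≤ 136 * V * (6 * N / (1 + N * |t|)) := by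
    intro t ht1 ht2
    set m := ⌊2 * N⌋₊ - ⌊N⌋₊ with hm
    have hm3 : (m : ℝ) ≤ 3 * N := floor_two_mul_sub_floor_le (by linarith)
    have e1 : W t = ∑ i ∈ Finset.range m, unweight y a ((⌊N⌋₊ + 1 + i : ℕ) : ℝ)
        * expTwoPi (-((((⌊N⌋₊ + 1 : ℕ) : ℝ) + i) * t)) := by
      rw [hW, hs]
      simp only
      rw [sum_Ioc_eq_sum_range]
      refine Finset.sum_congr rfl fun i _ => ?_
      push_cast
      rfl
    have hmem' : ∀ i < m, N ≤ ((⌊N⌋₊ + 1 + i : ℕ) : ℝ) ∧ ((⌊N⌋₊ + 1 + i : ℕ) : ℝ) ≤ 2 * N :=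
      fun i hi => hmem _ (by rw [hs, Finset.mem_Ioc]; omega)
    have h2 := norm_sum_mul_le_of_variation
      (fun i : ℕ => expTwoPi (-((((⌊N⌋₊ + 1 : ℕ) : ℝ) + i) * t)))
      (fun i : ℕ => unweight y a ((⌊N⌋₊ + 1 + i : ℕ) : ℝ)) m
      (P := 6 * N / (1 + N * |t|)) (V := V) (D := V * (45 / N)) hV0 (by positivity) ?_ ?_ ?_
    · rw [e1]
      refine h2.trans ?_
      calc _ ≤ 6 * N / (1 + N * |t|) * (V + 3 * N * (V * (45 / N))) := by gcongr
        _ = _ := by field_simp; ring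
    · intro k hk
      have hk' : (k : ℝ) ≤ 3 * N := (Nat.cast_le.2 hk).trans hm3
      have hk2 : ‖∑ i ∈ Finset.range k, expTwoPi (-((((⌊N⌋₊ + 1 : ℕ) : ℝ) + i) * t))‖ ≤ k := by
        simpa using norm_sum_expTwoPi_le (Finset.range k)
          (fun i => -((((⌊N⌋₊ + 1 : ℕ) : ℝ) + i) * t))
      rcases le_total (N * |t|) 1 with h | h
      · refine hk2.trans (hk'.trans ?_)
        rw [le_div_iff₀ (by positivity)]
        nlinarith
      · have ht0 : t ≠ 0 := by
          rintro rfl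
          simp at h
          linarith
        have ht0' : 0 < |t| := abs_pos.2 ht0
        refine (norm_geom_sum_expTwoPi_le _ t ht0 (abs_le.2 ⟨ht1.le, ht2⟩) k).trans ?_
        rw [div_le_div_iff₀ (by positivity) (by positivity)]
        nlinarith
    · intro i hi
      exact norm_unweight_le hy ha0 haN hya (hmem' i hi).1 (hmem' i hi).2
    · intro i hi
      have h3 := (hmem' i (by omega)).1
      have h4 := (hmem' (i + 1) hi).2
      have e2 : ((⌊N⌋₊ + 1 + (i + 1) : ℕ) : ℝ) = ((⌊N⌋₊ + 1 + i : ℕ) : ℝ) + 1 := by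
        push_cast
        ring
      rw [e2] at h4 ⊢
      exact norm_unweight_add_one_sub_le hy ha0 haN hya h3 h4
  have hmain := norm_integral_dampedSine_mul_periodic_le hy ha0 hWc hWM hper
    (fun t K h1 h2 => hT y a t K hy ha0 h1 h2) (h := fun t => 136 * V * (6 * N / (1 + N * |t|)))
    (by
      refine continuous_const.mul (continuous_const.div (by fun_prop) fun t => ?_)
      positivity) hWh
  rw [hint, intervalIntegral.integral_const_mul] at hmain
  refine hmain.trans ?_
  set T := 1 + y ^ (1 / 60 : ℝ) * a ^ (-(17 / 20) : ℝ) + y ^ (-(1 / 60) : ℝ) * a ^ (-(41 / 40) : ℝ)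
    with hTdef
  have hT0 : 0 ≤ T := by positivity
  have hlog : 0 ≤ Real.log N := Real.log_nonneg hN
  have hVe : V = c1 * (y ^ (-(1 / 2) : ℝ) * N ^ (3 / 2 : ℝ)) := by
    rw [hV, hc1, Real.sqrt_mul (by positivity), Real.rpow_neg hy.le, ← Real.sqrt_eq_rpow,
      Real.sqrt_eq_rpow (N ^ 3), ← Real.rpow_natCast N 3, ← Real.rpow_mul hN0.le]
    norm_num
    field_simp
  have haw : ∀ w : ℝ, a ^ (-w) = y ^ w * N ^ (-(2 * w)) := by
    intro w
    rw [ha, Real.div_rpow (by positivity) hy.le, ← Real.rpow_natCast N 2, ← Real.rpow_mul hN0.le,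
      Real.rpow_neg hy.le w, div_inv_eq_mul, mul_comm]
    congr 2
    push_cast
    ring
  have hVT : V * T = c1 * (y ^ (11 / 30 : ℝ) * N ^ (-(1 / 5) : ℝ)
        + y ^ (61 / 120 : ℝ) * N ^ (-(11 / 20) : ℝ) + y ^ (-(1 / 2) : ℝ) * N ^ (3 / 2 : ℝ)) := by
    have f1 : y ^ (11 / 30 : ℝ) = y ^ (-(1 / 2) : ℝ) * (y ^ (1 / 60 : ℝ) * y ^ (17 / 20 : ℝ)) := by
      rw [← Real.rpow_add hy, ← Real.rpow_add hy]
      norm_num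
    have f2 : y ^ (61 / 120 : ℝ)
        = y ^ (-(1 / 2) : ℝ) * (y ^ (-(1 / 60) : ℝ) * y ^ (41 / 40 : ℝ)) := by
      rw [← Real.rpow_add hy, ← Real.rpow_add hy]
      norm_num
    have f3 : N ^ (-(1 / 5) : ℝ) = N ^ (3 / 2 : ℝ) * N ^ (-(2 * (17 / 20)) : ℝ) := by
      rw [← Real.rpow_add hN0]
      norm_num
    have f4 : N ^ (-(11 / 20) : ℝ) = N ^ (3 / 2 : ℝ) * N ^ (-(2 * (41 / 40)) : ℝ) := by
      rw [← Real.rpow_add hN0]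
      norm_num
    rw [hTdef, hVe, haw, haw, f1, f2, f3, f4]
    ring
  calc _ ≤ C * T * (136 * V * (12 * (1 + Real.log N))) := by
        gcongr
        exact integral_div_one_add_mul_abs_le hN
    _ = 12 * 136 * C * (1 + Real.log N) * (V * T) := by ring
    _ = _ := by rw [hVT]; ring

end

section

open Finset

/-! ### The sawtooth function and its smoothing by Bernoulli functions -/

/-- The sawtooth function `t ↦ {t} - 1/2`. -/
noncomputable def sawtooth (t : ℝ) : ℝ := Int.fract t - 1 / 2

/-- The periodic second Bernoulli function. -/
noncomputable def bernoulliTwo (t : ℝ) : ℝ := Int.fract t ^ 2 - Int.fract t + 1 / 6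

lemma abs_sawtooth_le (t : ℝ) : |sawtooth t| ≤ 1 / 2 := by
  have h1 := Int.fract_nonneg t
  have h2 := Int.fract_lt_one t
  rw [sawtooth, abs_le]
  constructor <;> linarith

lemma int_sq_sub_nonneg (j : ℤ) : (0 : ℝ) ≤ (j : ℝ) ^ 2 - j := by
  have : (0 : ℤ) ≤ j ^ 2 - j := by
    rcases le_or_gt j 0 with h | h <;> nlinarith
  exact_mod_cast this

/-- Half of `bernoulliTwo` is a primitive of the sawtooth, so the quotient is the mean of the
sawtooth over [t - δ, t]. Since `sawtooth s - s` is nonincreasing in s, the value at t exceeds this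
mean by at most δ. `le_sawtooth` is the mirror image on [t, t + δ]. -/
lemma sawtooth_le {δ : ℝ} (hδ : 0 < δ) (t : ℝ) :
    sawtooth t ≤ δ + (bernoulliTwo t - bernoulliTwo (t - δ)) / (2 * δ) := by
  rw [← sub_le_iff_le_add', le_div_iff₀ (by positivity), sawtooth, bernoulliTwo, bernoulliTwo]
  have h1 := Int.floor_add_fract t
  have h2 := Int.floor_add_fract (t - δ)
  have h3 := Int.fract_lt_one (t - δ)
  have hj : (0 : ℤ) ≤ ⌊t⌋ - ⌊t - δ⌋ := sub_nonneg.2 (Int.floor_le_floor (by linarith))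
  have hj' : (0 : ℝ) ≤ ((⌊t⌋ - ⌊t - δ⌋ : ℤ) : ℝ) := by exact_mod_cast hj
  have h4 := int_sq_sub_nonneg (⌊t⌋ - ⌊t - δ⌋)
  set j : ℤ := ⌊t⌋ - ⌊t - δ⌋ with hjdef
  have h5 : δ = Int.fract t - Int.fract (t - δ) + j := by
    rw [hjdef]
    push_cast
    linarith
  set f := Int.fract t
  set f' := Int.fract (t - δ)
  rw [h5]
  nlinarith [mul_nonneg hj' (sub_nonneg.2 h3.le), sq_nonneg (f - f' + j)]

lemma le_sawtooth {δ : ℝ} (hδ : 0 < δ) (t : ℝ) :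
    -δ + (bernoulliTwo (t + δ) - bernoulliTwo t) / (2 * δ) ≤ sawtooth t := by
  rw [← le_sub_iff_add_le', div_le_iff₀ (by positivity), sawtooth, bernoulliTwo, bernoulliTwo]
  have h1 := Int.floor_add_fract t
  have h2 := Int.floor_add_fract (t + δ)
  have h3 := Int.fract_nonneg (t + δ)
  have hj : (0 : ℤ) ≤ ⌊t + δ⌋ - ⌊t⌋ := sub_nonneg.2 (Int.floor_le_floor (by linarith))
  have hj' : (0 : ℝ) ≤ ((⌊t + δ⌋ - ⌊t⌋ : ℤ) : ℝ) := by exact_mod_cast hj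
  have h4 := int_sq_sub_nonneg (⌊t + δ⌋ - ⌊t⌋)
  set j : ℤ := ⌊t + δ⌋ - ⌊t⌋ with hjdef
  have h5 : δ = Int.fract (t + δ) - Int.fract t + j := by
    rw [hjdef]
    push_cast
    linarith
  set f := Int.fract t
  set f' := Int.fract (t + δ)
  rw [h5]
  nlinarith [mul_nonneg hj' h3, sq_nonneg (f' - f + j)]

/-- Absolute convergence of this series is the gain from replacing the sawtooth by difference
quotients of `bernoulliTwo`. The index is shifted so that h + 1 is the frequency. -/
lemma hasSum_bernoulliTwo (t : ℝ) :
    HasSum (fun h : ℕ => 1 / Real.pi ^ 2 * (1 / ((h : ℝ) + 1) ^ 2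
      * Real.cos (2 * Real.pi * ((h + 1) * t)))) (bernoulliTwo t) := by
  have h1 := hasSum_one_div_nat_pow_mul_cos (k := 1) one_ne_zero
    (x := Int.fract t) ⟨Int.fract_nonneg t, (Int.fract_lt_one t).le⟩
  have h2 : (Polynomial.map (algebraMap ℚ ℝ) (Polynomial.bernoulli (2 * 1))).eval (Int.fract t)
      = bernoulliTwo t := by
    rw [mul_one, Polynomial.bernoulli, Finset.sum_range_succ, Finset.sum_range_succ,
      Finset.sum_range_succ, Finset.sum_range_zero]
    simp [bernoulliTwo, bernoulli_one, bernoulli_two, Polynomial.eval_add]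
    ring
  rw [h2] at h1
  rw [← hasSum_nat_add_iff' 1] at h1
  simp only [range_one, sum_singleton, Nat.cast_zero] at h1
  have h3 := h1.mul_left (1 / Real.pi ^ 2)
  have hpi : Real.pi ≠ 0 := Real.pi_ne_zero
  convert! h3 using 1
  · funext h
    have e : Real.cos (2 * Real.pi * ((h + 1) * t))
        = Real.cos (2 * Real.pi * ((h + 1 : ℕ) : ℝ) * Int.fract t) := by
      have h4 : 2 * Real.pi * ((h + 1) * t) = 2 * Real.pi * ((h + 1 : ℕ) : ℝ) * Int.fract t
          + (((h + 1 : ℕ) * ⌊t⌋ : ℤ) : ℝ) * (2 * Real.pi) := by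
        have h5 := Int.floor_add_fract t
        push_cast
        linear_combination (-(2 * Real.pi * (h + 1))) * h5
      rw [h4, Real.cos_add_int_mul_two_pi]
    rw [e]
    push_cast
    ring
  · norm_num
    field_simp

lemma exists_abs_sum_sawtooth_le {ι : Type*} (s : Finset ι) (u : ι → ℝ) {δ : ℝ} (hδ : 0 < δ) :
    ∃ δ' : ℝ, |δ'| = δ ∧ |∑ n ∈ s, sawtooth (u n)| ≤ s.card * δ
      + |∑ n ∈ s, (bernoulliTwo (u n + δ') - bernoulliTwo (u n))| / (2 * δ) := by
  have hup : ∑ n ∈ s, sawtooth (u n) ≤ s.card * δ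
      + (∑ n ∈ s, (bernoulliTwo (u n) - bernoulliTwo (u n - δ))) / (2 * δ) := by
    refine (sum_le_sum fun n _ => sawtooth_le hδ (u n)).trans ?_
    rw [sum_add_distrib, sum_const, nsmul_eq_mul, sum_div]
  have hlo : -(s.card * δ) + (∑ n ∈ s, (bernoulliTwo (u n + δ) - bernoulliTwo (u n))) / (2 * δ)
      ≤ ∑ n ∈ s, sawtooth (u n) := by
    refine le_trans ?_ (sum_le_sum fun n _ => le_sawtooth hδ (u n))
    rw [sum_add_distrib, sum_const, nsmul_eq_mul, sum_div]
    apply le_of_eq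
    ring
  rcases le_total 0 (∑ n ∈ s, sawtooth (u n)) with h | h
  · refine ⟨-δ, by rw [abs_neg, abs_of_pos hδ], ?_⟩
    rw [abs_of_nonneg h]
    refine hup.trans ?_
    gcongr
    have e : ∑ n ∈ s, (bernoulliTwo (u n + -δ) - bernoulliTwo (u n))
        = -∑ n ∈ s, (bernoulliTwo (u n) - bernoulliTwo (u n - δ)) := by
      rw [← sum_neg_distrib]
      refine sum_congr rfl fun n _ => ?_
      rw [← sub_eq_add_neg]
      ring
    rw [e, abs_neg]
    exact le_abs_self _
  · refine ⟨δ, abs_of_pos hδ, ?_⟩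
    rw [abs_of_nonpos h]
    have h1 := neg_abs_le (∑ n ∈ s, (bernoulliTwo (u n + δ) - bernoulliTwo (u n)))
    have h2 : -(|∑ n ∈ s, (bernoulliTwo (u n + δ) - bernoulliTwo (u n))| / (2 * δ))
        ≤ (∑ n ∈ s, (bernoulliTwo (u n + δ) - bernoulliTwo (u n))) / (2 * δ) := by
      rw [← neg_div]
      gcongr
    linarith

/-- A truncated Fourier expansion of the sawtooth function, in the form of an inequality. -/
lemma abs_sum_sawtooth_le {ι : Type*} (s : Finset ι) (u : ι → ℝ) {δ B : ℝ} (hδ : 0 < δ)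
    (hB : ∀ H : ℕ, ∑ h ∈ range H, min (1 / ((h : ℝ) + 1)) (1 / (δ * ((h : ℝ) + 1) ^ 2))
      * ‖∑ n ∈ s, expTwoPi ((h + 1) * u n)‖ ≤ B) :
    |∑ n ∈ s, sawtooth (u n)| ≤ s.card * δ + B := by
  obtain ⟨δ', hδ', h⟩ := exists_abs_sum_sawtooth_le s u hδ
  refine h.trans ?_
  gcongr
  rw [div_le_iff₀ (by positivity)]
  have hsum : HasSum (fun h : ℕ => ∑ n ∈ s, (1 / Real.pi ^ 2 * (1 / ((h : ℝ) + 1) ^ 2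
      * Real.cos (2 * Real.pi * ((h + 1) * (u n + δ')))) - 1 / Real.pi ^ 2 * (1 / ((h : ℝ) + 1) ^ 2
      * Real.cos (2 * Real.pi * ((h + 1) * u n)))))
      (∑ n ∈ s, (bernoulliTwo (u n + δ') - bernoulliTwo (u n))) :=
    hasSum_sum fun n _ => (hasSum_bernoulliTwo (u n + δ')).sub (hasSum_bernoulliTwo (u n))
  -- The full series is a limit of partial sums, which is why the hypothesis is asked with the same
  -- B for every cutoff H.
  refine le_of_tendsto hsum.tendsto_sum_nat.abs (Filter.Eventually.of_forall fun H => ?_)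
  refine (abs_sum_le_sum_abs _ _).trans ?_
  have hterm : ∀ h ∈ range H, |∑ n ∈ s, (1 / Real.pi ^ 2 * (1 / ((h : ℝ) + 1) ^ 2
      * Real.cos (2 * Real.pi * ((h + 1) * (u n + δ')))) - 1 / Real.pi ^ 2 * (1 / ((h : ℝ) + 1) ^ 2
      * Real.cos (2 * Real.pi * ((h + 1) * u n))))|
      ≤ 2 * δ * (min (1 / ((h : ℝ) + 1)) (1 / (δ * ((h : ℝ) + 1) ^ 2))
        * ‖∑ n ∈ s, expTwoPi ((h + 1) * u n)‖) := by
    intro h _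
    set S := ∑ n ∈ s, expTwoPi ((h + 1) * u n) with hS
    have hpi := Real.pi_gt_three
    have e1 : ∑ n ∈ s, (1 / Real.pi ^ 2 * (1 / ((h : ℝ) + 1) ^ 2
        * Real.cos (2 * Real.pi * ((h + 1) * (u n + δ')))) - 1 / Real.pi ^ 2 * (1 / ((h : ℝ) + 1) ^ 2
        * Real.cos (2 * Real.pi * ((h + 1) * u n))))
        = 1 / Real.pi ^ 2 * (1 / ((h : ℝ) + 1) ^ 2)
          * ((expTwoPi ((h + 1) * δ') - 1) * S).re := by
      rw [hS, mul_sum, Complex.re_sum, mul_sum]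
      refine sum_congr rfl fun n _ => ?_
      rw [sub_mul, one_mul, ← expTwoPi_add, Complex.sub_re, expTwoPi_re, expTwoPi_re,
        show ((h : ℝ) + 1) * δ' + (h + 1) * u n = (h + 1) * (u n + δ') by ring]
      ring
    have h0 : (0 : ℝ) < (h : ℝ) + 1 := by positivity
    have h1 : ‖expTwoPi ((h + 1) * δ') - 1‖ ≤ 2 := by
      refine (norm_sub_le _ _).trans ?_
      rw [norm_expTwoPi, norm_one]
      norm_num
    have h2 : ‖expTwoPi ((h + 1) * δ') - 1‖ ≤ 2 * Real.pi * ((h + 1) * δ) := by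
      have := norm_expTwoPi_sub_one_le ((h + 1) * δ')
      rwa [abs_mul, hδ', abs_of_pos h0] at this
    rw [e1, abs_mul, abs_of_nonneg (by positivity)]
    have h3 : |((expTwoPi ((h + 1) * δ') - 1) * S).re| ≤ ‖expTwoPi ((h + 1) * δ') - 1‖ * ‖S‖ := by
      rw [← norm_mul]
      exact Complex.abs_re_le_norm _
    -- The two entries of the minimum come from |e((h+1)δ') - 1| being at most 2π(h+1)δ and at most
    -- 2.
    have h4 : 1 / Real.pi ^ 2 * (1 / ((h : ℝ) + 1) ^ 2) * ‖expTwoPi ((h + 1) * δ') - 1‖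
        ≤ 2 * δ * min (1 / ((h : ℝ) + 1)) (1 / (δ * ((h : ℝ) + 1) ^ 2)) := by
      rw [mul_min_of_nonneg _ _ (by positivity)]
      apply le_min
      · calc _ ≤ 1 / Real.pi ^ 2 * (1 / ((h : ℝ) + 1) ^ 2) * (2 * Real.pi * ((h + 1) * δ)) := by
              gcongr
          _ = 1 / Real.pi * (2 * δ * (1 / ((h : ℝ) + 1))) := by field_simp
          _ ≤ 1 * (2 * δ * (1 / ((h : ℝ) + 1))) := by
              gcongr
              rw [div_le_one (by positivity)]
              linarith
          _ = _ := one_mul _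
      · calc _ ≤ 1 / Real.pi ^ 2 * (1 / ((h : ℝ) + 1) ^ 2) * 2 := by gcongr
          _ ≤ 1 * (1 / ((h : ℝ) + 1) ^ 2) * 2 := by
              gcongr
              rw [div_le_one (by positivity)]
              nlinarith
          _ = _ := by field_simp
    calc _ ≤ 1 / Real.pi ^ 2 * (1 / ((h : ℝ) + 1) ^ 2)
          * (‖expTwoPi ((h + 1) * δ') - 1‖ * ‖S‖) := by gcongr
      _ = 1 / Real.pi ^ 2 * (1 / ((h : ℝ) + 1) ^ 2) * ‖expTwoPi ((h + 1) * δ') - 1‖ * ‖S‖ := by ring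
      _ ≤ 2 * δ * min (1 / ((h : ℝ) + 1)) (1 / (δ * ((h : ℝ) + 1) ^ 2)) * ‖S‖ := by gcongr
      _ = _ := by ring
  refine (sum_le_sum hterm).trans ?_
  rw [← mul_sum, mul_comm B]
  gcongr
  exact hB H

/-- Bernoulli's inequality for exponents in `[-1, 0]`. -/
lemma one_add_mul_self_le_rpow_one_add_of_nonpos {s p : ℝ} (hs : -1 < s) (hp : -1 ≤ p)
    (hp0 : p ≤ 0) : 1 + p * s ≤ (1 + s) ^ p := by
  have h1 := rpow_one_add_le_one_add_mul_self hs.le (p := -p) (by linarith) (by linarith)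
  have h2 : 0 < (1 + s) ^ (-p) := Real.rpow_pos_of_pos (by linarith) _
  have h3 : (1 + s) ^ p = ((1 + s) ^ (-p))⁻¹ := by rw [Real.rpow_neg (by linarith), inv_inv]
  rw [h3, ← one_div, le_div_iff₀ h2]
  rcases le_or_gt (1 + p * s) 0 with h | h
  · nlinarith
  · nlinarith [mul_le_mul_of_nonneg_left h1 h.le, sq_nonneg (p * s)]

/-- The weights of the sawtooth expansion summed against a power `h ^ w`. -/
lemma exists_sum_min_mul_rpow_le {w : ℝ} (hw : 0 < w) (hw1 : w < 1) :
    ∃ C : ℝ, 0 ≤ C ∧ ∀ (δ : ℝ) (H : ℕ), 0 < δ →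
      ∑ h ∈ range H, min (1 / ((h : ℝ) + 1)) (1 / (δ * ((h : ℝ) + 1) ^ 2)) * ((h : ℝ) + 1) ^ w
        ≤ C * δ ^ (-w) := by
  have hlow : ∀ n : ℕ, ∑ h ∈ range n, ((h : ℝ) + 1) ^ (w - 1) ≤ 1 / w * (n : ℝ) ^ w := by
    intro n
    induction n with
    | zero => simp [Real.zero_rpow hw.ne']
    | succ n ih =>
      rw [sum_range_succ]
      have hn : (0 : ℝ) < (n : ℝ) + 1 := by positivity
      have h1 : (n : ℝ) ^ w ≤ ((n : ℝ) + 1) ^ w - w * ((n : ℝ) + 1) ^ (w - 1) := by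
        have h2 := rpow_one_add_le_one_add_mul_self (s := -1 / ((n : ℝ) + 1)) (p := w)
          (by rw [le_div_iff₀ hn]; linarith [Nat.cast_nonneg (α := ℝ) n]) hw.le hw1.le
        have h3 : (1 : ℝ) + -1 / ((n : ℝ) + 1) = n / ((n : ℝ) + 1) := by field_simp; ring
        rw [h3, Real.div_rpow (Nat.cast_nonneg n) hn.le, div_le_iff₀ (by positivity)] at h2
        refine h2.trans (le_of_eq ?_)
        rw [Real.rpow_sub_one hn.ne']
        field_simp
        ring
      push_cast
      calc _ ≤ 1 / w * (n : ℝ) ^ w + ((n : ℝ) + 1) ^ (w - 1) := by linarith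
        _ ≤ 1 / w * (((n : ℝ) + 1) ^ w - w * ((n : ℝ) + 1) ^ (w - 1))
            + ((n : ℝ) + 1) ^ (w - 1) := by gcongr
        _ = _ := by field_simp; ring
  have hhigh : ∀ m n : ℕ, 1 ≤ m → ∑ h ∈ Ico m n, ((h : ℝ) + 1) ^ (w - 2)
      ≤ 1 / (1 - w) * (m : ℝ) ^ (w - 1) := by
    intro m n hm
    have h1w : 0 < 1 - w := by linarith
    have hm0 : (0 : ℝ) < m := by exact_mod_cast hm
    suffices h : ∀ k : ℕ, ∑ h ∈ Ico m (m + k), ((h : ℝ) + 1) ^ (w - 2)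
        ≤ 1 / (1 - w) * ((m : ℝ) ^ (w - 1) - ((m + k : ℕ) : ℝ) ^ (w - 1)) by
      rcases le_total n m with hnm | hnm
      · rw [Ico_eq_empty_of_le hnm, sum_empty]
        positivity
      · obtain ⟨k, rfl⟩ := Nat.exists_eq_add_of_le hnm
        refine (h k).trans ?_
        gcongr
        have : 0 ≤ ((m + k : ℕ) : ℝ) ^ (w - 1) := by positivity
        linarith
    intro k
    induction k with
    | zero => simp
    | succ k ih =>
      rw [← add_assoc, sum_Ico_succ_top (by omega)]
      set x : ℝ := ((m + k : ℕ) : ℝ) with hx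
      have hx0 : 0 < x := by rw [hx]; positivity
      have e : ((m + k + 1 : ℕ) : ℝ) = x + 1 := by rw [hx]; push_cast; ring
      rw [e]
      have h1 : (x + 1) ^ (w - 1) + (1 - w) * (x + 1) ^ (w - 2) ≤ x ^ (w - 1) := by
        have h2 := one_add_mul_self_le_rpow_one_add_of_nonpos (s := -1 / (x + 1)) (p := w - 1)
          (by rw [lt_div_iff₀ (by positivity)]; linarith) (by linarith) (by linarith)
        have h3 : (1 : ℝ) + -1 / (x + 1) = x / (x + 1) := by field_simp; ring
        rw [h3, Real.div_rpow hx0.le (by positivity), le_div_iff₀ (by positivity)] at h2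
        refine le_trans (le_of_eq ?_) h2
        rw [show w - 2 = w - 1 - 1 by ring, Real.rpow_sub_one (x := x + 1) (by positivity) (w - 1)]
        field_simp
        ring
      calc _ ≤ 1 / (1 - w) * ((m : ℝ) ^ (w - 1) - x ^ (w - 1)) + (x + 1) ^ (w - 2) := by linarith
        _ ≤ 1 / (1 - w) * ((m : ℝ) ^ (w - 1) - ((x + 1) ^ (w - 1) + (1 - w) * (x + 1) ^ (w - 2)))
            + (x + 1) ^ (w - 2) := by gcongr
        _ = _ := by field_simp; ring
  refine ⟨1 / w + 1 + 1 / (1 - w), ?_, fun δ H hδ => ?_⟩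
  · have : 0 < 1 - w := by linarith
    positivity
  have h1w : 0 < 1 - w := by linarith
  -- Frequencies up to 1/δ use the weight 1/h, later ones 1/(δh²). The index m is treated alone so
  -- that the tail starts at m + 1 ≥ 1 even when δ > 1 and m = 0.
  set m := ⌊δ⁻¹⌋₊ with hm
  have hm1 : (m : ℝ) ≤ δ⁻¹ := Nat.floor_le (by positivity)
  have hm2 : δ⁻¹ < m + 1 := Nat.lt_floor_add_one _
  have hδw : δ ^ (-w) = (δ⁻¹) ^ w := by rw [Real.rpow_neg hδ.le, Real.inv_rpow hδ.le]
  have hδw1 : δ⁻¹ * (δ⁻¹) ^ (w - 1) = δ ^ (-w) := by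
    rw [hδw, ← Real.rpow_one_add' (by positivity) (by linarith)]
    congr 1
    ring
  set f : ℕ → ℝ := fun h => min (1 / ((h : ℝ) + 1)) (1 / (δ * ((h : ℝ) + 1) ^ 2))
    * ((h : ℝ) + 1) ^ w with hf
  have hf0 : ∀ h, 0 ≤ f h := fun h => by positivity
  have hf1 : ∀ h, f h ≤ ((h : ℝ) + 1) ^ (w - 1) := by
    intro h
    have h0 : (0 : ℝ) < (h : ℝ) + 1 := by positivity
    rw [Real.rpow_sub_one h0.ne', div_eq_inv_mul, ← one_div]
    exact mul_le_mul_of_nonneg_right (min_le_left _ _) (by positivity)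
  have hf2 : ∀ h, f h ≤ δ⁻¹ * ((h : ℝ) + 1) ^ (w - 2) := by
    intro h
    have h0 : (0 : ℝ) < (h : ℝ) + 1 := by positivity
    calc f h ≤ 1 / (δ * ((h : ℝ) + 1) ^ 2) * ((h : ℝ) + 1) ^ w :=
          mul_le_mul_of_nonneg_right (min_le_right _ _) (by positivity)
      _ = _ := by
          rw [Real.rpow_sub h0, Real.rpow_ofNat]
          field_simp
  have hA : ∑ h ∈ range m, f h ≤ 1 / w * δ ^ (-w) := by
    refine (sum_le_sum fun h _ => hf1 h).trans ((hlow m).trans ?_)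
    rw [hδw]
    gcongr
  have hB : f m ≤ 1 * δ ^ (-w) := by
    rw [one_mul]
    refine (hf2 m).trans ?_
    rw [← hδw1]
    gcongr ?_ * ?_
    calc ((m : ℝ) + 1) ^ (w - 2) ≤ ((m : ℝ) + 1) ^ (w - 1) :=
          Real.rpow_le_rpow_of_exponent_le (by linarith [Nat.cast_nonneg (α := ℝ) m]) (by linarith)
      _ ≤ _ := Real.rpow_le_rpow_of_nonpos (by positivity) hm2.le (by linarith)
  have hC : ∑ h ∈ Ico (m + 1) H, f h ≤ 1 / (1 - w) * δ ^ (-w) := by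
    refine (sum_le_sum fun h _ => hf2 h).trans ?_
    rw [← mul_sum, ← hδw1]
    calc _ ≤ δ⁻¹ * (1 / (1 - w) * ((m + 1 : ℕ) : ℝ) ^ (w - 1)) := by
          gcongr
          exact hhigh (m + 1) H (by omega)
      _ ≤ δ⁻¹ * (1 / (1 - w) * (δ⁻¹) ^ (w - 1)) := by
          gcongr ?_ * (_ * ?_)
          push_cast
          exact Real.rpow_le_rpow_of_nonpos (by positivity) hm2.le (by linarith)
      _ = _ := by ring
  have hle : ∑ h ∈ range H, f h ≤ ∑ h ∈ range m, f h + f m + ∑ h ∈ Ico (m + 1) H, f h := by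
    rw [← sum_range_succ]
    rcases le_total H (m + 1) with h | h
    · rw [Ico_eq_empty_of_le h, sum_empty, add_zero]
      exact sum_le_sum_of_subset_of_nonneg (range_mono h) fun i _ _ => hf0 i
    · rw [sum_range_add_sum_Ico _ h]
  calc _ ≤ _ := hle
    _ ≤ 1 / w * δ ^ (-w) + 1 * δ ^ (-w) + 1 / (1 - w) * δ ^ (-w) := add_le_add (add_le_add hA hB) hC
    _ = _ := by ring

lemma sum_min_mul_inv_rpow_le {w : ℝ} (hw : 1 / 2 ≤ w) : ∃ C : ℝ, 0 ≤ C ∧ ∀ (δ : ℝ) (H : ℕ),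
    ∑ h ∈ range H, min (1 / ((h : ℝ) + 1)) (1 / (δ * ((h : ℝ) + 1) ^ 2)) * ((h : ℝ) + 1) ^ (-w)
      ≤ C := by
  have hs : Summable fun h : ℕ => ((h + 1 : ℕ) : ℝ) ^ (-(3 / 2) : ℝ) :=
    (summable_nat_add_iff 1).2 (Real.summable_nat_rpow.2 (by norm_num))
  refine ⟨∑' h : ℕ, ((h + 1 : ℕ) : ℝ) ^ (-(3 / 2) : ℝ), tsum_nonneg fun _ => by positivity,
    fun δ H => ?_⟩
  refine le_trans (sum_le_sum fun h _ => ?_) (hs.sum_le_tsum (range H) fun _ _ => by positivity)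
  have h0 : (0 : ℝ) < (h : ℝ) + 1 := by positivity
  push_cast
  calc _ ≤ 1 / ((h : ℝ) + 1) * ((h : ℝ) + 1) ^ (-w) := by
        gcongr
        exact min_le_left _ _
    _ = ((h : ℝ) + 1) ^ (-1 + -w) := by
        rw [Real.rpow_add h0, Real.rpow_neg_one, one_div]
    _ ≤ _ := Real.rpow_le_rpow_of_exponent_le (by linarith [Nat.cast_nonneg (α := ℝ) h])
        (by linarith)

/-! ### What the exponent pair says about the phase y/n -/

lemma modelPhase_two {y u : ℝ} (hu : 0 < u) : modelPhase y 2 u = -(y / u) := by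
  rw [modelPhase, if_neg (by norm_num), show (1 : ℝ) - 2 = -1 by norm_num, Real.rpow_neg_one]
  field_simp

lemma isAdmissiblePhase_modelPhase_two {N y ε : ℝ} (P : ℕ) (hN : 0 < N) (hε : 0 < ε) :
    IsAdmissiblePhase N P y 2 ε N (2 * N) (modelPhase y 2) := by
  have hsm : ∀ u, 0 < u → ContDiffAt ℝ (P : WithTop ℕ∞) (modelPhase y 2) u := by
    intro u hu
    have h1 : ContDiffAt ℝ (P : WithTop ℕ∞) (fun u : ℝ => -(y / u)) u :=
      (contDiffAt_const.div contDiffAt_id hu.ne').neg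
    refine h1.congr_of_eventuallyEq ?_
    filter_upwards [lt_mem_nhds hu] with v hv
    exact modelPhase_two hv
  refine ⟨by linarith, subset_rfl, fun u hu => ?_, fun p _ hp u hu => ?_⟩
  · exact (hsm u (hN.trans_le hu.1)).contDiffWithinAt
  · rw [iteratedDerivWithin_eq_iteratedDeriv (uniqueDiffOn_Icc (by linarith))
      ((hsm u (hN.trans_le hu.1)).of_le (by exact_mod_cast hp)) hu, sub_self, abs_zero]
    positivity

lemma image_natCast_Ioc (a b : ℕ) :
    (Ioc a b).image (fun n : ℕ => (n : ℤ)) = Ioc (a : ℤ) b := by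
  ext n
  simp only [mem_image, mem_Ioc]
  constructor
  · rintro ⟨m, hm, rfl⟩
    exact_mod_cast hm
  · intro hn
    exact ⟨n.toNat, by omega, by omega⟩

/-- The model phase of index 2 is -y/u; complex conjugation removes the sign. -/
lemma norm_phaseSum_modelPhase_two {N y : ℝ} (hN : 0 < N) :
    ‖phaseSum N (2 * N) (modelPhase y 2)‖
      = ‖∑ n ∈ Ioc ⌊N⌋₊ ⌊2 * N⌋₊, expTwoPi (y / n)‖ := by
  rw [phaseSum, ← Int.natCast_floor_eq_floor hN.le,
    ← Int.natCast_floor_eq_floor (by linarith : 0 ≤ 2 * N), ← image_natCast_Ioc,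
    sum_image (fun _ _ _ _ h => by exact_mod_cast h), ← Complex.norm_conj, map_sum]
  congr 1
  refine sum_congr rfl fun n hn => ?_
  have hn0 : (0 : ℝ) < n := by
    have := (mem_Ioc.1 hn).1
    exact_mod_cast (by omega : 0 < n)
  rw [Int.cast_natCast, modelPhase_two hn0]
  change (starRingEnd ℂ) (expTwoPi (-(y / n))) = _
  rw [expTwoPi_neg, Complex.conj_conj]

/-- `(k, l)` bounds the exponential sums with phase `y / n` over dyadic blocks. -/
def BoundsReciprocalPhase (k l : ℝ) : Prop :=
  ∃ C : ℝ, 0 ≤ C ∧ ∀ y N : ℝ, 0 < y → 0 < N →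
    ‖∑ n ∈ Ioc ⌊N⌋₊ ⌊2 * N⌋₊, expTwoPi (y / n)‖ ≤ C * ((y / N ^ 2) ^ k * N ^ l + N ^ 2 / y)

lemma IsExponentPair.boundsReciprocalPhase {k l : ℝ} (h : IsExponentPair k l) :
    BoundsReciprocalPhase k l := by
  -- Only one instance of the definition is ever used: s = 2, with the model phase itself, which
  -- meets every order P and every precision ε.
  obtain ⟨P, _, ε, hε, C, hC⟩ := h.2.2.2.2 2 (by norm_num)
  refine ⟨|C|, abs_nonneg C, fun y N hy hN => ?_⟩
  have h1 := hC N y hN hy N (2 * N) _ (isAdmissiblePhase_modelPhase_two P hN hε)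
  rw [norm_phaseSum_modelPhase_two hN, show (-2 : ℝ) = -((2 : ℕ) : ℝ) by norm_num,
    Real.rpow_neg hN.le, Real.rpow_natCast, ← div_eq_mul_inv, inv_div] at h1
  refine h1.trans ?_
  gcongr
  exact le_abs_self C

/-- For y = m²(2m)! all phases y/n with m < n ≤ 2m are integers, so there is no cancellation and the
sum equals m, while N²/y ≤ 1. With k = 0 the size of y is not penalised, and m ≪ m^l + 1 forces l ≥
1. -/
lemma BoundsReciprocalPhase.one_le {l : ℝ} (h : BoundsReciprocalPhase 0 l) : 1 ≤ l := by
  obtain ⟨C, hC, h⟩ := h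
  by_contra! hl
  have hb : ∀ m : ℕ, 1 ≤ m → (m : ℝ) ≤ C * ((m : ℝ) ^ l + 1) := by
    intro m hm
    have hm0 : (0 : ℝ) < m := by exact_mod_cast hm
    set y : ℝ := ((m ^ 2 * (2 * m).factorial : ℕ) : ℝ) with hy
    have hf : 0 < (2 * m).factorial := Nat.factorial_pos _
    have hy0 : 0 < y := by
      rw [hy]
      exact_mod_cast Nat.mul_pos (pow_pos (by omega) 2) hf
    have h1 := h y m hy0 hm0
    have h2 : ∑ n ∈ Ioc ⌊(m : ℝ)⌋₊ ⌊2 * (m : ℝ)⌋₊, expTwoPi (y / n) = m := by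
      have e1 : ⌊2 * (m : ℝ)⌋₊ = 2 * m := by
        rw [← Nat.floor_natCast (R := ℝ) (2 * m)]
        push_cast
        rfl
      rw [Nat.floor_natCast, e1]
      have e2 : ∀ n ∈ Ioc m (2 * m), expTwoPi (y / n) = 1 := by
        intro n hn
        have hn := mem_Ioc.1 hn
        have hn0 : (n : ℝ) ≠ 0 := by
          have : 0 < n := by omega
          positivity
        obtain ⟨q, hq⟩ := (Nat.dvd_factorial (by omega) hn.2).mul_left (m ^ 2)
        have : y / n = ((q : ℤ) : ℝ) := by
          rw [hy, hq]
          push_cast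
          field_simp
        rw [this, expTwoPi_int]
      rw [sum_congr rfl e2, sum_const, Nat.card_Ioc, nsmul_eq_mul, mul_one]
      congr 1
      omega
    rw [h2, Complex.norm_natCast, Real.rpow_zero, one_mul] at h1
    refine h1.trans ?_
    gcongr
    rw [div_le_one hy0, hy]
    have : m ^ 2 ≤ m ^ 2 * (2 * m).factorial := Nat.le_mul_of_pos_right _ hf
    exact_mod_cast this
  have h1 : Filter.Tendsto (fun m : ℕ => (m : ℝ) / ((m : ℝ) ^ l + 1)) Filter.atTop
      Filter.atTop := by
    have h2 : Filter.Tendsto (fun m : ℕ => 1 / 2 * (m : ℝ) ^ (1 - max l 0)) Filter.atTop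
        Filter.atTop :=
      ((tendsto_rpow_atTop (by simp [hl])).comp tendsto_natCast_atTop_atTop).const_mul_atTop
        (by norm_num)
    refine Filter.tendsto_atTop_mono' _ ?_ h2
    filter_upwards [Filter.eventually_ge_atTop 1] with m hm
    have hm1 : (1 : ℝ) ≤ m := by exact_mod_cast hm
    have hm0 : (0 : ℝ) < m := by linarith
    rw [le_div_iff₀ (by positivity), Real.rpow_sub hm0, Real.rpow_one]
    have h3 : (m : ℝ) ^ l ≤ (m : ℝ) ^ max l 0 :=
      Real.rpow_le_rpow_of_exponent_le hm1 (le_max_left _ _)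
    have h4 : 1 ≤ (m : ℝ) ^ max l 0 := Real.one_le_rpow hm1 (le_max_right _ _)
    calc 1 / 2 * ((m : ℝ) / (m : ℝ) ^ max l 0) * ((m : ℝ) ^ l + 1)
        ≤ 1 / 2 * ((m : ℝ) / (m : ℝ) ^ max l 0) * ((m : ℝ) ^ max l 0 + (m : ℝ) ^ max l 0) := by
          gcongr
      _ = m := by field_simp; ring
  obtain ⟨m, hm1, hm2⟩ := ((h1.eventually_gt_atTop C).and (Filter.eventually_ge_atTop 1)).exists
  have h3 := hb m hm2
  have h4 : (0 : ℝ) < (m : ℝ) ^ l + 1 := by positivity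
  rw [lt_div_iff₀ h4] at hm1
  linarith

/-! ### Sawtooth sums with argument X/n + c -/

lemma sum_expTwoPi_mul_add (s : Finset ℕ) (h X c : ℝ) :
    ‖∑ n ∈ s, expTwoPi (h * (X / n + c))‖ = ‖∑ n ∈ s, expTwoPi (h * X / n)‖ := by
  have e : ∀ n ∈ s, expTwoPi (h * (X / n + c)) = expTwoPi (h * c) * expTwoPi (h * X / n) := by
    intro n _
    rw [← expTwoPi_add]
    congr 1
    ring
  rw [sum_congr rfl e, ← mul_sum, norm_mul, norm_expTwoPi, one_mul]

lemma card_block_le {N : ℝ} (hN : 1 / 2 ≤ N) : ((Ioc ⌊N⌋₊ ⌊2 * N⌋₊).card : ℝ) ≤ 3 * N := by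
  rw [Nat.card_Ioc]
  exact floor_two_mul_sub_floor_le hN

lemma BoundsReciprocalPhase.exists_abs_sum_block_sawtooth_le {k l : ℝ}
    (h : BoundsReciprocalPhase k l) (hk : 0 < k) (hk1 : k < 1) :
    ∃ C : ℝ, 0 ≤ C ∧ ∀ X N c : ℝ, 0 < X → 1 / 2 ≤ N →
      |∑ n ∈ Ioc ⌊N⌋₊ ⌊2 * N⌋₊, sawtooth (X / n + c)|
        ≤ C * (N ^ ((l - k) / (k + 1)) * X ^ (k / (k + 1)) + N ^ 2 / X) := by
  obtain ⟨C₀, hC₀, h⟩ := h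
  obtain ⟨C₁, hC₁, h₁⟩ := exists_sum_min_mul_rpow_le hk hk1
  obtain ⟨C₂, hC₂, h₂⟩ := sum_min_mul_inv_rpow_le (w := 1) (by norm_num)
  refine ⟨3 + C₀ * C₁ + C₀ * C₂, by positivity, fun X N c hX hN => ?_⟩
  have hN0 : 0 < N := by linarith
  have hk1' : k + 1 ≠ 0 := by linarith
  -- This δ balances the smoothing loss Nδ against the main Fourier contribution (X/N²)^k N^l
  -- δ^(-k); both become Y.
  set δ := N ^ ((l - k) / (k + 1) - 1) * X ^ (k / (k + 1)) with hδ
  have hδ0 : 0 < δ := by positivity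
  set Y := N ^ ((l - k) / (k + 1)) * X ^ (k / (k + 1)) with hY
  have hY0 : 0 ≤ Y := by positivity
  have hNδ : N * δ = Y := by
    rw [hδ, hY, Real.rpow_sub_one hN0.ne']
    field_simp
  have hδk : (X / N ^ 2) ^ k * N ^ l * δ ^ (-k) = Y := by
    rw [hδ, hY, Real.div_rpow hX.le (by positivity), ← Real.rpow_natCast N 2,
      ← Real.rpow_mul hN0.le, Real.mul_rpow (by positivity) (by positivity),
      ← Real.rpow_mul hN0.le, ← Real.rpow_mul hX.le]
    have e1 : N ^ ((l - k) / (k + 1)) = N ^ l * N ^ (((l - k) / (k + 1) - 1) * -k)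
        * N ^ (-(((2 : ℕ) : ℝ) * k)) := by
      rw [← Real.rpow_add hN0, ← Real.rpow_add hN0]
      congr 1
      push_cast
      field_simp
      ring
    have e2 : X ^ (k / (k + 1)) = X ^ k * X ^ (k / (k + 1) * -k) := by
      rw [← Real.rpow_add hX]
      congr 1
      field_simp
      ring
    rw [e1, e2, Real.rpow_neg hN0.le]
    field_simp
  have hB : ∀ H : ℕ, ∑ i ∈ range H, min (1 / ((i : ℝ) + 1)) (1 / (δ * ((i : ℝ) + 1) ^ 2))
      * ‖∑ n ∈ Ioc ⌊N⌋₊ ⌊2 * N⌋₊, expTwoPi ((i + 1) * (X / n + c))‖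
      ≤ C₀ * C₁ * Y + C₀ * C₂ * (N ^ 2 / X) := by
    intro H
    have hterm : ∀ i ∈ range H, min (1 / ((i : ℝ) + 1)) (1 / (δ * ((i : ℝ) + 1) ^ 2))
        * ‖∑ n ∈ Ioc ⌊N⌋₊ ⌊2 * N⌋₊, expTwoPi ((i + 1) * (X / n + c))‖
        ≤ C₀ * ((X / N ^ 2) ^ k * N ^ l) * (min (1 / ((i : ℝ) + 1)) (1 / (δ * ((i : ℝ) + 1) ^ 2))
            * ((i : ℝ) + 1) ^ k)
          + C₀ * (N ^ 2 / X) * (min (1 / ((i : ℝ) + 1)) (1 / (δ * ((i : ℝ) + 1) ^ 2))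
            * ((i : ℝ) + 1) ^ (-(1 : ℝ))) := by
      intro i _
      have hi : (0 : ℝ) < (i : ℝ) + 1 := by positivity
      rw [sum_expTwoPi_mul_add]
      refine (mul_le_mul_of_nonneg_left (h _ N (mul_pos hi hX) hN0) (by positivity)).trans
        (le_of_eq ?_)
      rw [mul_div_assoc, Real.mul_rpow hi.le (by positivity), Real.rpow_neg_one]
      field_simp
    refine (sum_le_sum hterm).trans ?_
    rw [sum_add_distrib, ← mul_sum, ← mul_sum]
    calc _ ≤ C₀ * ((X / N ^ 2) ^ k * N ^ l) * (C₁ * δ ^ (-k)) + C₀ * (N ^ 2 / X) * C₂ := by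
          gcongr
          · exact h₁ δ H hδ0
          · exact h₂ δ H
      _ = C₀ * C₁ * ((X / N ^ 2) ^ k * N ^ l * δ ^ (-k)) + C₀ * C₂ * (N ^ 2 / X) := by ring
      _ = _ := by rw [hδk]
  refine (abs_sum_sawtooth_le _ _ hδ0 hB).trans ?_
  have hc := mul_le_mul_of_nonneg_right (card_block_le hN) hδ0.le
  have hZ : 0 ≤ N ^ 2 / X := by positivity
  have h5 : 0 ≤ C₀ * C₁ * (N ^ 2 / X) := by positivity
  have h6 : 0 ≤ C₀ * C₂ * Y := by positivity
  linarith

/-- Each dyadic block is bounded by the value at the top one, at the price of a logarithm. This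
version also covers k = l, where the power of N is constant. -/
lemma BoundsReciprocalPhase.exists_abs_sum_sawtooth_le_log {k l : ℝ}
    (h : BoundsReciprocalPhase k l) (hk : 0 < k) (hk1 : k < 1) (hkl : k ≤ l) :
    ∃ C : ℝ, 0 ≤ C ∧ ∀ X N c : ℝ, 0 < X → 1 ≤ N →
      |∑ n ∈ Ioc 0 ⌊N⌋₊, sawtooth (X / n + c)|
        ≤ C * ((1 + Real.log N) * (N ^ ((l - k) / (k + 1)) * X ^ (k / (k + 1))) + N ^ 2 / X) := by
  obtain ⟨C, hC, hb⟩ := h.exists_abs_sum_block_sawtooth_le hk hk1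
  refine ⟨2 * C, by positivity, fun X N c hX hN => ?_⟩
  have hN0 : 0 < N := by linarith
  obtain ⟨J, hJ, hJ2, hsum⟩ := exists_norm_sum_Ioc_le_dyadic
    (fun n : ℕ => sawtooth (X / n + c)) N hN _ (fun M hM _ => hb X M c hX hM)
  refine hsum.trans ?_
  rw [← mul_sum, sum_add_distrib, ← sum_div, mul_comm 2 C, mul_assoc]
  gcongr
  have hlog := Real.log_nonneg hN
  have hw : 0 ≤ (l - k) / (k + 1) := div_nonneg (by linarith) (by linarith)
  have h1 : ∑ j ∈ range J, (N / 2 ^ (j + 1)) ^ ((l - k) / (k + 1)) * X ^ (k / (k + 1))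
      ≤ J * (N ^ ((l - k) / (k + 1)) * X ^ (k / (k + 1))) := by
    refine (sum_le_card_nsmul _ _ _ fun j _ => ?_).trans (le_of_eq (by rw [card_range, nsmul_eq_mul]))
    gcongr
    exact div_le_self hN0.le (one_le_pow₀ (by norm_num))
  have h2 : ∑ j ∈ range J, (N / 2 ^ (j + 1)) ^ 2 ≤ N ^ 2 := by
    have h3 := sum_range_dyadic_rpow_le (w := 2) (by norm_num) hN0.le J
    simp only [Real.rpow_ofNat] at h3
    refine h3.trans (div_le_self (by positivity) (by norm_num))
  have h4 : (J : ℝ) ≤ 2 * (1 + Real.log N) := by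
    have h5 : Real.log N / Real.log 2 ≤ 2 * Real.log N := by
      rw [div_le_iff₀ (Real.log_pos (by norm_num))]
      have := Real.log_two_gt_d9
      nlinarith
    linarith
  have h6 : 0 ≤ N ^ 2 / X := by positivity
  calc _ ≤ J * (N ^ ((l - k) / (k + 1)) * X ^ (k / (k + 1))) + N ^ 2 / X := by gcongr
    _ ≤ 2 * (1 + Real.log N) * (N ^ ((l - k) / (k + 1)) * X ^ (k / (k + 1))) + 2 * (N ^ 2 / X) := by
        gcongr
        linarith
    _ = _ := by ring

/-- For k < l the exponent of N is positive, so the dyadic blocks form a geometric series and no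
logarithm appears. -/
lemma BoundsReciprocalPhase.exists_abs_sum_sawtooth_le {k l : ℝ}
    (h : BoundsReciprocalPhase k l) (hk : 0 < k) (hk1 : k < 1) (hkl : k < l) :
    ∃ C : ℝ, 0 ≤ C ∧ ∀ X N c : ℝ, 0 < X → 1 ≤ N →
      |∑ n ∈ Ioc 0 ⌊N⌋₊, sawtooth (X / n + c)|
        ≤ C * (N ^ ((l - k) / (k + 1)) * X ^ (k / (k + 1)) + N ^ 2 / X) := by
  obtain ⟨C, hC, hb⟩ := h.exists_abs_sum_block_sawtooth_le hk hk1
  have hw : 0 < (l - k) / (k + 1) := div_pos (by linarith) (by linarith)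
  have hq : (0 : ℝ) < 2 ^ ((l - k) / (k + 1)) - 1 := by
    linarith [Real.one_lt_rpow (x := 2) (by norm_num) hw]
  refine ⟨C * (1 + ((2 : ℝ) ^ ((l - k) / (k + 1)) - 1)⁻¹), by positivity, fun X N c hX hN => ?_⟩
  have hN0 : 0 < N := by linarith
  obtain ⟨J, hJ, hJ2, hsum⟩ := exists_norm_sum_Ioc_le_dyadic
    (fun n : ℕ => sawtooth (X / n + c)) N hN _ (fun M hM _ => hb X M c hX hM)
  refine hsum.trans ?_
  rw [← mul_sum, sum_add_distrib, ← sum_div, ← sum_mul, mul_assoc]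
  refine mul_le_mul_of_nonneg_left ?_ hC
  have h2 : ∑ j ∈ range J, (N / 2 ^ (j + 1)) ^ 2 ≤ N ^ 2 := by
    have h3 := sum_range_dyadic_rpow_le (w := 2) (by norm_num) hN0.le J
    simp only [Real.rpow_ofNat] at h3
    refine h3.trans (div_le_self (by positivity) (by norm_num))
  have h6 : 0 ≤ N ^ 2 / X := by positivity
  set q := ((2 : ℝ) ^ ((l - k) / (k + 1)) - 1)⁻¹ with hqdef
  have hq0 : 0 < q := by positivity
  have h1 := (sum_range_dyadic_rpow_le hw hN0.le J).trans_eq (div_eq_mul_inv _ _)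
  rw [← hqdef] at h1
  calc _ ≤ N ^ ((l - k) / (k + 1)) * q * X ^ (k / (k + 1)) + N ^ 2 / X := by gcongr
    _ ≤ N ^ ((l - k) / (k + 1)) * q * X ^ (k / (k + 1)) + N ^ 2 / X
        + (N ^ ((l - k) / (k + 1)) * X ^ (k / (k + 1)) + q * (N ^ 2 / X)) :=
        le_add_of_nonneg_right (by positivity)
    _ = _ := by ring

/-! ### Multiples of d among the floor quotients -/

/-- The number of multiples of `d` in `𝒮(x)`. -/
noncomputable def multipleCount (x : ℝ) (d : ℕ) : ℕ := #{m ∈ floorQuotients x | d ∣ m}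

/-- The number of `n ≤ N` for which `d` divides `⌊x / n⌋`. -/
noncomputable def hitCount (x : ℝ) (d N : ℕ) : ℕ := #((Ioc 0 N).filter fun n : ℕ => d ∣ ⌊x / (n : ℝ)⌋₊)

lemma mem_floorQuotients {x : ℝ} {m : ℕ} :
    m ∈ floorQuotients x ↔ ∃ n : ℕ, 1 ≤ n ∧ n ≤ ⌊x⌋₊ ∧ ⌊x / (n : ℝ)⌋₊ = m := by
  simp only [floorQuotients, mem_image, mem_Icc, and_assoc]

lemma one_le_of_mem_floorQuotients {x : ℝ} {m : ℕ} (hm : m ∈ floorQuotients x) : 1 ≤ m := by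
  obtain ⟨n, hn, hnx, rfl⟩ := mem_floorQuotients.1 hm
  have hn0 : (0 : ℝ) < n := by exact_mod_cast hn
  have hx : (n : ℝ) ≤ x := (Nat.le_floor_iff' (by omega)).1 hnx
  exact Nat.le_floor (by rw [Nat.cast_one, one_le_div hn0]; exact hx)

lemma le_of_mem_floorQuotients {x : ℝ} (hx : 0 ≤ x) {m : ℕ} (hm : m ∈ floorQuotients x) :
    (m : ℝ) ≤ x := by
  obtain ⟨n, hn, hnx, rfl⟩ := mem_floorQuotients.1 hm
  have hn0 : (1 : ℝ) ≤ n := by exact_mod_cast hn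
  exact (Nat.floor_le (by positivity)).trans (div_le_self hx hn0)

/-- Values up to M contain at most M/d multiples of d; a value above M can come only from some n ≤
x/M. The cut M stays free: √x serves for the asymptotics, larger values for large d. -/
lemma multipleCount_le {x M : ℝ} (hx : 0 ≤ x) (hM : 0 < M) (d : ℕ) :
    (multipleCount x d : ℝ) ≤ M / d + hitCount x d ⌊x / M⌋₊ := by
  have hsub : {m ∈ floorQuotients x | d ∣ m} ⊆ {m ∈ Ioc 0 ⌊M⌋₊ | d ∣ m} ∪
      ((Ioc 0 ⌊x / M⌋₊).filter fun n : ℕ => d ∣ ⌊x / (n : ℝ)⌋₊).image fun n : ℕ => ⌊x / (n : ℝ)⌋₊ := by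
    intro m hm
    obtain ⟨hm, hdm⟩ := mem_filter.1 hm
    rcases le_or_gt (m : ℝ) M with hmM | hmM
    · exact mem_union_left _ (mem_filter.2 ⟨mem_Ioc.2
        ⟨one_le_of_mem_floorQuotients hm, Nat.le_floor hmM⟩, hdm⟩)
    · obtain ⟨n, hn, hnx, rfl⟩ := mem_floorQuotients.1 hm
      have hn0 : (0 : ℝ) < n := by exact_mod_cast hn
      refine mem_union_right _ (mem_image.2 ⟨n, mem_filter.2 ⟨mem_Ioc.2 ⟨hn, ?_⟩, hdm⟩, rfl⟩)
      refine Nat.le_floor ?_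
      rw [le_div_iff₀ hM, mul_comm, ← le_div_iff₀ hn0]
      exact hmM.le.trans (Nat.floor_le (by positivity))
  have h := (card_le_card hsub).trans ((card_union_le _ _).trans
    (Nat.add_le_add_left card_image_le _))
  rw [Nat.Ioc_filter_dvd_card_eq_div] at h
  have h' : (multipleCount x d : ℝ) ≤ ((⌊M⌋₊ / d : ℕ) : ℝ) + hitCount x d ⌊x / M⌋₊ := by
    exact_mod_cast h
  refine h'.trans (add_le_add_left (Nat.cast_div_le.trans ?_) _)
  gcongr
  exact Nat.floor_le hM.le

/-- As m(m+1) ≤ x, the interval (x/(m+1), x/m] has length at least 1, so ⌊x/m⌋ lies in it and is an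
n with ⌊x/n⌋ = m. -/
lemma mem_floorQuotients_of_add_one_le_sqrt {x : ℝ} {m : ℕ} (hm : 1 ≤ m)
    (hmx : (m : ℝ) + 1 ≤ √x) : m ∈ floorQuotients x := by
  have hm0 : (1 : ℝ) ≤ m := by exact_mod_cast hm
  have hs : √x * √x = x := Real.mul_self_sqrt (by
    by_contra! h
    rw [Real.sqrt_eq_zero_of_nonpos h.le] at hmx
    linarith)
  have h1 : (m : ℝ) * (m + 1) ≤ x := by nlinarith
  have hx0 : 0 < x := by nlinarith
  have hxm : 1 ≤ x / m := by
    rw [one_le_div (by linarith)]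
    nlinarith
  have hn : 1 ≤ ⌊x / (m : ℝ)⌋₊ := Nat.le_floor (by exact_mod_cast hxm)
  have hn0 : (0 : ℝ) < (⌊x / (m : ℝ)⌋₊ : ℝ) := by exact_mod_cast hn
  have hle : (⌊x / (m : ℝ)⌋₊ : ℝ) ≤ x / m := Nat.floor_le (by positivity)
  refine mem_floorQuotients.2 ⟨⌊x / (m : ℝ)⌋₊, hn,
    Nat.floor_le_floor (div_le_self hx0.le hm0), ?_⟩
  rw [Nat.floor_eq_iff (by positivity), le_div_iff₀ hn0, div_lt_iff₀ hn0]
  constructor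
  · rwa [mul_comm, ← le_div_iff₀ (by linarith)]
  · have h2 := Nat.lt_floor_add_one (x / (m : ℝ))
    have h3 : x / (m + 1) ≤ x / m - 1 := by
      rw [div_le_iff₀ (by linarith)]
      have : x / m * m = x := div_mul_cancel₀ _ (by linarith)
      nlinarith [(le_div_iff₀ (by linarith : (0 : ℝ) < m)).2
        (by nlinarith : ((m : ℝ) + 1) * m ≤ x)]
    rw [mul_comm, ← div_lt_iff₀ (by linarith)]
    linarith

lemma sqrt_sub_one_lt_floor {x : ℝ} {n : ℕ} (hn : 1 ≤ n) (hnx : (n : ℝ) ≤ √x) :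
    √x - 1 < (⌊x / (n : ℝ)⌋₊ : ℝ) := by
  have hn0 : (0 : ℝ) < n := by exact_mod_cast hn
  have h2 : √x ≤ x / n := by
    rw [le_div_iff₀ hn0]
    calc √x * n ≤ √x * √x := by gcongr
      _ = x := Real.mul_self_sqrt (Real.sqrt_pos.1 (hn0.trans_le hnx)).le
  linarith [Nat.lt_floor_add_one (x / (n : ℝ))]

/-- For a < b ≤ √x one has x/a - x/b ≥ x/(ab) ≥ 1, so the floors differ. -/
lemma floor_div_injOn (x : ℝ) :
    Set.InjOn (fun n : ℕ => ⌊x / (n : ℝ)⌋₊) {n : ℕ | 1 ≤ n ∧ (n : ℝ) ≤ √x} := by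
  have key : ∀ a b : ℕ, 1 ≤ a → a < b → (b : ℝ) ≤ √x →
      ⌊x / (b : ℝ)⌋₊ < ⌊x / (a : ℝ)⌋₊ := by
    intro a b ha hab hb
    have ha0 : (0 : ℝ) < a := by exact_mod_cast ha
    have hab' : (a : ℝ) + 1 ≤ b := by exact_mod_cast hab
    have hs : √x * √x = x :=
      Real.mul_self_sqrt (Real.sqrt_pos.1 (lt_of_lt_of_le (by linarith) hb)).le
    have h1 : x / b + 1 ≤ x / a := by
      have h2 : x / a - x / b = x * (b - a) / (a * b) := by
        have : (b : ℝ) ≠ 0 := by linarith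
        field_simp
      have h3 : 1 ≤ x * (b - a) / (a * b) := by
        rw [one_le_div (by nlinarith)]
        nlinarith [mul_le_mul hb hb (by linarith) (Real.sqrt_nonneg x)]
      linarith
    have h4 : 0 ≤ x / b := div_nonneg (hs ▸ mul_self_nonneg _) (by linarith)
    have h5 := Nat.floor_le h4
    exact Nat.lt_of_succ_le (Nat.le_floor (by push_cast; linarith))
  intro a ha b hb hab
  rcases lt_trichotomy a b with h | h | h
  · exact absurd hab (key a b ha.1 h hb.2).ne'
  · exact h
  · exact absurd hab (key b a hb.1 h ha.2).ne

/-- The integers up to √x - 1 and the values ⌊x/n⌋ with n ≤ √x all lie in 𝒮(x). The latter exceed √x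
- 1 and are pairwise distinct, so nothing is counted twice. -/
lemma le_multipleCount {x : ℝ} (hx : 1 ≤ x) {d : ℕ} (hd : 1 ≤ d) :
    √x / d - 3 + hitCount x d ⌊√x⌋₊ ≤ multipleCount x d := by
  have hd0 : (1 : ℝ) ≤ d := by exact_mod_cast hd
  have hs1 : 1 ≤ √x := Real.one_le_sqrt.2 hx
  have hmem : ∀ n ∈ Ioc 0 ⌊√x⌋₊, 1 ≤ n ∧ (n : ℝ) ≤ √x := fun n hn =>
    ⟨(mem_Ioc.1 hn).1, (Nat.le_floor_iff (by positivity)).1 (mem_Ioc.1 hn).2⟩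
  have hsub : {m ∈ Ioc 0 ⌊√x - 1⌋₊ | d ∣ m} ∪
      ((Ioc 0 ⌊√x⌋₊).filter fun n : ℕ => d ∣ ⌊x / (n : ℝ)⌋₊).image (fun n : ℕ => ⌊x / (n : ℝ)⌋₊)
      ⊆ {m ∈ floorQuotients x | d ∣ m} := by
    refine union_subset (fun m hm => ?_) (fun m hm => ?_)
    · obtain ⟨hm, hdm⟩ := mem_filter.1 hm
      have h := (Nat.le_floor_iff (by linarith)).1 (mem_Ioc.1 hm).2
      exact mem_filter.2
        ⟨mem_floorQuotients_of_add_one_le_sqrt (mem_Ioc.1 hm).1 (by linarith), hdm⟩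
    · obtain ⟨n, hn, rfl⟩ := mem_image.1 hm
      obtain ⟨hn, hdn⟩ := mem_filter.1 hn
      have h := mem_Ioc.1 hn
      exact mem_filter.2 ⟨mem_floorQuotients.2 ⟨n, h.1, h.2.trans
        (Nat.floor_le_floor (Real.sqrt_le_iff.2 ⟨by linarith, by nlinarith⟩)), rfl⟩, hdn⟩
  have hdisj : Disjoint {m ∈ Ioc 0 ⌊√x - 1⌋₊ | d ∣ m}
      (((Ioc 0 ⌊√x⌋₊).filter fun n : ℕ => d ∣ ⌊x / (n : ℝ)⌋₊).image (fun n : ℕ => ⌊x / (n : ℝ)⌋₊)) := by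
    rw [disjoint_left]
    intro m hm hm'
    obtain ⟨n, hn, rfl⟩ := mem_image.1 hm'
    have h1 := (Nat.le_floor_iff (by linarith)).1 (mem_Ioc.1 (mem_filter.1 hm).1).2
    have h2 := hmem n (mem_filter.1 hn).1
    linarith [sqrt_sub_one_lt_floor h2.1 h2.2]
  have h := card_le_card hsub
  rw [card_union_of_disjoint hdisj, Nat.Ioc_filter_dvd_card_eq_div, card_image_of_injOn
    ((floor_div_injOn x).mono fun n hn => hmem n (mem_filter.1 hn).1)] at h
  have h' : ((⌊√x - 1⌋₊ / d : ℕ) : ℝ) + hitCount x d ⌊√x⌋₊ ≤ multipleCount x d := by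
    exact_mod_cast h
  have h1 := Nat.lt_floor_add_one (√x - 1)
  have h2 : (⌊√x - 1⌋₊ : ℝ) < d * (((⌊√x - 1⌋₊ / d : ℕ) : ℝ) + 1) := by
    exact_mod_cast Nat.lt_mul_div_succ _ (by omega)
  have h3 : √x / d ≤ ((⌊√x - 1⌋₊ / d : ℕ) : ℝ) + 3 := by
    rw [div_le_iff₀ (by linarith)]
    nlinarith
  linarith

lemma int_ediv_sub_sub_one_ediv {d : ℤ} (hd : 0 < d) (z : ℤ) :
    z / d - (z - 1) / d = if d ∣ z then 1 else 0 := by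
  have h1 := Int.emod_add_mul_ediv z d
  have h2 := Int.emod_nonneg z hd.ne'
  have h3 := Int.emod_lt_of_pos z hd
  split_ifs with h
  · have h4 := Int.emod_eq_zero_of_dvd h
    have : (z - 1) / d = z / d - 1 :=
      ((Int.ediv_emod_unique (r := d - 1) hd).2 ⟨by linarith, by omega, by omega⟩).1
    omega
  · have h4 : z % d ≠ 0 := fun h5 => h (Int.dvd_of_emod_eq_zero h5)
    have : (z - 1) / d = z / d :=
      ((Int.ediv_emod_unique (r := z % d - 1) hd).2 ⟨by linarith, by omega, by omega⟩).1
    omega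

/-- Divisibility of ⌊t⌋ by d is the jump ⌊t/d⌋ - ⌊(t-1)/d⌋. Writing each floor as its argument minus
a fractional part leaves 1/d and two sawtooths. -/
lemma ite_dvd_floor_eq {t : ℝ} (ht : 0 ≤ t) {d : ℕ} (hd : 1 ≤ d) :
    (if d ∣ ⌊t⌋₊ then (1 : ℝ) else 0)
      = 1 / d + (sawtooth (t / d - 1 / d) - sawtooth (t / d)) := by
  have h := int_ediv_sub_sub_one_ediv (by exact_mod_cast hd : (0 : ℤ) < d) ⌊t⌋
  have hdvd : (d : ℤ) ∣ ⌊t⌋ ↔ d ∣ ⌊t⌋₊ := by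
    rw [← Int.natCast_floor_eq_floor ht, Int.natCast_dvd_natCast]
  simp only [hdvd] at h
  have h' : (if d ∣ ⌊t⌋₊ then (1 : ℝ) else 0) = ⌊t / d⌋ - ⌊(t - 1) / d⌋ := by
    rw [Int.floor_div_natCast, Int.floor_div_natCast, Int.floor_sub_one]
    exact_mod_cast h.symm
  rw [h', ← sub_div, sawtooth, sawtooth, Int.fract, Int.fract]
  ring

lemma abs_hitCount_sub_le {x U : ℝ} (hx : 0 ≤ x) {d N : ℕ} (hd : 1 ≤ d)
    (hU : ∀ c : ℝ, |∑ n ∈ Ioc 0 N, sawtooth (x / d / n + c)| ≤ U) :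
    |(hitCount x d N : ℝ) - N / d| ≤ 2 * U := by
  have e : (hitCount x d N : ℝ) = N / d + (∑ n ∈ Ioc 0 N, sawtooth (x / d / n + -(1 / d))
      - ∑ n ∈ Ioc 0 N, sawtooth (x / d / n + 0)) := by
    rw [hitCount, card_filter, Nat.cast_sum, ← sum_sub_distrib]
    have : ((N : ℝ) / d) = ∑ n ∈ Ioc 0 N, (1 / d : ℝ) := by
      rw [sum_const, Nat.card_Ioc, nsmul_eq_mul, Nat.sub_zero, mul_one_div]
    rw [this, ← sum_add_distrib]
    refine sum_congr rfl fun n _ => ?_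
    push_cast
    rw [ite_dvd_floor_eq (by positivity) hd, add_zero, div_right_comm, sub_eq_add_neg (_ / _)]
  rw [e, add_sub_cancel_left]
  linarith [abs_sub (∑ n ∈ Ioc 0 N, sawtooth (x / d / n + -(1 / d)))
    (∑ n ∈ Ioc 0 N, sawtooth (x / d / n + 0)), hU (-(1 / d)), hU 0]

lemma card_floorQuotients_le {x : ℝ} (hx : 1 ≤ x) : ((floorQuotients x).card : ℝ) ≤ 2 * √x := by
  have h := multipleCount_le (by linarith) (Real.sqrt_pos.2 (by linarith : 0 < x)) 1
  have h1 : multipleCount x 1 = (floorQuotients x).card := by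
    simp [multipleCount]
  have h2 : (hitCount x 1 ⌊x / √x⌋₊ : ℝ) ≤ √x := by
    rw [Real.div_sqrt]
    have : hitCount x 1 ⌊√x⌋₊ ≤ ⌊√x⌋₊ := by
      refine (card_filter_le _ _).trans_eq (by simp)
    exact (Nat.cast_le.2 this).trans (Nat.floor_le (Real.sqrt_nonneg _))
  rw [h1, Nat.cast_one, div_one] at h
  linarith

/-- The number of multiples of `d` in `𝒮(x)` is close to `2√x / d` when the sawtooth sums are
small. -/
lemma abs_multipleCount_sub_le {x U : ℝ} (hx : 1 ≤ x) {d : ℕ} (hd : 1 ≤ d)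
    (hU : ∀ c : ℝ, |∑ n ∈ Ioc 0 ⌊√x⌋₊, sawtooth (x / d / n + c)| ≤ U) :
    |(multipleCount x d : ℝ) - 2 * √x / d| ≤ 2 * U + 4 := by
  have h1 := abs_le.1 (abs_hitCount_sub_le (by linarith) hd hU)
  have h2 := multipleCount_le (x := x) (by linarith) (Real.sqrt_pos.2 (by linarith : 0 < x)) d
  have h3 := le_multipleCount hx hd
  rw [Real.div_sqrt] at h2
  have hd0 : (1 : ℝ) ≤ d := by exact_mod_cast hd
  have h4 : (⌊√x⌋₊ : ℝ) / d ≤ √x / d := by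
    gcongr
    exact Nat.floor_le (Real.sqrt_nonneg _)
  have h5 : √x / d ≤ (⌊√x⌋₊ : ℝ) / d + 1 := by
    rw [div_add_one (by linarith), div_le_div_iff_of_pos_right (by linarith)]
    linarith [Nat.lt_floor_add_one (√x)]
  have h6 : 2 * √x / d = √x / d + √x / d := by ring
  rw [h6, abs_le]
  constructor <;> linarith [h1.1, h1.2]

/-! ### The divisor bound and Möbius inversion -/

lemma add_one_le_mul_rpow {ε : ℝ} (hε : 0 < ε) {p : ℕ} (hp : 2 ≤ p) (v : ℕ) :
    (v : ℝ) + 1 ≤ (if p < ⌈(2 : ℝ) ^ (1 / ε)⌉₊ then 1 + 1 / (ε * Real.log 2) else 1)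
      * ((p ^ v : ℕ) : ℝ) ^ ε := by
  have hp2 : (2 : ℝ) ≤ p := by exact_mod_cast hp
  have hp0 : (0 : ℝ) < p := by linarith
  have hl : 0 < Real.log 2 := Real.log_pos (by norm_num)
  have e : ((p ^ v : ℕ) : ℝ) ^ ε = ((p : ℝ) ^ ε) ^ v := by
    rw [Nat.cast_pow, ← Real.rpow_natCast, ← Real.rpow_mul hp0.le, mul_comm, Real.rpow_mul hp0.le,
      Real.rpow_natCast]
  rw [e]
  split_ifs with h
  · have h1 : 1 + v * (ε * Real.log 2) ≤ ((p : ℝ) ^ ε) ^ v := by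
      have h2 : 1 + ε * Real.log 2 ≤ (p : ℝ) ^ ε := by
        calc 1 + ε * Real.log 2 ≤ (2 : ℝ) ^ ε := by
              rw [Real.rpow_def_of_pos (by norm_num), add_comm, mul_comm ε]
              exact Real.add_one_le_exp _
          _ ≤ _ := by gcongr
      refine (one_add_mul_le_pow (a := ε * Real.log 2) ?_ v).trans ?_
      · have : 0 < ε * Real.log 2 := by positivity
        linarith
      · gcongr
    have h0 : 0 < ε * Real.log 2 := by positivity
    refine le_trans ?_ (mul_le_mul_of_nonneg_left h1 (by positivity))
    have h3 : (1 + 1 / (ε * Real.log 2)) * (1 + v * (ε * Real.log 2))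
        = v + 1 + (v * (ε * Real.log 2) + 1 / (ε * Real.log 2)) := by
      field_simp
      ring
    rw [h3]
    exact le_add_of_nonneg_right (by positivity)
  -- Here p^ε ≥ 2, so v + 1 ≤ 2^v ≤ p^(vε) with no loss. Only the primes below 2^(1/ε) cost a
  -- constant, and their number depends on ε alone.
  · rw [one_mul]
    have h1 : (2 : ℝ) ≤ (p : ℝ) ^ ε := by
      have h2 : (2 : ℝ) ^ (1 / ε) ≤ p := Nat.ceil_le.1 (not_lt.1 h)
      calc (2 : ℝ) = ((2 : ℝ) ^ (1 / ε)) ^ ε := by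
            rw [← Real.rpow_mul (by norm_num), one_div_mul_cancel hε.ne', Real.rpow_one]
        _ ≤ _ := by gcongr
    calc (v : ℝ) + 1 = 1 + v * 1 := by ring
      _ ≤ (1 + 1) ^ v := one_add_mul_le_pow (by norm_num) v
      _ ≤ _ := by
        gcongr
        linarith

/-- The divisor bound. -/
lemma exists_card_divisors_le {ε : ℝ} (hε : 0 < ε) :
    ∃ C : ℝ, 0 ≤ C ∧ ∀ n : ℕ, n ≠ 0 → (#n.divisors : ℝ) ≤ C * (n : ℝ) ^ ε := by
  set B := ⌈(2 : ℝ) ^ (1 / ε)⌉₊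
  set A := 1 + 1 / (ε * Real.log 2) with hA
  have hA1 : 1 ≤ A := by
    have hl : 0 < Real.log 2 := Real.log_pos (by norm_num)
    exact le_add_of_nonneg_right (by positivity)
  refine ⟨A ^ B, by positivity, fun n hn => ?_⟩
  rw [Nat.card_divisors hn, Nat.cast_prod]
  have h1 : (n : ℝ) ^ ε
      = ∏ p ∈ n.primeFactors, ((p ^ n.factorization p : ℕ) : ℝ) ^ ε := by
    rw [Real.finsetProd_rpow _ _ (fun _ _ => Nat.cast_nonneg _), ← Nat.cast_prod]
    congr 2
    exact (Nat.prod_factorization_pow_eq_self hn).symm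
  have h2 : ∏ p ∈ n.primeFactors, (if p < B then A else 1) ≤ A ^ B := by
    rw [← prod_filter, prod_const]
    refine pow_le_pow_right₀ hA1 ?_
    refine (card_le_card (t := range B) fun p hp => mem_range.2 (mem_filter.1 hp).2).trans_eq
      (card_range B)
  rw [h1]
  refine le_trans (prod_le_prod (fun p _ => Nat.cast_nonneg _) (fun p hp => ?_))
    ((prod_mul_distrib).trans_le (mul_le_mul_of_nonneg_right h2
      (prod_nonneg fun p _ => by positivity)))
  rw [Nat.cast_add_one]
  exact add_one_le_mul_rpow hε (Nat.prime_of_mem_primeFactors hp).two_le _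

/-- Exchanging the summations counts the divisors of the elements of 𝒮(x); there are at most 2√x
elements, each at most x. -/
lemma exists_sum_multipleCount_le {ε : ℝ} (hε : 0 < ε) :
    ∃ C : ℝ, 0 ≤ C ∧ ∀ x : ℝ, 1 ≤ x →
      ∑ d ∈ Ioc 0 ⌊x⌋₊, (multipleCount x d : ℝ) ≤ C * (√x * x ^ ε) := by
  obtain ⟨C, hC, h⟩ := exists_card_divisors_le hε
  refine ⟨2 * C, by positivity, fun x hx => ?_⟩
  have e : ∑ d ∈ Ioc 0 ⌊x⌋₊, multipleCount x d = ∑ m ∈ floorQuotients x, #m.divisors := by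
    simp only [multipleCount, card_filter]
    rw [sum_comm]
    refine sum_congr rfl fun m hm => ?_
    rw [← card_filter]
    congr 1
    ext d
    have h1 := one_le_of_mem_floorQuotients hm
    have h2 : m ≤ ⌊x⌋₊ := Nat.le_floor (le_of_mem_floorQuotients (by linarith) hm)
    rw [mem_filter, mem_Ioc, Nat.mem_divisors]
    constructor
    · rintro ⟨-, hd⟩
      exact ⟨hd, by omega⟩
    · rintro ⟨hd, -⟩
      exact ⟨⟨Nat.pos_of_dvd_of_pos hd h1, (Nat.le_of_dvd h1 hd).trans h2⟩, hd⟩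
  rw [← Nat.cast_sum, e, Nat.cast_sum]
  calc ∑ m ∈ floorQuotients x, (#m.divisors : ℝ)
      ≤ ∑ _m ∈ floorQuotients x, C * x ^ ε := by
        refine sum_le_sum fun m hm => (h m ?_).trans ?_
        · have := one_le_of_mem_floorQuotients hm
          omega
        · have := le_of_mem_floorQuotients (by linarith) hm
          gcongr
    _ = #(floorQuotients x) * (C * x ^ ε) := by rw [sum_const, nsmul_eq_mul]
    _ ≤ 2 * √x * (C * x ^ ε) := by
        gcongr
        exact card_floorQuotients_le hx
    _ = _ := by ring

lemma sum_divisors_moebius {n : ℕ} :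
    ∑ d ∈ n.divisors, ArithmeticFunction.moebius d = if n = 1 then 1 else 0 := by
  rw [← ArithmeticFunction.coe_mul_zeta_apply, ArithmeticFunction.moebius_mul_coe_zeta,
    ArithmeticFunction.one_apply]

lemma coprimePairCount_eq_sum {x : ℝ} (hx : 0 ≤ x) :
    (coprimePairCount x : ℤ)
      = ∑ d ∈ Ioc 0 ⌊x⌋₊, ArithmeticFunction.moebius d * (multipleCount x d : ℤ) ^ 2 := by
  have h1 : ∀ p ∈ floorQuotients x ×ˢ floorQuotients x,
      (if Nat.gcd p.1 p.2 = 1 then (1 : ℤ) else 0)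
        = ∑ d ∈ Ioc 0 ⌊x⌋₊, if d ∣ p.1 ∧ d ∣ p.2 then ArithmeticFunction.moebius d else 0 := by
    intro p hp
    have hp := mem_product.1 hp
    have hp1 := one_le_of_mem_floorQuotients hp.1
    have hp2 : p.1 ≤ ⌊x⌋₊ := Nat.le_floor (le_of_mem_floorQuotients hx hp.1)
    rw [← sum_divisors_moebius, ← sum_filter]
    refine sum_congr ?_ fun _ _ => rfl
    ext d
    rw [Nat.mem_divisors, mem_filter, mem_Ioc, Nat.dvd_gcd_iff]
    constructor
    · rintro ⟨hd, -⟩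
      exact ⟨⟨Nat.pos_of_dvd_of_pos hd.1 hp1, (Nat.le_of_dvd hp1 hd.1).trans hp2⟩, hd⟩
    · rintro ⟨-, hd⟩
      exact ⟨hd, Nat.gcd_ne_zero_left (by omega)⟩
  rw [coprimePairCount, card_filter, Nat.cast_sum]
  simp only [Nat.cast_ite, Nat.cast_one, Nat.cast_zero]
  rw [sum_congr rfl h1, sum_comm]
  refine sum_congr rfl fun d _ => ?_
  rw [← sum_filter, sum_const, nsmul_eq_mul, mul_comm, sq]
  congr 1
  rw [multipleCount, ← Nat.cast_mul, ← card_product, ← filter_product]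

/-- The full series is the L-series of μ at 2, the inverse of ζ(2); the tail is dominated by ∑ 1/d²,
which telescopes to at most 1/N. -/
lemma norm_sum_moebius_div_sq_sub_le {N : ℕ} (hN : N ≠ 0) :
    ‖∑ d ∈ Ioc 0 N, (ArithmeticFunction.moebius d : ℂ) / (d : ℂ) ^ 2 - 1 / riemannZeta 2‖
      ≤ 1 / N := by
  have hs : 1 < (2 : ℂ).re := by norm_num
  have hsum := (ArithmeticFunction.LSeriesSummable_moebius_iff.2 hs).hasSum
  have hval : ∑' n, LSeries.term (fun n => (ArithmeticFunction.moebius n : ℂ)) 2 n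
      = 1 / riemannZeta 2 := by
    have h := ArithmeticFunction.LSeries_zeta_mul_Lseries_moebius hs
    rw [ArithmeticFunction.LSeries_zeta_eq_riemannZeta hs] at h
    exact eq_one_div_of_mul_eq_one_right h
  rw [hval] at hsum
  have hterm : ∀ M : ℕ,
      ∑ n ∈ range (M + 1), LSeries.term (fun n => (ArithmeticFunction.moebius n : ℂ)) 2 n
        = ∑ d ∈ Ioc 0 M, (ArithmeticFunction.moebius d : ℂ) / (d : ℂ) ^ 2 := by
    intro M
    rw [range_eq_Ico, sum_eq_sum_Ico_succ_bot (by omega), LSeries.term_zero, zero_add]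
    refine sum_congr (by ext; simp; omega) fun d hd => ?_
    have hd := mem_Ioc.1 hd
    rw [LSeries.term_of_ne_zero (by omega)]
    norm_num
  have hlim := ((hsum.tendsto_sum_nat.comp (Filter.tendsto_add_atTop_nat 1)).const_sub
    (∑ d ∈ Ioc 0 N, (ArithmeticFunction.moebius d : ℂ) / (d : ℂ) ^ 2)).norm
  refine le_of_tendsto hlim (Filter.eventually_atTop.2 ⟨N, fun M hM => ?_⟩)
  rw [Function.comp_apply, hterm, ← sum_Ioc_consecutive _ (Nat.zero_le N) hM, sub_add_cancel_left,
    norm_neg]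
  refine (norm_sum_le _ _).trans ?_
  calc _ ≤ ∑ d ∈ Ioc N M, ((d : ℝ) ^ 2)⁻¹ := by
        refine sum_le_sum fun d _ => ?_
        rw [norm_div, norm_pow, Complex.norm_natCast, Complex.norm_intCast, inv_eq_one_div]
        gcongr
        exact_mod_cast ArithmeticFunction.abs_moebius_le_one
    _ ≤ (N : ℝ)⁻¹ - (M : ℝ)⁻¹ := sum_Ioc_inv_sq_le_sub hN hM
    _ ≤ 1 / N := by
        rw [one_div]
        exact sub_le_self _ (by positivity)

/-! ### Summation over d -/

lemma exists_one_add_log_le_mul_rpow {η : ℝ} (hη : 0 < η) :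
    ∃ C : ℝ, 0 ≤ C ∧ ∀ x : ℝ, 1 ≤ x → 1 + Real.log x ≤ C * x ^ η := by
  refine ⟨1 + 1 / η, by positivity, fun x hx => ?_⟩
  have h1 := Real.log_le_rpow_div (by linarith : 0 ≤ x) hη
  have h2 := Real.one_le_rpow hx hη.le
  have : (1 + 1 / η) * x ^ η = x ^ η + x ^ η / η := by ring
  linarith

lemma sum_Ioc_inv_le_one_add_log {x : ℝ} (hx : 1 ≤ x) :
    ∑ d ∈ Ioc 0 ⌊x⌋₊, (d : ℝ)⁻¹ ≤ 1 + Real.log x := by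
  have h := harmonic_floor_le_one_add_log x hx
  rw [harmonic_eq_sum_Icc] at h
  push_cast at h
  exact h

lemma sqrt_mul_rpow {x : ℝ} (hx : 0 < x) (θ : ℝ) : √x * x ^ θ = x ^ (1 / 2 + θ) := by
  rw [Real.sqrt_eq_rpow, ← Real.rpow_add hx]

lemma abs_sq_sub_sq_le {S a E b C : ℝ} (h : |S - a| ≤ E) (hE : E ≤ C * b) (ha : 0 ≤ a)
    (hab : a ≤ 2 * b) : |S ^ 2 - a ^ 2| ≤ (C + 4) * (E * b) := by
  have h0 : 0 ≤ E := (abs_nonneg _).trans h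
  have h1 : |S + a| ≤ (C + 4) * b := by
    have : S + a = (S - a) + 2 * a := by ring
    rw [this]
    refine (abs_add_le _ _).trans ?_
    rw [abs_of_nonneg (by linarith : 0 ≤ 2 * a)]
    linarith
  rw [show S ^ 2 - a ^ 2 = (S - a) * (S + a) by ring, abs_mul]
  calc _ ≤ E * ((C + 4) * b) := mul_le_mul h h1 (abs_nonneg _) h0
    _ = _ := by ring

/-- For d ≤ x^(1/2-θ) one has x^θ ≤ √x/d, so the error in S_d is at most of the order of its main
term and the error in the square is about x^θ d^(-κ) · √x/d. The exponent -(1+κ) of d makes the sum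
converge. -/
lemma exists_sum_abs_multipleCount_sq_sub_le {θ κ : ℝ} (hκ : 0 < κ)
    (hE : ∃ C : ℝ, 0 ≤ C ∧ ∀ x : ℝ, 2 ≤ x → ∀ d : ℕ, 1 ≤ d → (d : ℝ) ≤ x ^ (1 / 2 - θ) →
      |(multipleCount x d : ℝ) - 2 * √x / d| ≤ C * (x ^ θ * (d : ℝ) ^ (-κ))) :
    ∃ C : ℝ, 0 ≤ C ∧ ∀ x : ℝ, 2 ≤ x →
      ∑ d ∈ Ioc 0 ⌊x ^ (1 / 2 - θ)⌋₊, |(multipleCount x d : ℝ) ^ 2 - 4 * x / (d : ℝ) ^ 2|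
        ≤ C * x ^ (1 / 2 + θ) := by
  obtain ⟨C, hC, hE⟩ := hE
  have hsum : Summable fun d : ℕ => (d : ℝ) ^ (-(1 + κ)) :=
    Real.summable_nat_rpow.2 (by linarith)
  refine ⟨(C + 4) * C * ∑' d : ℕ, (d : ℝ) ^ (-(1 + κ)),
    mul_nonneg (by positivity) (tsum_nonneg fun _ => by positivity), fun x hx => ?_⟩
  have hx0 : 0 < x := by linarith
  calc _ ≤ ∑ d ∈ Ioc 0 ⌊x ^ (1 / 2 - θ)⌋₊,
        (C + 4) * C * x ^ (1 / 2 + θ) * (d : ℝ) ^ (-(1 + κ)) := by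
        refine sum_le_sum fun d hd => ?_
        have hd := mem_Ioc.1 hd
        have hd1 : 1 ≤ d := hd.1
        have hd0 : (0 : ℝ) < d := by exact_mod_cast hd1
        have hd1' : (1 : ℝ) ≤ d := by exact_mod_cast hd1
        have hdx : (d : ℝ) ≤ x ^ (1 / 2 - θ) := (Nat.le_floor_iff (by positivity)).1 hd.2
        have h1 : x ^ θ ≤ √x / d := by
          rw [le_div_iff₀ hd0]
          calc x ^ θ * d ≤ x ^ θ * x ^ (1 / 2 - θ) := by gcongr
            _ = √x := by
              rw [← Real.rpow_add hx0, Real.sqrt_eq_rpow]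
              congr 1
              ring
        have h2 : (d : ℝ) ^ (-κ) ≤ 1 :=
          Real.rpow_le_one_of_one_le_of_nonpos hd1' (by linarith)
        have h3 : C * (x ^ θ * (d : ℝ) ^ (-κ)) ≤ C * (√x / d) := by
          refine mul_le_mul_of_nonneg_left ((mul_le_of_le_one_right (by positivity) h2).trans h1) hC
        have h4 := abs_sq_sub_sq_le (hE x hx d hd1 hdx) h3 (by positivity)
          (mul_div_assoc 2 _ _).le
        have h5 : (2 * √x / d) ^ 2 = 4 * x / (d : ℝ) ^ 2 := by
          rw [div_pow, mul_pow, Real.sq_sqrt hx0.le]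
          norm_num
        rw [h5] at h4
        refine h4.trans_eq ?_
        rw [← sqrt_mul_rpow hx0, neg_add, Real.rpow_add hd0, Real.rpow_neg_one]
        ring
    _ = (C + 4) * C * x ^ (1 / 2 + θ) * ∑ d ∈ Ioc 0 ⌊x ^ (1 / 2 - θ)⌋₊, (d : ℝ) ^ (-(1 + κ)) :=
        (mul_sum _ _ _).symm
    _ ≤ (C + 4) * C * x ^ (1 / 2 + θ) * ∑' d : ℕ, (d : ℝ) ^ (-(1 + κ)) := by
        gcongr
        exact hsum.sum_le_tsum _ fun _ _ => by positivity
    _ = _ := by ring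

lemma div_floor_rpow_le {x θ : ℝ} (hx : 2 ≤ x) (hθ : θ < 1 / 2) :
    x / ⌊x ^ (1 / 2 - θ)⌋₊ ≤ 2 * x ^ (1 / 2 + θ) := by
  have hx0 : 0 < x := by linarith
  have h1 : 1 ≤ x ^ (1 / 2 - θ) := Real.one_le_rpow (by linarith) (by linarith)
  have h2 : (1 : ℝ) ≤ ⌊x ^ (1 / 2 - θ)⌋₊ := by exact_mod_cast Nat.le_floor (by exact_mod_cast h1)
  have h3 := Nat.lt_floor_add_one (x ^ (1 / 2 - θ))
  rw [div_le_iff₀ (by linarith)]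
  calc x = x ^ (1 / 2 + θ) * x ^ (1 / 2 - θ) := by
        rw [← Real.rpow_add hx0]
        norm_num
    _ ≤ x ^ (1 / 2 + θ) * (2 * ⌊x ^ (1 / 2 - θ)⌋₊) := by
        gcongr
        linarith
    _ = _ := by ring

/-- Applying the bound twice to the part √x/d and once to the part x^(θ-η) leaves three sums: ∑
x/d², dominated by x over the cut, ∑ 1/d, a logarithm, and ∑ S_d, controlled by the divisor bound.
Each of the last two loses at most x^η, which the saving cancels. -/
lemma exists_sum_multipleCount_sq_le {θ η : ℝ} (hθ : θ < 1 / 2) (hθ0 : 0 ≤ θ) (hη : 0 < η)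
    (hT : ∃ C : ℝ, 0 ≤ C ∧ ∀ x : ℝ, 2 ≤ x → ∀ d : ℕ, x ^ (1 / 2 - θ) < d →
      (multipleCount x d : ℝ) ≤ C * (√x / d + x ^ (θ - η))) :
    ∃ C : ℝ, 0 ≤ C ∧ ∀ x : ℝ, 2 ≤ x →
      ∑ d ∈ Ioc ⌊x ^ (1 / 2 - θ)⌋₊ ⌊x⌋₊, (multipleCount x d : ℝ) ^ 2
        ≤ C * x ^ (1 / 2 + θ) := by
  obtain ⟨C, hC, hT⟩ := hT
  obtain ⟨C₁, hC₁, hS⟩ := exists_sum_multipleCount_le hη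
  obtain ⟨C₂, hC₂, hL⟩ := exists_one_add_log_le_mul_rpow hη
  refine ⟨C ^ 2 * 2 + C ^ 2 * C₂ + C * C₁, by positivity, fun x hx => ?_⟩
  have hx0 : 0 < x := by linarith
  set D := ⌊x ^ (1 / 2 - θ)⌋₊ with hD
  set S : ℕ → ℝ := fun d => multipleCount x d with hSdef
  have h1 : 1 ≤ x ^ (1 / 2 - θ) := Real.one_le_rpow (by linarith) (by linarith)
  have hD1 : 1 ≤ D := Nat.le_floor (by exact_mod_cast h1)
  have hDR : D ≤ ⌊x⌋₊ := Nat.floor_le_floor <|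
    (Real.rpow_le_rpow_of_exponent_le (by linarith) (by linarith)).trans_eq (Real.rpow_one x)
  have hpt : ∀ d ∈ Ioc D ⌊x⌋₊, S d ^ 2 ≤ C ^ 2 * (x * ((d : ℝ) ^ 2)⁻¹)
      + C ^ 2 * (√x * x ^ (θ - η)) * (d : ℝ)⁻¹ + C * x ^ (θ - η) * S d := by
    intro d hd
    have hd := mem_Ioc.1 hd
    have hd0 : (0 : ℝ) < d := by
      have : 0 < d := by omega
      exact_mod_cast this
    have h2 := hT x hx d ((Nat.floor_lt (by positivity)).1 hd.1)
    have h3 : 0 ≤ S d := Nat.cast_nonneg _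
    have h4 : S d ≤ C * (√x / d + x ^ (θ - η)) := h2
    calc S d ^ 2 ≤ S d * (C * (√x / d + x ^ (θ - η))) := by
          rw [sq]
          gcongr
      _ = C * (√x / d) * S d + C * x ^ (θ - η) * S d := by ring
      _ ≤ C * (√x / d) * (C * (√x / d + x ^ (θ - η))) + C * x ^ (θ - η) * S d := by gcongr
      _ = C ^ 2 * ((√x) ^ 2 * ((d : ℝ) ^ 2)⁻¹) + C ^ 2 * (√x * x ^ (θ - η)) * (d : ℝ)⁻¹
          + C * x ^ (θ - η) * S d := by
          field_simp
      _ = _ := by rw [Real.sq_sqrt hx0.le]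
  have hsub : Ioc D ⌊x⌋₊ ⊆ Ioc 0 ⌊x⌋₊ := Ioc_subset_Ioc_left (Nat.zero_le _)
  have hs1 : x * ∑ d ∈ Ioc D ⌊x⌋₊, ((d : ℝ) ^ 2)⁻¹ ≤ 2 * x ^ (1 / 2 + θ) := by
    refine le_trans ?_ (div_floor_rpow_le hx hθ)
    rw [div_eq_mul_inv]
    gcongr
    exact (sum_Ioc_inv_sq_le_sub (by omega) hDR).trans (sub_le_self _ (by positivity))
  have hs2 : ∑ d ∈ Ioc D ⌊x⌋₊, (d : ℝ)⁻¹ ≤ C₂ * x ^ η :=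
    (sum_le_sum_of_subset_of_nonneg hsub fun _ _ _ => by positivity).trans
      ((sum_Ioc_inv_le_one_add_log (by linarith)).trans (hL x (by linarith)))
  have hs3 : ∑ d ∈ Ioc D ⌊x⌋₊, S d ≤ C₁ * (√x * x ^ η) :=
    (sum_le_sum_of_subset_of_nonneg hsub fun _ _ _ => Nat.cast_nonneg _).trans
      (hS x (by linarith))
  have hpow : x ^ (θ - η) * x ^ η = x ^ θ := by
    rw [← Real.rpow_add hx0, sub_add_cancel]
  refine (sum_le_sum hpt).trans ?_
  rw [sum_add_distrib, sum_add_distrib, ← mul_sum, ← mul_sum, ← mul_sum, ← mul_sum]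
  calc _ ≤ C ^ 2 * (2 * x ^ (1 / 2 + θ)) + C ^ 2 * (√x * x ^ (θ - η)) * (C₂ * x ^ η)
        + C * x ^ (θ - η) * (C₁ * (√x * x ^ η)) := by gcongr
    _ = C ^ 2 * 2 * x ^ (1 / 2 + θ) + (C ^ 2 * C₂ + C * C₁) * (√x * (x ^ (θ - η) * x ^ η)) := by
        ring
    _ = _ := by
        rw [hpow, sqrt_mul_rpow hx0]
        ring

/-- Asymptotics for the number of coprime pairs in `𝒮(x)` from information on the number of
multiples of a given `d`. -/
lemma exists_norm_coprimePairCount_sub_le {θ κ η : ℝ} (hθ : θ < 1 / 2) (hθ0 : 0 ≤ θ)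
    (hκ : 0 < κ) (hη : 0 < η)
    (hE : ∃ C : ℝ, 0 ≤ C ∧ ∀ x : ℝ, 2 ≤ x → ∀ d : ℕ, 1 ≤ d → (d : ℝ) ≤ x ^ (1 / 2 - θ) →
      |(multipleCount x d : ℝ) - 2 * √x / d| ≤ C * (x ^ θ * (d : ℝ) ^ (-κ)))
    (hT : ∃ C : ℝ, 0 ≤ C ∧ ∀ x : ℝ, 2 ≤ x → ∀ d : ℕ, x ^ (1 / 2 - θ) < d →
      (multipleCount x d : ℝ) ≤ C * (√x / d + x ^ (θ - η))) :
    ∃ C : ℝ, ∀ x : ℝ, 2 ≤ x →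
      ‖(coprimePairCount x : ℂ) - 4 / riemannZeta 2 * (x : ℂ)‖ ≤ C * x ^ (1 / 2 + θ) := by
  obtain ⟨C₁, hC₁, h₁⟩ := exists_sum_abs_multipleCount_sq_sub_le hκ hE
  obtain ⟨C₂, hC₂, h₂⟩ := exists_sum_multipleCount_sq_le hθ hθ0 hη hT
  refine ⟨C₁ + 8 + C₂, fun x hx => ?_⟩
  have hx0 : 0 < x := by linarith
  have h3 : 1 ≤ x ^ (1 / 2 - θ) := Real.one_le_rpow (by linarith) (by linarith)
  have hD1 : 1 ≤ ⌊x ^ (1 / 2 - θ)⌋₊ := Nat.le_floor (by exact_mod_cast h3)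
  have hDR : ⌊x ^ (1 / 2 - θ)⌋₊ ≤ ⌊x⌋₊ := Nat.floor_le_floor <|
    (Real.rpow_le_rpow_of_exponent_le (by linarith) (by linarith)).trans_eq (Real.rpow_one x)
  have h₁ := h₁ x hx
  have h₂ := h₂ x hx
  have h₃ := div_floor_rpow_le hx hθ
  set D := ⌊x ^ (1 / 2 - θ)⌋₊
  have hμ : ∀ d : ℕ, ‖(ArithmeticFunction.moebius d : ℂ)‖ ≤ 1 := fun d => by
    rw [Complex.norm_intCast]
    exact_mod_cast ArithmeticFunction.abs_moebius_le_one
  have e : (coprimePairCount x : ℂ) - 4 / riemannZeta 2 * (x : ℂ)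
      = (∑ d ∈ Ioc 0 D, (ArithmeticFunction.moebius d : ℂ)
          * (((multipleCount x d : ℝ) ^ 2 - 4 * x / (d : ℝ) ^ 2 : ℝ) : ℂ)
        + 4 * (x : ℂ) * (∑ d ∈ Ioc 0 D, (ArithmeticFunction.moebius d : ℂ) / (d : ℂ) ^ 2
          - 1 / riemannZeta 2))
        + ∑ d ∈ Ioc D ⌊x⌋₊, (ArithmeticFunction.moebius d : ℂ)
          * (((multipleCount x d : ℝ) ^ 2 : ℝ) : ℂ) := by
    have h := congrArg (Int.cast : ℤ → ℂ) (coprimePairCount_eq_sum hx0.le)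
    rw [← sum_Ioc_consecutive _ (Nat.zero_le D) hDR] at h
    push_cast at h
    rw [h, mul_sub, mul_sum]
    push_cast
    have : ∀ d : ℕ, (ArithmeticFunction.moebius d : ℂ)
        * ((multipleCount x d : ℂ) ^ 2 - 4 * x / (d : ℂ) ^ 2)
        = (ArithmeticFunction.moebius d : ℂ) * (multipleCount x d : ℂ) ^ 2
          - 4 * x * ((ArithmeticFunction.moebius d : ℂ) / (d : ℂ) ^ 2) := fun d => by ring
    simp only [this, sum_sub_distrib]
    ring
  rw [e]
  refine (norm_add_le _ _).trans ((add_le_add_left (norm_add_le _ _) _).trans ?_)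
  have t1 : ‖∑ d ∈ Ioc 0 D, (ArithmeticFunction.moebius d : ℂ)
      * (((multipleCount x d : ℝ) ^ 2 - 4 * x / (d : ℝ) ^ 2 : ℝ) : ℂ)‖
      ≤ C₁ * x ^ (1 / 2 + θ) := by
    refine (norm_sum_le _ _).trans ((sum_le_sum fun d _ => ?_).trans h₁)
    rw [norm_mul, Complex.norm_real, Real.norm_eq_abs]
    exact mul_le_of_le_one_left (abs_nonneg _) (hμ d)
  have t2 : ‖4 * (x : ℂ) * (∑ d ∈ Ioc 0 D, (ArithmeticFunction.moebius d : ℂ) / (d : ℂ) ^ 2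
      - 1 / riemannZeta 2)‖ ≤ 8 * x ^ (1 / 2 + θ) := by
    rw [norm_mul, norm_mul, Complex.norm_real, Real.norm_of_nonneg hx0.le, Complex.norm_ofNat]
    calc _ ≤ 4 * x * (1 / D) := by
          gcongr
          exact norm_sum_moebius_div_sq_sub_le (by omega)
      _ = 4 * (x / D) := by ring
      _ ≤ 4 * (2 * x ^ (1 / 2 + θ)) := by gcongr
      _ = _ := by ring
  have t3 : ‖∑ d ∈ Ioc D ⌊x⌋₊, (ArithmeticFunction.moebius d : ℂ)
      * (((multipleCount x d : ℝ) ^ 2 : ℝ) : ℂ)‖ ≤ C₂ * x ^ (1 / 2 + θ) := by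
    refine (norm_sum_le _ _).trans ((sum_le_sum fun d _ => ?_).trans h₂)
    rw [norm_mul, Complex.norm_real, Real.norm_of_nonneg (by positivity)]
    exact mul_le_of_le_one_left (by positivity) (hμ d)
  linarith

/-! ### A power saving over x^(1/3) for small d -/

lemma exists_abs_sum_block_sawtooth_le_of_pos :
    ∃ C : ℝ, 0 ≤ C ∧ ∀ X N c δ : ℝ, 1 ≤ N → N ≤ X → 0 < δ →
      |∑ n ∈ Ioc ⌊N⌋₊ ⌊2 * N⌋₊, sawtooth (X / n + c)|
        ≤ 3 * N * δ + C * (1 + Real.log N) *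
          (δ ^ (-(11 / 30) : ℝ) * (X ^ (11 / 30 : ℝ) * N ^ (-(1 / 5) : ℝ))
            + δ ^ (-(61 / 120) : ℝ) * (X ^ (61 / 120 : ℝ) * N ^ (-(11 / 20) : ℝ))
            + X ^ (-(1 / 2) : ℝ) * N ^ (3 / 2 : ℝ)) := by
  obtain ⟨C₀, hC₀, h⟩ := exists_norm_sum_block_div_le
  obtain ⟨C₁, hC₁, h₁⟩ := exists_sum_min_mul_rpow_le (w := 11 / 30) (by norm_num) (by norm_num)
  obtain ⟨C₂, hC₂, h₂⟩ := exists_sum_min_mul_rpow_le (w := 61 / 120) (by norm_num) (by norm_num)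
  obtain ⟨C₃, hC₃, h₃⟩ := sum_min_mul_inv_rpow_le (w := 1 / 2) le_rfl
  refine ⟨C₀ * (C₁ + C₂ + C₃), by positivity, fun X N c δ hN hNX hδ => ?_⟩
  have hN0 : 0 < N := by linarith
  have hX : 0 < X := by linarith
  have hL : 0 ≤ 1 + Real.log N := by linarith [Real.log_nonneg hN]
  set L := C₀ * (1 + Real.log N) with hLdef
  have hL0 : 0 ≤ L := mul_nonneg hC₀ hL
  set A₁ := X ^ (11 / 30 : ℝ) * N ^ (-(1 / 5) : ℝ) with hA₁
  set A₂ := X ^ (61 / 120 : ℝ) * N ^ (-(11 / 20) : ℝ) with hA₂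
  set A₃ := X ^ (-(1 / 2) : ℝ) * N ^ (3 / 2 : ℝ) with hA₃
  have hA₁0 : 0 ≤ A₁ := by positivity
  have hA₂0 : 0 ≤ A₂ := by positivity
  have hA₃0 : 0 ≤ A₃ := by positivity
  set a := δ ^ (-(11 / 30) : ℝ) with ha
  set b := δ ^ (-(61 / 120) : ℝ) with hb
  have ha0 : 0 ≤ a := by positivity
  have hb0 : 0 ≤ b := by positivity
  have hB : ∀ H : ℕ, ∑ i ∈ range H, min (1 / ((i : ℝ) + 1)) (1 / (δ * ((i : ℝ) + 1) ^ 2))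
      * ‖∑ n ∈ Ioc ⌊N⌋₊ ⌊2 * N⌋₊, expTwoPi ((i + 1) * (X / n + c))‖
      ≤ L * A₁ * (C₁ * a) + L * A₂ * (C₂ * b) + L * A₃ * C₃ := by
    intro H
    have hterm : ∀ i ∈ range H, min (1 / ((i : ℝ) + 1)) (1 / (δ * ((i : ℝ) + 1) ^ 2))
        * ‖∑ n ∈ Ioc ⌊N⌋₊ ⌊2 * N⌋₊, expTwoPi ((i + 1) * (X / n + c))‖
        ≤ L * A₁ * (min (1 / ((i : ℝ) + 1)) (1 / (δ * ((i : ℝ) + 1) ^ 2))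
            * ((i : ℝ) + 1) ^ (11 / 30 : ℝ))
          + L * A₂ * (min (1 / ((i : ℝ) + 1)) (1 / (δ * ((i : ℝ) + 1) ^ 2))
            * ((i : ℝ) + 1) ^ (61 / 120 : ℝ))
          + L * A₃ * (min (1 / ((i : ℝ) + 1)) (1 / (δ * ((i : ℝ) + 1) ^ 2))
            * ((i : ℝ) + 1) ^ (-(1 / 2) : ℝ)) := by
      intro i _
      have hi : (0 : ℝ) < (i : ℝ) + 1 := by positivity
      have hi1 : (1 : ℝ) ≤ (i : ℝ) + 1 := by linarith [Nat.cast_nonneg (α := ℝ) i]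
      rw [sum_expTwoPi_mul_add]
      refine (mul_le_mul_of_nonneg_left (h _ N hN (hNX.trans
        (le_mul_of_one_le_left hX.le hi1))) (by positivity)).trans (le_of_eq ?_)
      rw [Real.mul_rpow hi.le hX.le, Real.mul_rpow hi.le hX.le, Real.mul_rpow hi.le hX.le,
        hA₁, hA₂, hA₃]
      ring
    refine (sum_le_sum hterm).trans ?_
    rw [sum_add_distrib, sum_add_distrib, ← mul_sum, ← mul_sum, ← mul_sum]
    gcongr
    · exact h₁ δ H hδ
    · exact h₂ δ H hδ
    · exact h₃ δ H
  refine (abs_sum_sawtooth_le _ _ hδ hB).trans ?_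
  have hc := mul_le_mul_of_nonneg_right (card_block_le (by linarith : 1 / 2 ≤ N)) hδ.le
  have h4 : L * A₁ * (C₁ * a) ≤ L * (C₁ + C₂ + C₃) * (a * A₁) := by
    calc L * A₁ * (C₁ * a) = L * C₁ * (a * A₁) := by ring
      _ ≤ _ := by
        gcongr
        linarith
  have h5 : L * A₂ * (C₂ * b) ≤ L * (C₁ + C₂ + C₃) * (b * A₂) := by
    calc L * A₂ * (C₂ * b) = L * C₂ * (b * A₂) := by ring
      _ ≤ _ := by
        gcongr
        linarith
  have h6 : L * A₃ * C₃ ≤ L * (C₁ + C₂ + C₃) * A₃ := by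
    calc L * A₃ * C₃ = L * C₃ * A₃ := by ring
      _ ≤ _ := by
        gcongr
        linarith
  calc _ ≤ 3 * N * δ + (L * (C₁ + C₂ + C₃) * (a * A₁) + L * (C₁ + C₂ + C₃) * (b * A₂)
        + L * (C₁ + C₂ + C₃) * A₃) := by gcongr
    _ = _ := by
      rw [hLdef]
      ring

lemma abs_sum_block_sawtooth_le (N : ℝ) (hN : 1 / 2 ≤ N) (u : ℕ → ℝ) :
    |∑ n ∈ Ioc ⌊N⌋₊ ⌊2 * N⌋₊, sawtooth (u n)| ≤ 2 * N := by
  refine (abs_sum_le_sum_abs _ _).trans ((sum_le_sum fun n _ => abs_sawtooth_le (u n)).trans ?_)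
  rw [sum_const, nsmul_eq_mul]
  linarith [card_block_le hN]

/-- Short blocks, N ≤ x^(3/10), are bounded trivially. Otherwise N = x^t and X = x^s with t in
[3/10, 1/2] and s in [11/12, 1], and every term becomes a power of x with exponent linear in s and
t. -/
lemma exists_abs_sum_block_sawtooth_le_rpow :
    ∃ C : ℝ, 0 ≤ C ∧ ∀ x X N c : ℝ, 2 ≤ x → x ^ (11 / 12 : ℝ) ≤ X → X ≤ x → 1 / 2 ≤ N →
      N ≤ √x → |∑ n ∈ Ioc ⌊N⌋₊ ⌊2 * N⌋₊, sawtooth (X / n + c)|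
        ≤ C * x ^ (1 / 3 - 1 / 500 : ℝ) := by
  obtain ⟨C₀, hC₀, h⟩ := exists_abs_sum_block_sawtooth_le_of_pos
  obtain ⟨C₁, hC₁, hlog⟩ := exists_one_add_log_le_mul_rpow (η := 1 / 1000) (by norm_num)
  refine ⟨3 + C₀ * C₁ * 3, by positivity, fun x X N c hx hX hXx hN hNx => ?_⟩
  have hx0 : 0 < x := by linarith
  have hx1 : 1 ≤ x := by linarith
  have hN0 : 0 < N := by linarith
  set Z := x ^ (1 / 3 - 1 / 500 : ℝ) with hZ
  have hZ0 : 0 ≤ Z := by positivity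
  rcases le_or_gt N (x ^ (3 / 10 : ℝ)) with hNs | hNs
  · have h1 : x ^ (3 / 10 : ℝ) ≤ Z := Real.rpow_le_rpow_of_exponent_le hx1 (by norm_num)
    have h2 : 0 ≤ C₀ * C₁ * 3 * Z := by positivity
    linarith [abs_sum_block_sawtooth_le N hN fun n => X / n + c]
  · have hN1 : 1 ≤ N := (Real.one_le_rpow hx1 (by norm_num)).trans hNs.le
    have hX0 : 0 < X := lt_of_lt_of_le (by positivity) hX
    have hlx : 0 < Real.log x := Real.log_pos (by linarith)
    obtain ⟨t, ht⟩ : ∃ t : ℝ, N = x ^ t :=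
      ⟨Real.logb x N, (Real.rpow_logb hx0 (by linarith) hN0).symm⟩
    obtain ⟨s, hs⟩ : ∃ s : ℝ, X = x ^ s :=
      ⟨Real.logb x X, (Real.rpow_logb hx0 (by linarith) hX0).symm⟩
    have hxx : 1 < x := by linarith
    have ht1 : 3 / 10 ≤ t := by
      rw [ht] at hNs
      exact ((Real.rpow_lt_rpow_left_iff hxx).1 hNs).le
    have ht2 : t ≤ 1 / 2 := by
      rw [ht, Real.sqrt_eq_rpow] at hNx
      exact (Real.rpow_le_rpow_left_iff hxx).1 hNx
    have hs1 : 11 / 12 ≤ s := by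
      rw [hs] at hX
      exact (Real.rpow_le_rpow_left_iff hxx).1 hX
    have hs2 : s ≤ 1 := by
      rw [hs] at hXx
      exact (Real.rpow_le_rpow_left_iff hxx).1 (by rwa [Real.rpow_one])
    have hNX : N ≤ X := by
      rw [ht, hs]
      exact Real.rpow_le_rpow_of_exponent_le hx1 (by linarith)
    have hlogN : 1 + Real.log N ≤ C₁ * x ^ (1 / 1000 : ℝ) := by
      refine le_trans ?_ (hlog x hx1)
      gcongr
      rw [ht]
      exact (Real.rpow_le_rpow_of_exponent_le hx1 (by linarith)).trans_eq (Real.rpow_one x)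
    have hlogN0 : 0 ≤ 1 + Real.log N := by linarith [Real.log_nonneg hN1]
    set W := x ^ (1 / 3 - 3 / 1000 : ℝ) with hW
    have hW0 : 0 ≤ W := by positivity
    have hWZ : x ^ (1 / 1000 : ℝ) * W = Z := by
      rw [hW, hZ, ← Real.rpow_add hx0]
      norm_num
    -- Chosen so that the smoothing loss Nδ is exactly the target; the other three terms then stay
    -- below x^(1/3 - 3/1000), which leaves room for the logarithm.
    set δ := x ^ (1 / 3 - 1 / 500 - t : ℝ) with hδ
    have e0 : 3 * N * δ = 3 * Z := by
      rw [hδ, ht, mul_assoc, ← Real.rpow_add hx0]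
      congr 2
      ring
    have e1 : δ ^ (-(11 / 30) : ℝ) * (X ^ (11 / 30 : ℝ) * N ^ (-(1 / 5) : ℝ)) ≤ W := by
      rw [hδ, hs, ht, ← Real.rpow_mul hx0.le, ← Real.rpow_mul hx0.le, ← Real.rpow_mul hx0.le,
        ← Real.rpow_add hx0, ← Real.rpow_add hx0]
      exact Real.rpow_le_rpow_of_exponent_le hx1 (by linarith)
    have e2 : δ ^ (-(61 / 120) : ℝ) * (X ^ (61 / 120 : ℝ) * N ^ (-(11 / 20) : ℝ)) ≤ W := by
      rw [hδ, hs, ht, ← Real.rpow_mul hx0.le, ← Real.rpow_mul hx0.le, ← Real.rpow_mul hx0.le,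
        ← Real.rpow_add hx0, ← Real.rpow_add hx0]
      exact Real.rpow_le_rpow_of_exponent_le hx1 (by linarith)
    have e3 : X ^ (-(1 / 2) : ℝ) * N ^ (3 / 2 : ℝ) ≤ W := by
      rw [hs, ht, ← Real.rpow_mul hx0.le, ← Real.rpow_mul hx0.le, ← Real.rpow_add hx0]
      exact Real.rpow_le_rpow_of_exponent_le hx1 (by linarith)
    calc _ ≤ _ := h X N c δ hN1 hNX (by positivity)
      _ ≤ 3 * Z + C₀ * (C₁ * x ^ (1 / 1000 : ℝ)) * (W + W + W) := by
        rw [e0]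
        gcongr
      _ = 3 * Z + C₀ * C₁ * 3 * (x ^ (1 / 1000 : ℝ) * W) := by ring
      _ = _ := by
        rw [hWZ]
        ring

lemma exists_abs_sum_sawtooth_le_rpow :
    ∃ C : ℝ, 0 ≤ C ∧ ∀ x X c : ℝ, 2 ≤ x → x ^ (11 / 12 : ℝ) ≤ X → X ≤ x →
      |∑ n ∈ Ioc 0 ⌊√x⌋₊, sawtooth (X / n + c)| ≤ C * x ^ (1 / 3 - 1 / 1000 : ℝ) := by
  obtain ⟨C₀, hC₀, h⟩ := exists_abs_sum_block_sawtooth_le_rpow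
  obtain ⟨C₁, hC₁, hlog⟩ := exists_one_add_log_le_mul_rpow (η := 1 / 1000) (by norm_num)
  refine ⟨2 * C₁ * C₀, by positivity, fun x X c hx hX hXx => ?_⟩
  have hx0 : 0 < x := by linarith
  have hx1 : 1 ≤ x := by linarith
  have hs1 : 1 ≤ √x := Real.one_le_sqrt.2 hx1
  obtain ⟨J, hJ, -, hsum⟩ := exists_norm_sum_Ioc_le_dyadic
    (fun n : ℕ => sawtooth (X / n + c)) (√x) hs1 _
    (fun M hM hM2 => h x X M c hx hX hXx hM (by linarith))
  refine hsum.trans ?_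
  rw [sum_const, card_range, nsmul_eq_mul]
  have hJ' : (J : ℝ) ≤ 2 * (C₁ * x ^ (1 / 1000 : ℝ)) := by
    refine hJ.trans (le_trans ?_ (mul_le_mul_of_nonneg_left (hlog x hx1) (by norm_num)))
    have h2 : Real.log (√x) / Real.log 2 ≤ 2 * Real.log x := by
      rw [Real.log_sqrt hx0.le, div_le_iff₀ (Real.log_pos (by norm_num))]
      nlinarith [Real.log_two_gt_d9, Real.log_nonneg hx1]
    linarith
  calc _ ≤ 2 * (C₁ * x ^ (1 / 1000 : ℝ)) * (C₀ * x ^ (1 / 3 - 1 / 500 : ℝ)) := by gcongr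
    _ = 2 * C₁ * C₀ * (x ^ (1 / 1000 : ℝ) * x ^ (1 / 3 - 1 / 500 : ℝ)) := by ring
    _ = _ := by
      rw [← Real.rpow_add hx0]
      norm_num

/-! ### The number of multiples of d for small and for large d -/

lemma exists_abs_multipleCount_sub_le {θ κ : ℝ} (hθ : 1 / 4 < θ) (hκ : 0 < κ)
    (hU : ∃ C : ℝ, 0 ≤ C ∧ ∀ x : ℝ, 2 ≤ x → ∀ d : ℕ, 1 ≤ d → (d : ℝ) ≤ x ^ (1 / 2 - θ) →
      ∀ c : ℝ, |∑ n ∈ Ioc 0 ⌊√x⌋₊, sawtooth (x / d / n + c)|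
        ≤ C * (x ^ θ * (d : ℝ) ^ (-κ) + d)) :
    ∃ κ' : ℝ, 0 < κ' ∧ ∃ C : ℝ, 0 ≤ C ∧ ∀ x : ℝ, 2 ≤ x → ∀ d : ℕ, 1 ≤ d →
      (d : ℝ) ≤ x ^ (1 / 2 - θ) →
      |(multipleCount x d : ℝ) - 2 * √x / d| ≤ C * (x ^ θ * (d : ℝ) ^ (-κ')) := by
  obtain ⟨C, hC, hU⟩ := hU
  -- The extra term d is at most x^(1/2-θ) ≤ x^(1/4) because θ > 1/4, and κ' ≤ θ - 1/4 gives x^(1/4)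
  -- d^κ' ≤ x^θ, so it is absorbed.
  refine ⟨min κ (θ - 1 / 4), lt_min hκ (by linarith), 4 * C + 4, by positivity,
    fun x hx d hd hdx => ?_⟩
  have hx0 : 0 < x := by linarith
  have hx1 : 1 ≤ x := by linarith
  have hd1 : (1 : ℝ) ≤ d := by exact_mod_cast hd
  have hd0 : (0 : ℝ) < d := by linarith
  set κ' := min κ (θ - 1 / 4)
  have hκ' : 0 ≤ κ' := le_min hκ.le (by linarith)
  set Z := x ^ θ * (d : ℝ) ^ (-κ') with hZ
  have hd4 : (d : ℝ) ≤ x ^ (1 / 4 : ℝ) :=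
    hdx.trans (Real.rpow_le_rpow_of_exponent_le hx1 (by linarith))
  have hdx' : (d : ℝ) ≤ x := hd4.trans
    ((Real.rpow_le_rpow_of_exponent_le hx1 (by norm_num)).trans_eq (Real.rpow_one x))
  have h1 : x ^ (1 / 4 : ℝ) ≤ Z := by
    rw [hZ, Real.rpow_neg hd0.le, ← div_eq_mul_inv, le_div_iff₀ (by positivity)]
    calc x ^ (1 / 4 : ℝ) * (d : ℝ) ^ κ' ≤ x ^ (1 / 4 : ℝ) * x ^ (θ - 1 / 4) := by
          gcongr
          exact (Real.rpow_le_rpow hd0.le hdx' hκ').trans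
            (Real.rpow_le_rpow_of_exponent_le hx1 (min_le_right _ _))
      _ = x ^ θ := by
          rw [← Real.rpow_add hx0]
          congr 1
          ring
  have h2 : x ^ θ * (d : ℝ) ^ (-κ) ≤ Z := by
    refine mul_le_mul_of_nonneg_left ?_ (by positivity)
    exact Real.rpow_le_rpow_of_exponent_le hd1 (neg_le_neg (min_le_left _ _))
  have h3 : 1 ≤ x ^ (1 / 4 : ℝ) := Real.one_le_rpow hx1 (by norm_num)
  calc _ ≤ 2 * (C * (x ^ θ * (d : ℝ) ^ (-κ) + d)) + 4 :=
        abs_multipleCount_sub_le hx1 hd (hU x hx d hd hdx)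
    _ ≤ 2 * (C * (Z + Z)) + 4 * Z := by
        have h4 : (d : ℝ) ≤ Z := hd4.trans h1
        have h5 : 1 ≤ Z := h3.trans h1
        gcongr
        linarith
    _ = _ := by ring

lemma sqrt_rpow_mul_div_rpow {x d : ℝ} (hx : 0 < x) (hd : 0 < d) {k l : ℝ} (hk : 0 < k + 1) :
    √x ^ ((l - k) / (k + 1)) * (x / d) ^ (k / (k + 1))
      = x ^ ((k + l) / (2 * k + 2)) * d ^ (-(k / (k + 1))) := by
  rw [Real.sqrt_eq_rpow, ← Real.rpow_mul hx.le, Real.div_rpow hx.le hd.le, Real.rpow_neg hd.le,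
    ← div_eq_mul_inv, ← mul_div_assoc, ← Real.rpow_add hx]
  congr 2
  field_simp
  ring

/-- A bound for `multipleCount` by splitting the values of `⌊x / n⌋` at `x / N`. -/
lemma BoundsReciprocalPhase.exists_multipleCount_le {k l : ℝ}
    (h : BoundsReciprocalPhase k l) (hk : 0 < k) (hk1 : k < 1) (hkl : k ≤ l) :
    ∃ C : ℝ, 0 ≤ C ∧ ∀ (x N : ℝ) (d : ℕ), 2 ≤ x → 1 ≤ d → 0 < N → N ≤ √x →
      (multipleCount x d : ℝ) ≤ x / d / N + √x / d
        + C * ((1 + Real.log x) * (x ^ ((k + l) / (2 * k + 2)) * (d : ℝ) ^ (-(k / (k + 1))))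
          + N ^ 2 / (x / d)) := by
  obtain ⟨C, hC, h⟩ := h.exists_abs_sum_sawtooth_le_log hk hk1 hkl
  refine ⟨2 * C, by positivity, fun x N d hx hd hN hNx => ?_⟩
  have hx0 : 0 < x := by linarith
  have hd0 : (0 : ℝ) < d := by exact_mod_cast hd
  have hlog : 0 ≤ 1 + Real.log x := by linarith [Real.log_nonneg (by linarith : 1 ≤ x)]
  have h1 := multipleCount_le hx0.le (div_pos hx0 hN) d
  rw [div_div_cancel₀ hx0.ne', div_right_comm] at h1
  refine h1.trans ?_
  rw [add_assoc]
  gcongr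
  rcases lt_or_ge N 1 with hN1 | hN1
  · rw [Nat.floor_eq_zero.2 hN1]
    have h2 : hitCount x d 0 = 0 := by simp [hitCount]
    rw [h2, Nat.cast_zero]
    positivity
  · have h2 := (abs_le.1 (abs_hitCount_sub_le hx0.le hd
      (fun c => h (x / d) N c (by positivity) hN1))).2
    have h3 : (⌊N⌋₊ : ℝ) / d ≤ √x / d := by
      gcongr
      exact (Nat.floor_le hN.le).trans hNx
    have hNx' : N ≤ x := hNx.trans (Real.sqrt_le_iff.2 ⟨by linarith, by nlinarith⟩)
    have h4 : (1 + Real.log N) * (N ^ ((l - k) / (k + 1)) * (x / d) ^ (k / (k + 1)))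
        ≤ (1 + Real.log x)
          * (x ^ ((k + l) / (2 * k + 2)) * (d : ℝ) ^ (-(k / (k + 1)))) := by
      rw [← sqrt_rpow_mul_div_rpow hx0 hd0 (by linarith)]
      have : 0 ≤ (l - k) / (k + 1) := div_nonneg (by linarith) (by linarith)
      gcongr
    have h5 := mul_le_mul_of_nonneg_left h4 hC
    linarith

lemma BoundsReciprocalPhase.exists_multipleCount_le_of_lt {k l : ℝ}
    (h : BoundsReciprocalPhase k l) (hk : 0 < k) (hk1 : k < 1) (hkl : k ≤ l)
    (hθ : 1 / 4 < (k + l) / (2 * k + 2)) (hθ1 : (k + l) / (2 * k + 2) < 1 / 2) :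
    ∃ η : ℝ, 0 < η ∧ ∃ C : ℝ, 0 ≤ C ∧ ∀ x : ℝ, 2 ≤ x → ∀ d : ℕ,
      x ^ (1 / 2 - (k + l) / (2 * k + 2)) < d →
      (multipleCount x d : ℝ) ≤ C * (√x / d + x ^ ((k + l) / (2 * k + 2) - η)) := by
  obtain ⟨C, hC, h⟩ := h.exists_multipleCount_le hk hk1 hkl
  set θ := (k + l) / (2 * k + 2)
  set κ := k / (k + 1) with hκdef
  have hκ : 0 < κ := by positivity
  -- For d > x^(1/2-θ) the factor d^(-κ) saves x^(-2η): half pays for the logarithm and half is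
  -- kept. The second entry ensures x^(1/4) ≤ x^(θ-η).
  set η := min (κ * (1 / 2 - θ) / 2) (θ - 1 / 4)
  have hη : 0 < η := lt_min (by nlinarith) (by linarith)
  obtain ⟨C₁, hC₁, hlog⟩ := exists_one_add_log_le_mul_rpow hη
  refine ⟨η, hη, 2 + C * (C₁ + 1), by positivity, fun x hx d hdx => ?_⟩
  have hx0 : 0 < x := by linarith
  have hx1 : 1 ≤ x := by linarith
  have hd0 : (0 : ℝ) < d := lt_of_le_of_lt (by positivity) hdx
  have hd : 1 ≤ d := by exact_mod_cast hd0
  have hxd : 0 < x / d := by positivity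
  set Z := x ^ (θ - η) with hZ
  have hZ4 : x ^ (1 / 4 : ℝ) ≤ Z := by
    refine Real.rpow_le_rpow_of_exponent_le hx1 ?_
    linarith [min_le_right (κ * (1 / 2 - θ) / 2) (θ - 1 / 4)]
  have hL : (1 + Real.log x) * (x ^ θ * (d : ℝ) ^ (-κ)) ≤ C₁ * Z := by
    have h1 : (d : ℝ) ^ (-κ) ≤ x ^ (-(2 * η)) := by
      calc (d : ℝ) ^ (-κ) ≤ (x ^ (1 / 2 - θ)) ^ (-κ) :=
            Real.rpow_le_rpow_of_nonpos (by positivity) hdx.le (by linarith)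
        _ = x ^ ((1 / 2 - θ) * -κ) := (Real.rpow_mul hx0.le _ _).symm
        _ ≤ x ^ (-(2 * η)) := by
            refine Real.rpow_le_rpow_of_exponent_le hx1 ?_
            linarith [min_le_left (κ * (1 / 2 - θ) / 2) (θ - 1 / 4)]
    calc _ ≤ C₁ * x ^ η * (x ^ θ * x ^ (-(2 * η))) := by
          gcongr
          exact hlog x hx1
      _ = C₁ * (x ^ η * (x ^ θ * x ^ (-(2 * η)))) := by ring
      _ = C₁ * Z := by
          rw [hZ, ← Real.rpow_add hx0, ← Real.rpow_add hx0]
          congr 2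
          ring
  have hZ0 : 0 ≤ Z := by positivity
  have hs0 : 0 ≤ √x / d := by positivity
  rcases le_or_gt (d : ℝ) (x ^ (1 / 4 : ℝ)) with hd4 | hd4
  · have h1 := h x (√x) d hx hd (Real.sqrt_pos.2 hx0) le_rfl
    rw [div_right_comm, Real.div_sqrt, Real.sq_sqrt hx0.le, div_div_cancel₀ hx0.ne'] at h1
    calc _ ≤ _ := h1
      _ ≤ √x / d + √x / d + C * (C₁ * Z + Z) := by
          gcongr
          exact hd4.trans hZ4
      _ = 2 * (√x / d) + C * (C₁ + 1) * Z := by ring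
      _ ≤ (2 + C * (C₁ + 1)) * (√x / d) + (2 + C * (C₁ + 1)) * Z := by
          gcongr
          · exact le_add_of_nonneg_right (by positivity)
          · exact le_add_of_nonneg_left (by norm_num)
      _ = _ := by ring
  -- For d > x^(1/4) the choice N = √x would leave the term d. Taking N = (x/d)^(2/3) equalises
  -- x/(dN) and N²/(x/d), both being (x/d)^(1/3) ≤ x^(1/4).
  · have hY : x / d ≤ x ^ (3 / 4 : ℝ) := by
      rw [div_le_iff₀ hd0]
      calc x = x ^ (3 / 4 : ℝ) * x ^ (1 / 4 : ℝ) := by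
            rw [← Real.rpow_add hx0]
            norm_num
        _ ≤ _ := by gcongr
    have hY3 : (x / d) ^ (1 / 3 : ℝ) ≤ Z := by
      refine le_trans ?_ hZ4
      calc (x / d) ^ (1 / 3 : ℝ) ≤ (x ^ (3 / 4 : ℝ)) ^ (1 / 3 : ℝ) := by gcongr
        _ = _ := by
          rw [← Real.rpow_mul hx0.le]
          norm_num
    have hN : (x / d) ^ (2 / 3 : ℝ) ≤ √x := by
      calc (x / d) ^ (2 / 3 : ℝ) ≤ (x ^ (3 / 4 : ℝ)) ^ (2 / 3 : ℝ) := by gcongr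
        _ = _ := by
          rw [← Real.rpow_mul hx0.le, Real.sqrt_eq_rpow]
          norm_num
    have h1 := h x _ d hx hd (by positivity : 0 < (x / d) ^ (2 / 3 : ℝ)) hN
    have e1 : x / d / (x / d) ^ (2 / 3 : ℝ) = (x / d) ^ (1 / 3 : ℝ) := by
      rw [← Real.rpow_one_sub' hxd.le (by norm_num)]
      norm_num
    have e2 : ((x / d) ^ (2 / 3 : ℝ)) ^ 2 / (x / d) = (x / d) ^ (1 / 3 : ℝ) := by
      rw [← Real.rpow_natCast, ← Real.rpow_mul hxd.le, ← Real.rpow_sub_one hxd.ne']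
      norm_num
    rw [e1, e2] at h1
    calc _ ≤ _ := h1
      _ ≤ Z + √x / d + C * (C₁ * Z + Z) := by gcongr
      _ = 1 * (√x / d) + (1 + C * (C₁ + 1)) * Z := by ring
      _ ≤ (2 + C * (C₁ + 1)) * (√x / d) + (2 + C * (C₁ + 1)) * Z := by
          have : 0 ≤ C * (C₁ + 1) := by positivity
          gcongr <;> linarith
      _ = _ := by ring

lemma BoundsReciprocalPhase.exists_abs_sum_sawtooth_sqrt_le {k l : ℝ}
    (h : BoundsReciprocalPhase k l) (hk : 0 < k) (hk1 : k < 1) (hkl : k < l) :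
    ∃ C : ℝ, 0 ≤ C ∧ ∀ x : ℝ, 2 ≤ x → ∀ d : ℕ, 1 ≤ d →
      (d : ℝ) ≤ x ^ (1 / 2 - (k + l) / (2 * k + 2)) →
      ∀ c : ℝ, |∑ n ∈ Ioc 0 ⌊√x⌋₊, sawtooth (x / d / n + c)|
        ≤ C * (x ^ ((k + l) / (2 * k + 2)) * (d : ℝ) ^ (-(k / (k + 1))) + d) := by
  obtain ⟨C, hC, h⟩ := h.exists_abs_sum_sawtooth_le hk hk1 hkl
  refine ⟨C, hC, fun x hx d hd _ c => ?_⟩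
  have hx0 : 0 < x := by linarith
  have hd0 : (0 : ℝ) < d := by exact_mod_cast hd
  have h1 := h (x / d) (√x) c (by positivity) (Real.one_le_sqrt.2 (by linarith))
  rwa [Real.sq_sqrt hx0.le, div_div_cancel₀ hx0.ne',
    sqrt_rpow_mul_div_rpow hx0 hd0 (by linarith)] at h1

/-- At k = l = 1/2 the exponent-pair bound carries a logarithm. For large d a part of d^(-1/3)
absorbs it; for small d the power saving from the dual sum is used instead. -/
lemma BoundsReciprocalPhase.exists_abs_sum_sawtooth_sqrt_le_half
    (h : BoundsReciprocalPhase (1 / 2) (1 / 2)) :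
    ∃ C : ℝ, 0 ≤ C ∧ ∀ x : ℝ, 2 ≤ x → ∀ d : ℕ, 1 ≤ d →
      ∀ c : ℝ, |∑ n ∈ Ioc 0 ⌊√x⌋₊, sawtooth (x / d / n + c)|
        ≤ C * (x ^ (1 / 3 : ℝ) * (d : ℝ) ^ (-(3 / 250) : ℝ) + d) := by
  obtain ⟨C₀, hC₀, h⟩ := h.exists_abs_sum_sawtooth_le_log (by norm_num) (by norm_num) le_rfl
  obtain ⟨C₁, hC₁, h'⟩ := exists_abs_sum_sawtooth_le_rpow
  obtain ⟨C₂, hC₂, hlog⟩ := exists_one_add_log_le_mul_rpow (η := 1 / 100) (by norm_num)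
  refine ⟨C₁ + C₀ * (C₂ + 1), by positivity, fun x hx d hd c => ?_⟩
  have hx0 : 0 < x := by linarith
  have hx1 : 1 ≤ x := by linarith
  have hd1 : (1 : ℝ) ≤ d := by exact_mod_cast hd
  have hd0 : (0 : ℝ) < d := by linarith
  set Z := x ^ (1 / 3 : ℝ) * (d : ℝ) ^ (-(3 / 250) : ℝ) with hZ
  have hZ0 : 0 ≤ Z := by positivity
  -- Below this cut X = x/d ≥ x^(11/12), as the power saving requires, and x^(-1/1000) ≤ d^(-3/250)
  -- because 1/1000 = (1/12)(3/250).
  rcases le_or_gt (d : ℝ) (x ^ (1 / 12 : ℝ)) with hdx | hdx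
  · have h1 : x ^ (11 / 12 : ℝ) ≤ x / d := by
      rw [le_div_iff₀ hd0]
      calc _ ≤ x ^ (11 / 12 : ℝ) * x ^ (1 / 12 : ℝ) := by gcongr
        _ = x := by
          rw [← Real.rpow_add hx0]
          norm_num
    refine (h' x (x / d) c hx h1 (div_le_self hx0.le hd1)).trans ?_
    have h2 : x ^ (1 / 3 - 1 / 1000 : ℝ) ≤ Z := by
      rw [hZ, sub_eq_add_neg, Real.rpow_add hx0]
      gcongr
      calc x ^ (-(1 / 1000) : ℝ) = (x ^ (1 / 12 : ℝ)) ^ (-(3 / 250) : ℝ) := by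
            rw [← Real.rpow_mul hx0.le]
            norm_num
        _ ≤ _ := Real.rpow_le_rpow_of_nonpos hd0 hdx (by norm_num)
    gcongr
    · exact le_add_of_nonneg_right (by positivity)
    · linarith
  · have h1 := h (x / d) (√x) c (by positivity) (Real.one_le_sqrt.2 hx1)
    rw [Real.sq_sqrt hx0.le, div_div_cancel₀ hx0.ne',
      sqrt_rpow_mul_div_rpow hx0 hd0 (by norm_num)] at h1
    norm_num at h1
    have h2 : 1 + Real.log (√x) ≤ C₂ * x ^ (1 / 100 : ℝ) := by
      refine le_trans ?_ (hlog x hx1)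
      rw [Real.log_sqrt hx0.le]
      linarith [Real.log_nonneg hx1]
    have h3 : x ^ (1 / 100 : ℝ) * (x ^ (1 / 3 : ℝ) * (d : ℝ) ^ (-(1 / 3) : ℝ)) ≤ Z := by
      have h4 : x ^ (1 / 100 : ℝ) * (d : ℝ) ^ (-(1 / 3) : ℝ) ≤ (d : ℝ) ^ (-(3 / 250) : ℝ) := by
        have h5 : x ^ (1 / 100 : ℝ) ≤ (d : ℝ) ^ (1 / 3 - 3 / 250 : ℝ) := by
          calc x ^ (1 / 100 : ℝ) ≤ x ^ (1 / 12 * (1 / 3 - 3 / 250) : ℝ) :=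
                Real.rpow_le_rpow_of_exponent_le hx1 (by norm_num)
            _ = (x ^ (1 / 12 : ℝ)) ^ (1 / 3 - 3 / 250 : ℝ) := Real.rpow_mul hx0.le _ _
            _ ≤ _ := Real.rpow_le_rpow (by positivity) hdx.le (by norm_num)
        calc _ ≤ (d : ℝ) ^ (1 / 3 - 3 / 250 : ℝ) * (d : ℝ) ^ (-(1 / 3) : ℝ) := by gcongr
          _ = _ := by
            rw [← Real.rpow_add hd0]
            norm_num
      calc _ = x ^ (1 / 3 : ℝ) * (x ^ (1 / 100 : ℝ) * (d : ℝ) ^ (-(1 / 3) : ℝ)) := by ring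
        _ ≤ _ := mul_le_mul_of_nonneg_left h4 (by positivity)
    calc _ ≤ _ := h1
      _ ≤ C₀ * (C₂ * x ^ (1 / 100 : ℝ) * (x ^ (1 / 3 : ℝ) * (d : ℝ) ^ (-(1 / 3) : ℝ)) + d) := by
          gcongr
      _ = C₀ * (C₂ * (x ^ (1 / 100 : ℝ) * (x ^ (1 / 3 : ℝ) * (d : ℝ) ^ (-(1 / 3) : ℝ))) + d) := by
          ring
      _ ≤ C₀ * (C₂ * Z + d) := by gcongr
      _ ≤ (C₁ + C₀ * (C₂ + 1)) * (Z + d) := by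
          have h6 : 0 ≤ C₁ * (Z + d) := by positivity
          have h7 : 0 ≤ C₀ * (C₂ * d + Z) := by positivity
          linarith

lemma exists_norm_coprimePairCount_sub_le_self : ∃ C : ℝ, ∀ x : ℝ, 2 ≤ x →
    ‖(coprimePairCount x : ℂ) - 4 / riemannZeta 2 * (x : ℂ)‖ ≤ C * x := by
  refine ⟨4 + ‖4 / riemannZeta 2‖, fun x hx => ?_⟩
  have hx0 : 0 < x := by linarith
  have h1 : (coprimePairCount x : ℝ) ≤ 4 * x := by
    have h2 : (coprimePairCount x : ℝ) ≤ (floorQuotients x).card * (floorQuotients x).card := by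
      rw [← Nat.cast_mul, ← card_product]
      exact Nat.cast_le.2 (card_filter_le _ _)
    have h3 := card_floorQuotients_le (by linarith : 1 ≤ x)
    calc _ ≤ _ := h2
      _ ≤ 2 * √x * (2 * √x) := by gcongr
      _ = 4 * (√x * √x) := by ring
      _ = 4 * x := by rw [Real.mul_self_sqrt hx0.le]
  refine (norm_sub_le _ _).trans ?_
  rw [norm_mul, Complex.norm_natCast, Complex.norm_real, Real.norm_of_nonneg hx0.le, add_mul]
  gcongr

end

/-! ### Conclusion -/

theorem theorem1p2 (k l : ℝ) (hkl : IsExponentPair k l) :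
    ∃ C : ℝ, ∀ x : ℝ, 2 ≤ x →
      ‖(coprimePairCount x : ℂ) - 4 / riemannZeta 2 * (x : ℂ)‖
        ≤ C * x ^ (1 / 2 + (k + l) / (2 * k + 2)) := by
  have hb := hkl.boundsReciprocalPhase
  obtain ⟨hk0, hk2, hl2, hl1, -⟩ := hkl
  have hk3 : 0 < 2 * k + 2 := by linarith
  -- For l = 1 the claimed error is of order x, and #𝒮(x) ≤ 2√x suffices.
  rcases hl1.eq_or_lt with rfl | hl1
  · obtain ⟨C, h⟩ := exists_norm_coprimePairCount_sub_le_self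
    refine ⟨C, fun x hx => (h x hx).trans_eq ?_⟩
    have : 1 / 2 + (k + 1) / (2 * k + 2) = 1 := by
      have : k + 1 ≠ 0 := by linarith
      field_simp
      norm_num
    rw [this, Real.rpow_one]
  have hk : 0 < k := by
    refine hk0.lt_of_ne fun h0 => ?_
    subst h0
    linarith [hb.one_le]
  -- This is k/2 + l > 1/2, where k > 0 makes the inequality strict; the bound θ < 1/2 below is l <
  -- 1.
  have hθ : 1 / 4 < (k + l) / (2 * k + 2) := by
    rw [lt_div_iff₀ hk3]
    linarith
  have hθ1 : (k + l) / (2 * k + 2) < 1 / 2 := by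
    rw [div_lt_iff₀ hk3]
    linarith
  obtain ⟨η, hη, hT⟩ := hb.exists_multipleCount_le_of_lt hk (by linarith) (by linarith) hθ hθ1
  have hU : ∃ κ : ℝ, 0 < κ ∧ ∃ C : ℝ, 0 ≤ C ∧ ∀ x : ℝ, 2 ≤ x → ∀ d : ℕ, 1 ≤ d →
      (d : ℝ) ≤ x ^ (1 / 2 - (k + l) / (2 * k + 2)) →
      ∀ c : ℝ, |∑ n ∈ Finset.Ioc 0 ⌊√x⌋₊, sawtooth (x / d / n + c)|
        ≤ C * (x ^ ((k + l) / (2 * k + 2)) * (d : ℝ) ^ (-κ) + d) := by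
    -- Since k ≤ 1/2 ≤ l, equality leaves only the pair (1/2, 1/2).
    rcases (hk2.trans hl2).eq_or_lt with _ | hlt
    · have hk' : k = 1 / 2 := by linarith
      have hl' : l = 1 / 2 := by linarith
      subst hk' hl'
      obtain ⟨C, hC, h⟩ := hb.exists_abs_sum_sawtooth_sqrt_le_half
      refine ⟨3 / 250, by norm_num, C, hC, fun x hx d hd _ c => ?_⟩
      convert! h x hx d hd c using 5
      norm_num
    · exact ⟨k / (k + 1), by positivity,
        hb.exists_abs_sum_sawtooth_sqrt_le hk (by linarith) hlt⟩
  obtain ⟨κ, hκ, hU⟩ := hU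
  obtain ⟨κ', hκ', hE⟩ := exists_abs_multipleCount_sub_le hθ hκ hU
  exact exists_norm_coprimePairCount_sub_le hθ1 (by linarith) hκ' hη hE hT
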